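/- Let $\mathcal K$ be an abstract elementary class and $\mu\ge \mathrm{LS}(\mathcal K)$ a cardinal; $\mathcal K_\mu$ is the class of models in $\mathcal K$ of cardinality $\mu$ and $\operatorname{ga-S}(M)$ the set of Galois types over $M$. For $N\prec_{\mathcal K}M$ in $\mathcal K_\mu$, $M$ is *universal over* $N$ if every $M'\in\mathcal K_\mu$ with $N\prec_{\mathcal K}M'$ has a $\mathcal K$-embedding into $M$ over $N$. For a limit ordinal $\theta<\mu^+$, $M$ is a *$(\mu,\theta)$-limit model over* $N$, *witnessed by* $\langle M_i\mid i<\theta\rangle$, if this is an increasing continuous chain in $\mathcal K_\mu$ with $M_0=N$, $M=\bigcup_{i<\theta}M_i$ and each $M_{i+1}$ universal over $M_i$; $M$ is a *limit model* if this holds for some $N$ and $\theta$. A type $p\in\operatorname{ga-S}(M)$ *$\mu$-splits over* $N\prec_{\mathcal K}M$ if there are $N_1,N_2\in\mathcal K_\mu$ with $N\prec_{\mathcal K}N_l\prec_{\mathcal K}M$ and an isomorphism $h:N_1\cong N_2$ over $N$ with $h(p\restriction N_1)\ne p\restriction N_2$. Let $\kappa^*_\mu(\mathcal K)$ be the least regular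 cardinal $\kappa<\mu^+$ such that for every regular $\theta\ge\kappa$, every increasing continuous $\langle M_i\in\mathcal K_\mu\mid i\le\theta\rangle$ with $M_{i+1}$ universal over $M_i$ for all $i<\theta$, and every non-algebraic $p\in\operatorname{ga-S}(M_\theta)$, there is $i<\theta$ such that $p$ does not $\mu$-split over $M_i$ (and $\kappa^*_\mu(\mathcal K)=\infty$ if there is no such $\kappa$). Assume: 1. $\mathcal K_\mu$ has joint embedding, amalgamation and no maximal models; 2. $\mathcal K$ is Galois-stable in $\mu$: $|\operatorname{ga-S}(M)|\le\mu$ for all $M\in\mathcal K_\mu$; 3. $\kappa^*_\mu(\mathcal K)<\mu^+$; 4. (limit continuity) if $M$ is a limit model witnessed by $\langle M_i\mid i<\theta\rangle$ with $\theta<\mu^+$ a limit ordinal, $N\in\mathcal K_\mu$, $N\prec_{\mathcal K}M_0$, $p\in\operatorname{ga-S}(M)$, and $p\restriction M_i$ does not $\mu$-split over $N$ for all $i<\theta$, then $p$ does not $\mu$-split over $N$. Let $\alpha$ be an ordinal and $\delta<\alpha$ a limit ordinal with $\kappa^*_\mu(\mathcal K)\le\operatorname{cf}(\delta)$. Assume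 *$(\mu,\delta)$-symmetry for non-$\mu$-splitting*: whenever $N,M_0,M\in\mathcal K_\mu$ and elements $a,b$ are such that $M$ is universal over $M_0$, $M_0$ is a $(\mu,\delta)$-limit model over $N$, $a\in M\setminus M_0$, $\operatorname{tp}(a/M_0)$ is non-algebraic and does not $\mu$-split over $N$, and $\operatorname{tp}(b/M)$ is non-algebraic and does not $\mu$-split over $M_0$, there is a limit model $M^b$ over $M_0$ containing $b$ such that $\operatorname{tp}(a/M^b)$ does not $\mu$-split over $N$ (here $b$ lies in some extension of $M$ in $\mathcal K_\mu$, and $M^b$ is found in some further extension in $\mathcal K_\mu$). Let $\mathcal K^*_{\mu,\alpha}$ be the class of *towers* $(\bar M,\bar a,\bar N)$ of length $\alpha$: $\bar M=\langle M_i\mid i<\alpha\rangle$ is a $\prec_{\mathcal K}$-increasing (not necessarily continuous) sequence of limit models in $\mathcal K_\mu$, and for $i+1<\alpha$, $a_i\in M_{i+1}\setminus M_i$, $N_i\in\mathcal K_\mu$, $N_i\prec_{\mathcal K}M_i$, $M_i$ is universal over $N_i$ and $\operatorname{tp}(a_i/M_i)$ does not $\mu$-split over $N_i$. Write $(\bar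 M,\bar a,\bar N)\le(\bar M',\bar a',\bar N')$ if $\bar a=\bar a'$, $\bar N=\bar N'$ and, for all $i<\alpha$, $M_i\preceq_{\mathcal K}M'_i$ and $M'_i$ is universal over $M_i$ whenever $M'_i\ne M_i$. The tower $(\bar M,\bar a,\bar N)$ is *reduced* if for every $(\bar M',\bar a,\bar N)\in\mathcal K^*_{\mu,\alpha}$ with $(\bar M,\bar a,\bar N)\le(\bar M',\bar a,\bar N)$ and every $i<\alpha$, $M'_i\cap\bigcup_{j<\alpha}M_j=M_i$. Then every reduced tower $(\bar M,\bar a,\bar N)\in\mathcal K^*_{\mu,\alpha}$ is continuous at $\delta$, that is, $M_\delta=\bigcup_{\beta<\delta}M_\beta$. -/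

import Mathlib

open scoped FirstOrder Cardinal
open FirstOrder FirstOrder.Language Order

universe u v w

/-- An abstract elementary class of `L`-structures.  It is presented through its strong embeddings:
`Strong f`, for `f : M ↪[L] N`, says that `N` is in the class and `f[M] ≺_K N`; in particular
`S ≺_K N` for a substructure `S` of `N` means `Strong S.subtype`.  -/
structure AEC (L : FirstOrder.Language.{u, v}) where
  /-- membership of a structure in the class -/
  Mem : ∀ (M : Type w) [L.Structure M], Prop
  /-- `f[M] ≺_K N` -/
  Strong : ∀ {M N : Type w} [L.Structure M] [L.Structure N], (M ↪[L] N) → Prop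
  mem_dom : ∀ {M N : Type w} [L.Structure M] [L.Structure N] {f : M ↪[L] N}, Strong f → Mem M
  mem_cod : ∀ {M N : Type w} [L.Structure M] [L.Structure N] {f : M ↪[L] N}, Strong f → Mem N
  /-- closure under isomorphism, and reflexivity of `≺_K` -/
  strong_equiv : ∀ {M N : Type w} [L.Structure M] [L.Structure N] (e : M ≃[L] N),
    Mem M → Strong e.toEmbedding
  /-- transitivity of `≺_K` -/
  strong_comp : ∀ {M N P : Type w} [L.Structure M] [L.Structure N] [L.Structure P]
    {f : M ↪[L] N} {g : N ↪[L] P}, Strong f → Strong g → Strong (g.comp f)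
  /-- coherence: if `M ⊆ N ≺_K P` and `M ≺_K P` then `M ≺_K N` -/
  coherence : ∀ {M N P : Type w} [L.Structure M] [L.Structure N] [L.Structure P]
    {f : M ↪[L] N} {g : N ↪[L] P}, Strong g → Strong (g.comp f) → Strong f
  /-- Tarski–Vaught, first part: the union `A` of a `≺_K`-increasing chain is in the class and
  every member of the chain is `≺_K A` -/
  chain_strong : ∀ {A : Type w} [L.Structure A] (o : Ordinal.{w}) (S : Ordinal.{w} → L.Substructure A),
    IsSuccLimit o →
    (∀ i j, i ≤ j → j < o → ∃ h : S i ≤ S j, Strong (Substructure.inclusion h)) →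
    (∀ x : A, ∃ i < o, x ∈ S i) →
    ∀ i < o, Strong (S i).subtype
  /-- Tarski–Vaught, second part: if every member of the chain is `≺_K B`, so is the union `A` -/
  chain_lift : ∀ {A B : Type w} [L.Structure A] [L.Structure B] (o : Ordinal.{w})
    (S : Ordinal.{w} → L.Substructure A) (f : A ↪[L] B),
    IsSuccLimit o →
    (∀ i j, i ≤ j → j < o → ∃ h : S i ≤ S j, Strong (Substructure.inclusion h)) →
    (∀ x : A, ∃ i < o, x ∈ S i) →
    (∀ i < o, Strong (f.comp (S i).subtype)) → Strong f
  /-- downward Löwenheim–Skolem: there is a Löwenheim–Skolem cardinal -/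
  exists_ls : ∃ κ : Cardinal.{w}, ℵ₀ ≤ κ ∧
    Cardinal.lift.{w} L.card ≤ Cardinal.lift.{max u v} κ ∧
    ∀ (M : Type w) [L.Structure M], Mem M → ∀ B : Set M,
      ∃ S : L.Substructure M, B ⊆ S ∧ Strong S.subtype ∧ #S ≤ #B + κ

namespace AEC

variable {L : FirstOrder.Language.{u, v}} (K : AEC.{u, v, w} L) (μ : Cardinal.{w})

/-- The Löwenheim–Skolem number `LS(K)`. -/
noncomputable def LS : Cardinal.{w} :=
  sInf {κ | ℵ₀ ≤ κ ∧ Cardinal.lift.{w} L.card ≤ Cardinal.lift.{max u v} κ ∧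
    ∀ (M : Type w) [L.Structure M], K.Mem M → ∀ B : Set M,
      ∃ S : L.Substructure M, B ⊆ S ∧ K.Strong S.subtype ∧ #S ≤ #B + κ}

/-- `M ∈ K_μ`. -/
def InCard (M : Type w) [L.Structure M] : Prop := K.Mem M ∧ #M = μ

/-- Two `≺_K`-substructures of one model, one contained in the other, are `≺_K`-related. -/
theorem strong_inclusion {A : Type w} [L.Structure A] {S T : L.Substructure A} (h : S ≤ T)
    (hS : K.Strong S.subtype) (hT : K.Strong T.subtype) : K.Strong (Substructure.inclusion h) :=
  K.coherence hT (by
    have : T.subtype.comp (Substructure.inclusion h) = S.subtype := by ext x; rfl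
    rw [this]; exact hS)

/-! ### Global hypotheses on `K_μ` -/

/-- Joint embedding in `K_μ`. -/
def JointEmbedding : Prop :=
  ∀ (M₁ M₂ : Type w) [L.Structure M₁] [L.Structure M₂], K.InCard μ M₁ → K.InCard μ M₂ →
    ∃ (N : Type w) (_ : L.Structure N) (f₁ : M₁ ↪[L] N) (f₂ : M₂ ↪[L] N),
      #N = μ ∧ K.Strong f₁ ∧ K.Strong f₂

/-- Amalgamation in `K_μ`. -/
def Amalgamation : Prop :=
  ∀ (M₀ M₁ M₂ : Type w) [L.Structure M₀] [L.Structure M₁] [L.Structure M₂]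
    (g₁ : M₀ ↪[L] M₁) (g₂ : M₀ ↪[L] M₂), #M₀ = μ → #M₁ = μ → #M₂ = μ →
    K.Strong g₁ → K.Strong g₂ →
    ∃ (N : Type w) (_ : L.Structure N) (f₁ : M₁ ↪[L] N) (f₂ : M₂ ↪[L] N),
      #N = μ ∧ K.Strong f₁ ∧ K.Strong f₂ ∧ f₁.comp g₁ = f₂.comp g₂

/-- Every model in `K_μ` has a proper `≺_K`-extension in `K_μ`. -/
def NoMaximal : Prop :=
  ∀ (M : Type w) [L.Structure M], K.InCard μ M →
    ∃ (N : Type w) (_ : L.Structure N) (f : M ↪[L] N),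
      #N = μ ∧ K.Strong f ∧ ¬ Function.Surjective f

/-! ### Galois types -/

/-- A triple `(M, a, N)` with `M ≺_K N ∈ K_μ` (through `emb`) and `a ∈ N`. -/
structure PreType (M : Type w) [L.Structure M] where
  N : Type w
  [str : L.Structure N]
  emb : M ↪[L] N
  strong : K.Strong emb
  card : #N = μ
  a : N

attribute [instance] PreType.str

variable {K μ}

/-- `(M, a₁, N₁)` and `(M, a₂, N₂)` are identified when `N₁` and `N₂` can be amalgamated over `M`
with `a₁` and `a₂` having the same image. -/
def PreType.Rel {M : Type w} [L.Structure M] (p q : PreType K μ M) : Prop :=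
  ∃ (N : Type w) (_ : L.Structure N) (g₁ : p.N ↪[L] N) (g₂ : q.N ↪[L] N),
    #N = μ ∧ K.Strong g₁ ∧ K.Strong g₂ ∧ g₁.comp p.emb = g₂.comp q.emb ∧ g₁ p.a = g₂ q.a

variable (K μ) in
/-- The set `ga-S(M)` of Galois types over `M`: triples modulo the equivalence relation generated
by `PreType.Rel`. -/
def GaType (M : Type w) [L.Structure M] : Type (max u v (w + 1)) :=
  Quot (PreType.Rel (K := K) (μ := μ) (M := M))

/-- The Galois type `tp(a / M; N)`, where `M ≺_K N` through `f`. -/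
def tp {M N : Type w} [L.Structure M] [L.Structure N] (f : M ↪[L] N) (hf : K.Strong f)
    (hN : #N = μ) (a : N) : GaType K μ M :=
  Quot.mk _ { N := N, emb := f, strong := hf, card := hN, a := a }

/-- A type is algebraic if it is realized in its domain. -/
def GaType.Algebraic {M : Type w} [L.Structure M] (p : GaType K μ M) : Prop :=
  ∃ q : PreType K μ M, Quot.mk _ q = p ∧ q.a ∈ Set.range q.emb

/-- Pulling a triple back along a strong embedding `j : M' → M`. -/
def PreType.pull {M' M : Type w} [L.Structure M'] [L.Structure M] (j : M' ↪[L] M)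
    (hj : K.Strong j) (q : PreType K μ M) : PreType K μ M' :=
  { N := q.N, emb := q.emb.comp j, strong := K.strong_comp hj q.strong, card := q.card, a := q.a }

/-- Pulling a type over `M` back along a strong embedding `j : M' → M`. If `j` is the inclusion
of `M' ≺_K M`, this is the restriction `p ↾ M'`; if `j` is the inverse of an isomorphism
`h : M ≅ M'`, it is `h(p)`. -/
def GaType.pull {M' M : Type w} [L.Structure M'] [L.Structure M] (j : M' ↪[L] M)
    (hj : K.Strong j) : GaType K μ M → GaType K μ M' :=
  Quot.map (PreType.pull j hj) (by
    rintro p q ⟨N, _, g₁, g₂, hN, h₁, h₂, hc, ha⟩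
    refine ⟨N, _, g₁, g₂, hN, h₁, h₂, ?_, ha⟩
    ext x
    exact DFunLike.congr_fun hc (j x))

/-- The restriction `p ↾ S` to `S ≺_K M`. -/
def GaType.restrict {M : Type w} [L.Structure M] (p : GaType K μ M) (S : L.Substructure M)
    (hS : K.Strong S.subtype) : GaType K μ S :=
  p.pull S.subtype hS

/-- The image `h(p)` of a type under an isomorphism. -/
def GaType.image {M M' : Type w} [L.Structure M] [L.Structure M'] (h : M ≃[L] M')
    (hM' : K.Mem M') (p : GaType K μ M) : GaType K μ M' :=
  p.pull h.symm.toEmbedding (K.strong_equiv h.symm hM')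

/-- For `N ≺_K M` (through `j`), the type `p ∈ ga-S(M)` `μ`-splits over `N`: there are
`N₁, N₂ ∈ K_μ` with `N ≺_K N₁, N₂ ≺_K M` and an isomorphism `h : N₁ ≅ N₂` over `N` with
`h(p ↾ N₁) ≠ p ↾ N₂`. (That `N ≺_K N₁, N₂` follows from `N ⊆ N₁, N₂` by coherence.) -/
def Splits {N M : Type w} [L.Structure N] [L.Structure M] (j : N ↪[L] M) (p : GaType K μ M) :
    Prop :=
  ∃ (N₁ N₂ : L.Substructure M) (h₁ : K.Strong N₁.subtype) (h₂ : K.Strong N₂.subtype)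
    (h : N₁ ≃[L] N₂), #N₁ = μ ∧ #N₂ = μ ∧
    (∀ x : N, ∃ hx : j x ∈ N₁, (h ⟨j x, hx⟩ : M) = j x) ∧
    (p.restrict N₁ h₁).image h (K.mem_dom h₂) ≠ p.restrict N₂ h₂

variable (K μ)

/-- Galois-stability in `μ`. -/
def Stable : Prop :=
  ∀ (M : Type w) [L.Structure M], K.InCard μ M →
    #(GaType K μ M) ≤ Cardinal.lift.{max u v (w + 1)} μ

/-! ### Universal extensions and limit models -/

/-- `M, N ∈ K_μ`, `N ≺_K M` (through `f`) and `M` is universal over `N`. -/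
def UniversalOver {N M : Type w} [L.Structure N] [L.Structure M] (f : N ↪[L] M) : Prop :=
  K.Strong f ∧ #N = μ ∧ #M = μ ∧
    ∀ (M' : Type w) [L.Structure M'] (g : N ↪[L] M'), #M' = μ → K.Strong g →
      ∃ h : M' ↪[L] M, K.Strong h ∧ h.comp g = f

/-- `⟨S i ∣ i < θ⟩` is a `≺_K`-increasing continuous chain in `K_μ` with union `M ∈ K_μ`, and
`S (i+1)` is universal over `S i` for all `i + 1 < θ`. (Values of `S` at `i ≥ θ` are
irrelevant.) -/
structure IsWitness (θ : Ordinal.{w}) {M : Type w} [L.Structure M]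
    (S : Ordinal.{w} → L.Substructure M) : Prop where
  card_top : #M = μ
  card : ∀ i < θ, #(S i) = μ
  mono : ∀ i j, i ≤ j → j < θ → S i ≤ S j
  strong : ∀ i < θ, K.Strong (S i).subtype
  cont : ∀ i < θ, IsSuccLimit i → (S i : Set M) = ⋃ j < i, (S j : Set M)
  univ : ∀ i, ∀ h : i + 1 < θ,
    K.UniversalOver μ (Substructure.inclusion (mono i (i + 1) le_self_add h))
  union : ∀ x : M, ∃ i < θ, x ∈ S i

/-- `M` is a `(μ, θ)`-limit model over `N` (embedded through `f`), `θ` a limit ordinal `< μ⁺`. -/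
def IsLimitOver (θ : Ordinal.{w}) {N M : Type w} [L.Structure N] [L.Structure M]
    (f : N ↪[L] M) : Prop :=
  IsSuccLimit θ ∧ θ < (succ μ).ord ∧
    ∃ S : Ordinal.{w} → L.Substructure M, K.IsWitness μ θ S ∧ S 0 = f.toHom.range

/-- `M` is a limit model of cardinality `μ`. -/
def IsLimitModel (M : Type w) [L.Structure M] : Prop :=
  ∃ (N : L.Substructure M) (θ : Ordinal.{w}), K.IsLimitOver μ θ N.subtype

theorem IsLimitModel.card {M : Type w} [L.Structure M] (h : K.IsLimitModel μ M) : #M = μ := by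
  obtain ⟨_, _, _, _, _, hS, _⟩ := h
  exact hS.card_top

/-! ### Local character, continuity and symmetry of non-splitting -/

/-- Local character of non-`μ`-splitting from `κ` on. -/
def LocalCharacter (κ : Cardinal.{w}) : Prop :=
  ∀ α : Cardinal.{w}, κ ≤ α → α.IsRegular →
    ∀ (M : Type w) [L.Structure M] (S : Ordinal.{w} → L.Substructure M),
      K.IsWitness μ α.ord S →
      ∀ p : GaType K μ M, ¬ p.Algebraic → ∃ i < α.ord, ¬ Splits (S i).subtype p

open Classical in
/-- `κ*_μ(K)`: the least regular `κ < μ⁺` with `LocalCharacter κ`, and `⊤` if there is none. -/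
noncomputable def kappaStar : WithTop Cardinal.{w} :=
  if ∃ κ : Cardinal.{w}, κ.IsRegular ∧ κ < succ μ ∧ K.LocalCharacter μ κ then
    ((sInf {κ : Cardinal.{w} | κ.IsRegular ∧ κ < succ μ ∧ K.LocalCharacter μ κ} :
      Cardinal.{w}) : WithTop Cardinal.{w})
  else ⊤

/-- Limit continuity of non-`μ`-splitting. -/
def SplittingContinuity : Prop :=
  ∀ (θ : Ordinal.{w}), IsSuccLimit θ → θ < (succ μ).ord →
    ∀ (M : Type w) [L.Structure M] (S : Ordinal.{w} → L.Substructure M)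
      (hS : K.IsWitness μ θ S) (N : L.Substructure M) (hN : ∀ i < θ, N ≤ S i),
      K.Strong N.subtype → #N = μ →
      ∀ p : GaType K μ M,
        (∀ i, ∀ hi : i < θ,
          ¬ Splits (Substructure.inclusion (hN i hi)) (p.restrict (S i) (hS.strong i hi))) →
        ¬ Splits N.subtype p

/-- `(μ, δ)`-symmetry for non-`μ`-splitting. The models `N ≺_K M₀ ≺_K M` and the element `b` live
in some `C ∈ K_μ`; the model `Mb` is found in some extension `C'` of `C` (through `g`). -/
def Symmetry (δ : Ordinal.{w}) : Prop :=
  ∀ (C : Type w) [L.Structure C] (hC : #C = μ) (N M₀ M : L.Substructure C)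
    (hN : N ≤ M₀) (hM : M₀ ≤ M) (_ : K.Strong N.subtype) (hM₀s : K.Strong M₀.subtype)
    (hMs : K.Strong M.subtype) (a b : C),
    K.UniversalOver μ (Substructure.inclusion hM) →
    K.IsLimitOver μ δ (Substructure.inclusion hN) →
    a ∈ M → a ∉ M₀ →
    ¬ (tp M₀.subtype hM₀s hC a).Algebraic →
    ¬ Splits (Substructure.inclusion hN) (tp M₀.subtype hM₀s hC a) →
    ¬ (tp M.subtype hMs hC b).Algebraic →
    ¬ Splits (Substructure.inclusion hM) (tp M.subtype hMs hC b) →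
    ∃ (C' : Type w) (_ : L.Structure C') (hC' : #C' = μ) (g : C ↪[L] C') (Mb : L.Substructure C')
      (hMb : K.Strong Mb.subtype) (h₀ : M₀.map g.toHom ≤ Mb) (hNb : N.map g.toHom ≤ Mb),
      K.Strong g ∧
      (∃ θ, K.IsLimitOver μ θ (Substructure.inclusion h₀)) ∧
      g b ∈ Mb ∧
      ¬ Splits (Substructure.inclusion hNb) (tp Mb.subtype hMb hC' (g a))

/-! ### Towers -/

/-- A tower `(M̄, ā, N̄) ∈ K*_{μ,α}`. The structure `A` is the union `⋃_{i<α} M_i`. Values of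
`M` at `i ≥ α`, and of `a` and `N` at `i` with `i + 1 ≥ α`, are irrelevant. -/
structure Tower (α : Ordinal.{w}) (A : Type w) [L.Structure A] where
  M : Ordinal.{w} → L.Substructure A
  a : Ordinal.{w} → A
  N : Ordinal.{w} → L.Substructure A
  union : ∀ x : A, ∃ i < α, x ∈ M i
  mono : ∀ i j, i ≤ j → j < α → M i ≤ M j
  strong : ∀ i < α, K.Strong (M i).subtype
  limit : ∀ i < α, K.IsLimitModel μ (M i)
  a_mem : ∀ i, i + 1 < α → a i ∈ M (i + 1)
  a_notMem : ∀ i, i + 1 < α → a i ∉ M i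
  N_le : ∀ i, i + 1 < α → N i ≤ M i
  univ : ∀ i, ∀ h : i + 1 < α, K.UniversalOver μ (Substructure.inclusion (N_le i h))
  /-- `tp(a_i / M_i; M_{i+1})` does not `μ`-split over `N_i` -/
  nonsplit : ∀ i, ∀ h : i + 1 < α,
    ¬ Splits (Substructure.inclusion (N_le i h))
      (tp (μ := μ) (Substructure.inclusion (mono i (i + 1) le_self_add h))
        (K.strong_inclusion _ (strong i (lt_of_le_of_lt le_self_add h)) (strong (i + 1) h))
        (limit (i + 1) h).card ⟨a i, a_mem i h⟩)

variable {K μ}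

/-- `T ≤ T'`, where the union `A` of `T` is identified with its image under `f` in the union `A'`
of `T'`. -/
structure Tower.Extends {α : Ordinal.{w}} {A A' : Type w} [L.Structure A] [L.Structure A']
    (T : Tower K μ α A) (T' : Tower K μ α A') (f : A ↪[L] A') : Prop where
  a_eq : ∀ i, i + 1 < α → T'.a i = f (T.a i)
  N_eq : ∀ i, i + 1 < α → T'.N i = (T.N i).map f.toHom
  le : ∀ i < α, (T.M i).map f.toHom ≤ T'.M i
  strong : ∀ i, ∀ hi : i < α, K.Strong (Substructure.inclusion (le i hi))
  univ : ∀ i, ∀ hi : i < α, (T.M i).map f.toHom ≠ T'.M i →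
    K.UniversalOver μ (Substructure.inclusion (le i hi))

/-- `T` is reduced: `M'_i ∩ ⋃_{j<α} M_j = M_i` for all `i < α` and all `T' ≥ T` of length `α`. -/
def Tower.Reduced {α : Ordinal.{w}} {A : Type w} [L.Structure A] (T : Tower K μ α A) : Prop :=
  ∀ (A' : Type w) [L.Structure A'] (T' : Tower K μ α A') (f : A ↪[L] A'), T.Extends T' f →
    ∀ i < α, (T'.M i : Set A') ∩ (⋃ j < α, f '' (T.M j : Set A)) = f '' (T.M i : Set A)

end AEC

/-! Let `b` lie in M_δ. It suffices to extend the tower, through some embedding `f`, so that `f b`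
lies in the j-th model for some j < δ. Reducedness then gives f b ∈ f[M_j], so b ∈ M_j.

The work takes place in a model `C` of size at most μ⁺ that is homogeneous for models of size μ
(`exists_monster`); it is built from amalgamation and stability. There, equality of Galois types is
conjugacy under automorphisms (`IsGt.eq_iff`), and nonsplitting and universality become statements
about automorphisms (`not_splits_iff`, `universalOver_iff`). Nonsplitting types have extensions, and
these are unique (`NS.exists_extension`, `NS.unique`). A tower has length at most μ⁺
(`Tower.length_le`), so its union embeds in such a `C`, and δ < μ⁺.

The core is `TowerData.exists_extension_mem`, about the tower cut off at δ. It is first extended to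
models S_j that are (μ, δ)-limits over models containing all earlier ones. If `b` is in no S_j,
local character along a cofinal sequence of length cf(δ) gives ξ < δ such that the type of `b` over
⋃ S_j does not split over S_ξ. From ξ on, new models T_j are built, with b ∈ T_ξ, together with
automorphisms σ_j that fix `b` and carry S_j into T_j. At successors, symmetry makes the type of a_j
nonsplitting over a model containing `b`, and uniqueness then moves a_j, over S_j and `b`, to a
realization of its nonsplitting extension over the larger model. At limits, the glued automorphism
may move `b`; continuity of nonsplitting and uniqueness correct it. One last gluing, possible
because δ < μ⁺, pulls all T_j back along a single automorphism fixing `b`, so that the elements a_j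
are unchanged and `b` enters at stage ξ.

From δ on nothing has to be fixed, and the same rebuilding (`exists_rebuild`) continues with σ_δ =
id. Since α may equal μ⁺, the σ_i need not come from one automorphism; they are only glued to an
embedding of the union of the tower. That embedding agrees with the original one on M_δ, hence at
`b`. -/

namespace AEC

/-! ### Transfinite recursion with choice -/

section

/-- Transfinite recursion with choice: if a value satisfying `Q` can be chosen at every stage
`j < o`, given suitable earlier values, then there is a sequence satisfying `Q` throughout. -/
theorem exists_transfinite {X : Type*} [Nonempty X]
    (Q : Ordinal.{w} → (Ordinal.{w} → X) → X → Prop)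
    (hloc : ∀ j f g x, (∀ i < j, f i = g i) → Q j f x → Q j g x) (o : Ordinal.{w})
    (step : ∀ j < o, ∀ f, (∀ i < j, Q i f (f i)) → ∃ x, Q j f x) :
    ∃ f : Ordinal.{w} → X, ∀ j < o, Q j f (f j) := by
  classical
  -- Values from stage `j` on are arbitrary; `hloc` says that `Q j` does not see them.
  let ext : (j : Ordinal.{w}) → ((i : Ordinal.{w}) → i < j → X) → (Ordinal.{w} → X) :=
    fun j g i => if h : i < j then g i h else Classical.arbitrary X
  let F : (j : Ordinal.{w}) → ((i : Ordinal.{w}) → i < j → X) → X := fun j g =>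
    if h : ∃ x, Q j (ext j g) x then h.choose else Classical.arbitrary X
  let f : Ordinal.{w} → X := WellFounded.fix (C := fun _ => X) Ordinal.lt_wf F
  have hf : ∀ j, f j = F j (fun i _ => f i) := fun j => WellFounded.fix_eq _ _ _
  have hext : ∀ j, ∀ i < j, ext j (fun i _ => f i) i = f i := fun j i hi => by
    simp only [ext, hi, dif_pos]
  refine ⟨f, fun j => ?_⟩
  induction j using WellFoundedLT.induction with
  | ind j ih =>
    intro hj
    obtain ⟨x, hx⟩ := step j hj f fun i hi => ih i hi (hi.trans hj)
    have hex : ∃ x, Q j (ext j (fun i _ => f i)) x :=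
      ⟨x, hloc j f _ x (fun i hi => (hext j i hi).symm) hx⟩
    have : f j = hex.choose := by rw [hf]; simp only [F, hex, dif_pos]
    rw [this]
    exact hloc j _ f _ (hext j) hex.choose_spec

variable {L : FirstOrder.Language.{u, v}} {K : AEC.{u, v, w} L} {μ : Cardinal.{w}}

/-! ### Strong substructures -/

theorem mem_equiv {M N : Type w} [L.Structure M] [L.Structure N] (e : M ≃[L] N) (h : K.Mem M) :
    K.Mem N :=
  K.mem_cod (K.strong_equiv e h)

/-- Closure under isomorphism identifies an embedding with its range. Strong embeddings can
therefore be compared as substructures of one large model. -/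
theorem strong_range_iff {M N : Type w} [L.Structure M] [L.Structure N] (e : M ↪[L] N) :
    K.Strong e.toHom.range.subtype ↔ K.Strong e := by
  constructor
  · intro h
    have h₁ := K.strong_equiv e.equivRange (mem_equiv e.equivRange.symm (K.mem_dom h))
    have := K.strong_comp h₁ h
    rwa [Embedding.subtype_equivRange] at this
  · intro h
    have h₁ := K.strong_equiv e.equivRange.symm (mem_equiv e.equivRange (K.mem_dom h))
    have := K.strong_comp h₁ h
    convert this using 1
    ext x
    obtain ⟨y, rfl⟩ := e.equivRange.surjective x
    simp

theorem mem_range' {M N : Type w} [L.Structure M] [L.Structure N] (e : M ↪[L] N) (y : N) :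
    y ∈ e.toHom.range ↔ ∃ x, e x = y := by
  simp

variable (K μ) in
/-- `S ≺_K C` and `S` has cardinality `μ`. -/
def Mod {C : Type w} [L.Structure C] (S : L.Substructure C) : Prop :=
  K.Strong S.subtype ∧ #S = μ

theorem Mod.range {M N : Type w} [L.Structure M] [L.Structure N] {e : M ↪[L] N}
    (h : K.Strong e) (hM : #M = μ) : K.Mod μ e.toHom.range :=
  ⟨(strong_range_iff e).2 h, by rw [← hM]; exact Cardinal.mk_congr e.equivRange.toEquiv.symm⟩

theorem Mod.map {M N : Type w} [L.Structure M] [L.Structure N] {e : M ↪[L] N}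
    (h : K.Strong e) {S : L.Substructure M} (hS : K.Mod μ S) : K.Mod μ (S.map e.toHom) := by
  have : S.map e.toHom = (e.comp S.subtype).toHom.range := by
    ext y; simp
  rw [this]
  exact Mod.range (K.strong_comp hS.1 h) hS.2

theorem range_comp_comap {M C : Type w} [L.Structure M] [L.Structure C] (k : M ↪[L] C)
    {S : L.Substructure C}
    (hS : S ≤ k.toHom.range) : (k.comp (S.comap k.toHom).subtype).toHom.range = S := by
  ext y
  rw [mem_range']
  constructor
  · rintro ⟨x, rfl⟩
    exact x.2
  · intro hy
    obtain ⟨x, rfl⟩ := (mem_range' k y).1 (hS hy)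
    exact ⟨⟨x, hy⟩, rfl⟩

theorem Mod.comap {M N : Type w} [L.Structure M] [L.Structure N] {e : M ↪[L] N}
    (h : K.Strong e) {S : L.Substructure N} (hS : K.Mod μ S) (hle : S ≤ e.toHom.range) :
    K.Mod μ (S.comap e.toHom) := by
  have hr := range_comp_comap e hle
  refine ⟨K.coherence h ((strong_range_iff _).1 (by rw [hr]; exact hS.1)), ?_⟩
  rw [← hS.2]
  refine (Cardinal.mk_congr (e.comp (S.comap e.toHom).subtype).equivRange.toEquiv).trans ?_
  rw [hr]

theorem Mod.mem {C : Type w} [L.Structure C] {S : L.Substructure C} (h : K.Mod μ S) : K.Mem C :=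
  K.mem_cod h.1

/-- The infimum defining `LS` is attained, since cardinals are well-ordered, and μ + μ = μ absorbs
the bound. -/
theorem ls_spec (hLS : K.LS ≤ μ) : ℵ₀ ≤ μ ∧
    ∀ (M : Type w) [L.Structure M], K.Mem M → ∀ B : Set M, #B ≤ μ →
      ∃ S : L.Substructure M, B ⊆ S ∧ K.Strong S.subtype ∧ #S ≤ μ := by
  have h := csInf_mem (s := {κ : Cardinal.{w} | ℵ₀ ≤ κ ∧
    Cardinal.lift.{w} L.card ≤ Cardinal.lift.{max u v} κ ∧
    ∀ (M : Type w) [L.Structure M], K.Mem M → ∀ B : Set M,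
      ∃ S : L.Substructure M, B ⊆ S ∧ K.Strong S.subtype ∧ #S ≤ #B + κ}) K.exists_ls
  obtain ⟨h₁, -, h₂⟩ := h
  have h₀ : ℵ₀ ≤ μ := le_trans h₁ hLS
  refine ⟨h₀, fun M _ hM B hB => ?_⟩
  obtain ⟨S, hBS, hS, hc⟩ := h₂ M hM B
  refine ⟨S, hBS, hS, hc.trans ?_⟩
  calc #B + _ ≤ μ + μ := add_le_add hB hLS
    _ = μ := Cardinal.add_eq_self h₀

theorem exists_mod (hLS : K.LS ≤ μ) {C : Type w} [L.Structure C] {P : L.Substructure C}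
    (hP : K.Mod μ P) (B : Set C) (hB : #B ≤ μ) :
    ∃ S : L.Substructure C, K.Mod μ S ∧ B ⊆ S ∧ P ≤ S := by
  obtain ⟨h₀, h⟩ := ls_spec hLS
  obtain ⟨S, hBS, hS, hc⟩ := h C hP.mem (B ∪ P) (by
    calc #(B ∪ P : Set C) ≤ #B + #P := Cardinal.mk_union_le _ _
      _ ≤ μ + μ := add_le_add hB hP.2.le
      _ = μ := Cardinal.add_eq_self h₀)
  have hPS : P ≤ S := fun x hx => hBS (Or.inr hx)
  refine ⟨S, ⟨hS, le_antisymm hc ?_⟩, fun x hx => hBS (Or.inl hx), hPS⟩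
  rw [← hP.2]
  exact Cardinal.mk_le_mk_of_subset hPS

/-! ### Unions of chains -/

/-- At limit lengths this is the second Tarski–Vaught axiom, coherence giving the strong inclusions
inside the chain. At successor lengths the last member is everything. Having both cases at once lets
recursions treat all stages alike. -/
theorem strong_of_chain {A B : Type w} [L.Structure A] [L.Structure B] {j : Ordinal.{w}}
    (hj : j ≠ 0) (S : Ordinal.{w} → L.Substructure A)
    (mono : ∀ i k, i ≤ k → k < j → S i ≤ S k) (cover : ∀ x : A, ∃ i < j, x ∈ S i)
    (f : A ↪[L] B) (hf : ∀ i < j, K.Strong (f.comp (S i).subtype)) : K.Strong f := by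
  rcases Ordinal.zero_or_succ_or_isSuccLimit j with rfl | ⟨k, rfl⟩ | hlim
  · exact absurd rfl hj
  · have hk : k < succ k := lt_succ k
    have htop : ∀ x : A, x ∈ S k := fun x => by
      obtain ⟨i, hi, hx⟩ := cover x
      exact mono i k (lt_succ_iff.1 hi) hk hx
    have hr : (f.comp (S k).subtype).toHom.range = f.toHom.range := by
      ext y
      rw [mem_range', mem_range']
      exact ⟨fun ⟨x, hx⟩ => ⟨x, hx⟩, fun ⟨x, hx⟩ => ⟨⟨x, htop x⟩, hx⟩⟩
    rw [← strong_range_iff, ← hr, strong_range_iff]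
    exact hf k hk
  · refine K.chain_lift j S f hlim (fun i k hik hk => ⟨mono i k hik hk, ?_⟩) cover hf
    exact K.coherence (hf k hk) (hf i (hik.trans_lt hk))

/-- Adjoining the base `B` makes the statement meaningful at `j = 0`, where the union is `B` itself.
-/
theorem exists_chain_union (hμ : ℵ₀ ≤ μ) {C : Type w} [L.Structure C] {j : Ordinal.{w}}
    (hj : j.card ≤ μ) {B : L.Substructure C} {R : Ordinal.{w} → L.Substructure C}
    (hB : K.Mod μ B) (hR : ∀ i < j, K.Mod μ (R i)) (hBR : ∀ i < j, B ≤ R i)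
    (mono : ∀ i k, i ≤ k → k < j → R i ≤ R k) :
    ∃ S, K.Mod μ S ∧ ∀ x, x ∈ S ↔ x ∈ B ∨ ∃ i < j, x ∈ R i := by
  by_cases hj0 : j = 0
  · subst hj0
    exact ⟨B, hB, fun x => by simp [not_lt_zero]⟩
  have hpos : 0 < j := pos_iff_ne_zero.2 hj0
  have : Nonempty (Set.Iio j) := ⟨⟨0, hpos⟩⟩
  let S : L.Substructure C := ⨆ i : Set.Iio j, R i.1
  have hS : ∀ x, x ∈ S ↔ ∃ i < j, x ∈ R i := fun x => by
    have hdir : Directed (· ≤ ·) (fun i : Set.Iio j => R i.1) := by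
      intro i k
      rcases le_total i k with h | h
      · exact ⟨k, mono _ _ h k.2, le_rfl⟩
      · exact ⟨i, le_rfl, mono _ _ h i.2⟩
    rw [Substructure.mem_iSup_of_directed hdir]
    simp [Set.mem_Iio]
  have hRS : ∀ i < j, R i ≤ S := fun i hi x hx => (hS x).2 ⟨i, hi, hx⟩
  have hstr : K.Strong S.subtype := by
    refine strong_of_chain hj0 (fun i => (R i).comap S.subtype.toHom)
      (fun i k hik hk x hx => mono i k hik hk hx) (fun x => (hS x).1 x.2) _ fun i hi => ?_
    rw [← strong_range_iff]
    have : (S.subtype.comp ((R i).comap S.subtype.toHom).subtype).toHom.range = R i := by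
      ext y
      rw [mem_range']
      exact ⟨fun ⟨x, hx⟩ => hx ▸ x.2, fun hy => ⟨⟨⟨y, hRS i hi hy⟩, hy⟩, rfl⟩⟩
    rw [this]
    exact (hR i hi).1
  refine ⟨S, ⟨hstr, le_antisymm ?_ ?_⟩, fun x => ?_⟩
  · have h := Cardinal.mk_biUnion_le_of_le hj hμ (fun i => (R i : Set C))
      fun i hi => (hR i hi).2.le
    have he : (S : Set C) = ⋃ i < j, (R i : Set C) := by
      ext x; simp [hS x]
    have : #(S : Set C) ≤ μ := by rw [he]; exact h
    exact this
  · rw [← (hR 0 hpos).2]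
    exact Cardinal.mk_le_mk_of_subset (hRS 0 hpos)
  · rw [hS]
    exact ⟨Or.inr, fun h => h.elim (fun h => ⟨0, hpos, hBR 0 hpos h⟩) id⟩

/-! ### Gluing coherent embeddings -/

variable (K) in
/-- The function `F` restricts to a strong embedding on `S`. -/
def StrongOn {A B : Type w} [L.Structure A] [L.Structure B] (F : A → B) (S : L.Substructure A) :
    Prop :=
  ∃ e : S ↪[L] B, K.Strong e ∧ ∀ x : S, e x = F x

theorem StrongOn.of_embedding {A B : Type w} [L.Structure A] [L.Structure B] {S : L.Substructure A}
    {f : A ↪[L] B} (hf : K.Strong f) (hS : K.Strong S.subtype) : K.StrongOn f S :=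
  ⟨f.comp S.subtype, K.strong_comp hS hf, fun _ => rfl⟩

theorem StrongOn.of_equiv {A B : Type w} [L.Structure A] [L.Structure B] {S : L.Substructure A}
    (f : A ≃[L] B) (hS : K.Strong S.subtype) : K.StrongOn f S :=
  StrongOn.of_embedding (f := f.toEmbedding) (K.strong_equiv f (K.mem_cod hS)) hS

theorem StrongOn.comp {A B C : Type w} [L.Structure A] [L.Structure B] [L.Structure C]
    {S : L.Substructure A} {F : A → B} (hF : K.StrongOn F S) {g : B ↪[L] C} (hg : K.Strong g) :
    K.StrongOn (g ∘ F) S := by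
  obtain ⟨e, he, hx⟩ := hF
  exact ⟨g.comp e, K.strong_comp he hg, fun x => by simp [hx]⟩

/-- Coherent strong embeddings on a chain glue to a strong embedding on the union. -/
theorem exists_glue {A B : Type w} [L.Structure A] [L.Structure B] {j : Ordinal.{w}}
    (hj : j ≠ 0) (S : Ordinal.{w} → L.Substructure A)
    (mono : ∀ i k, i ≤ k → k < j → S i ≤ S k) (F : Ordinal.{w} → A → B)
    (hF : ∀ i < j, K.StrongOn (F i) (S i))
    (coh : ∀ i k, i ≤ k → k < j → ∀ x ∈ S i, F k x = F i x) :
    ∃ G : A → B, (∀ i < j, ∀ x ∈ S i, G x = F i x) ∧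
      ∀ T : L.Substructure A, (∀ x, x ∈ T ↔ ∃ i < j, x ∈ S i) → K.StrongOn G T := by
  classical
  let G : A → B := fun x => if h : ∃ i < j, x ∈ S i then F h.choose x else F 0 x
  have hG : ∀ i < j, ∀ x ∈ S i, G x = F i x := fun i hi x hx => by
    have h : ∃ i < j, x ∈ S i := ⟨i, hi, hx⟩
    have hg : G x = F h.choose x := dif_pos h
    obtain ⟨h₁, h₂⟩ := h.choose_spec
    rw [hg]
    rcases le_total i h.choose with hle | hle
    · exact coh _ _ hle h₁ x hx
    · exact (coh _ _ hle hi x h₂).symm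
  refine ⟨G, hG, fun T hT => ?_⟩
  have hST : ∀ i < j, S i ≤ T := fun i hi x hx => (hT x).2 ⟨i, hi, hx⟩
  have hG' : ∀ i, i < j → ∃ e : S i ↪[L] B, K.Strong e ∧ ∀ x : S i, e x = G x := fun i hi => by
    obtain ⟨e, he, hx⟩ := hF i hi
    exact ⟨e, he, fun x => (hx x).trans (hG i hi x x.2).symm⟩
  -- Every finite tuple lies in one member of the chain, so functions and relations can be checked
  -- there. The empty tuple needs some member to exist, hence `j ≠ 0`.
  have hfin : ∀ {n : ℕ} (x : Fin n → T), ∃ i < j, ∀ k, (x k : A) ∈ S i := by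
    intro n x
    choose i hi hx using fun k => (hT _).1 (x k).2
    rcases Nat.eq_zero_or_pos n with rfl | hn
    · exact ⟨0, pos_iff_ne_zero.2 hj, fun k => k.elim0⟩
    · have : Nonempty (Fin n) := ⟨⟨0, hn⟩⟩
      obtain ⟨k₀, hk₀⟩ := Finite.exists_max i
      exact ⟨i k₀, hi k₀, fun k => mono _ _ (hk₀ k) (hi k₀) (hx k)⟩
  have hinj : Function.Injective fun x : T => G x := by
    intro x y hxy
    obtain ⟨i, hi, hx⟩ := hfin ![x, y]
    obtain ⟨e, -, he⟩ := hG' i hi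
    have h0 : (x : A) ∈ S i := hx 0
    have h1 : (y : A) ∈ S i := hx 1
    have := e.injective (a₁ := ⟨x, h0⟩) (a₂ := ⟨y, h1⟩) (by rw [he, he]; exact hxy)
    exact Subtype.ext (Subtype.mk.inj this)
  let e : T ↪[L] B :=
    { toFun := fun x => G x
      inj' := hinj
      map_fun' := by
        intro n f x
        obtain ⟨i, hi, hx⟩ := hfin x
        obtain ⟨e, -, he⟩ := hG' i hi
        have h := e.map_fun f (fun k => ⟨x k, hx k⟩)
        rw [he] at h
        refine Eq.trans ?_ (h.trans ?_)
        · rfl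
        · congr 1
          funext k
          exact he _
      map_rel' := by
        intro n r x
        obtain ⟨i, hi, hx⟩ := hfin x
        obtain ⟨e, -, he⟩ := hG' i hi
        have h := e.map_rel r (fun k => ⟨x k, hx k⟩)
        have h' : (e ∘ fun k => ⟨x k, hx k⟩ : Fin n → B) = (fun x : T => G x) ∘ x := by
          funext k
          exact he _
        rw [h'] at h
        exact h }
  refine ⟨e, ?_, fun x => rfl⟩
  refine strong_of_chain hj (fun i => (S i).comap T.subtype.toHom)
      (fun i k hik hk x hx => mono i k hik hk hx) (fun x => (hT x).1 x.2) _ fun i hi => ?_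
  obtain ⟨e', he', hx⟩ := hG' i hi
  have hr : (e.comp ((S i).comap T.subtype.toHom).subtype).toHom.range = e'.toHom.range := by
    ext y
    rw [mem_range', mem_range']
    constructor
    · rintro ⟨x, rfl⟩
      exact ⟨⟨x.1, x.2⟩, hx _⟩
    · rintro ⟨x, rfl⟩
      exact ⟨⟨⟨x.1, hST i hi x.2⟩, x.2⟩, (hx _).symm⟩
  rw [← strong_range_iff, hr, strong_range_iff]
  exact he'

/-! ### Galois types under amalgamation -/

theorem strong_refl {M : Type w} [L.Structure M] (h : K.Mem M) :
    K.Strong (Embedding.refl L M) := by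
  have := K.strong_equiv (FirstOrder.Language.Equiv.refl L M) h
  rwa [FirstOrder.Language.Equiv.refl_toEmbedding] at this

/-- Only transitivity has content: the two amalgams are amalgamated over the middle model `q.N`,
which has cardinality `μ`. -/
theorem PreType.rel_equivalence (hAP : K.Amalgamation μ) {M : Type w} [L.Structure M] :
    Equivalence (PreType.Rel (K := K) (μ := μ) (M := M)) where
  refl p := ⟨p.N, p.str, Embedding.refl L _, Embedding.refl L _, p.card,
    strong_refl (K.mem_cod p.strong), strong_refl (K.mem_cod p.strong), rfl, rfl⟩
  symm := fun ⟨N, i, g₁, g₂, h, h₁, h₂, hc, ha⟩ => ⟨N, i, g₂, g₁, h, h₂, h₁, hc.symm, ha.symm⟩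
  trans := by
    rintro p q r ⟨N, _, g₁, g₂, h, h₁, h₂, hc, ha⟩ ⟨N', _, g₂', g₃, h', h₂', h₃, hc', ha'⟩
    obtain ⟨P, _, f₁, f₂, hP, hf₁, hf₂, hf⟩ := hAP q.N N N' g₂ g₂' q.card h h' h₂ h₂'
    have hf' : ∀ x, f₁ (g₂ x) = f₂ (g₂' x) := DFunLike.congr_fun hf
    refine ⟨P, _, f₁.comp g₁, f₂.comp g₃, hP, K.strong_comp h₁ hf₁, K.strong_comp h₃ hf₂, ?_, ?_⟩
    · ext x
      have e₁ : g₁ (p.emb x) = g₂ (q.emb x) := DFunLike.congr_fun hc x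
      have e₂ : g₂' (q.emb x) = g₃ (r.emb x) := DFunLike.congr_fun hc' x
      simp only [Embedding.comp_apply]
      rw [e₁, hf', e₂]
    · simp only [Embedding.comp_apply]
      rw [ha, hf', ha']

theorem PreType.mk_eq_iff (hAP : K.Amalgamation μ) {M : Type w} [L.Structure M]
    {p q : PreType K μ M} : (Quot.mk _ p : GaType K μ M) = Quot.mk _ q ↔ p.Rel q := by
  refine ⟨fun h => ?_, fun h => Quot.sound h⟩
  have := Quot.eqvGen_exact h
  rwa [(PreType.rel_equivalence hAP).eqvGen_eq] at this

end

section

variable {L : FirstOrder.Language.{u, v}} {K : AEC.{u, v, w} L} {μ : Cardinal.{w}}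

/-! ### Structures on subsets of a fixed set -/

variable (L) in
/-- An `L`-structure whose underlying set is a subset of `U`. -/
structure Obj (U : Type w) where
  D : Set U
  [str : L.Structure D]

attribute [instance] Obj.str

variable {U : Type w}

variable (K) in
/-- The function `h` restricts to a strong embedding of `X` into `Y`. -/
def Obj.Maps (h : U → U) (X Y : Obj L U) : Prop :=
  ∃ e : X.D ↪[L] Y.D, K.Strong e ∧ ∀ x, (e x : U) = h x

variable (K) in
/-- `X ≺_K Y`. -/
def Obj.SLE (X Y : Obj L U) : Prop := Obj.Maps K id X Y

theorem Obj.Maps.congr {g h : U → U} {X Y : Obj L U} (hm : Obj.Maps K h X Y)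
    (hgh : ∀ x ∈ X.D, g x = h x) : Obj.Maps K g X Y := by
  obtain ⟨e, he, hx⟩ := hm
  exact ⟨e, he, fun x => (hx x).trans (hgh x x.2).symm⟩

theorem Obj.Maps.comp {g h : U → U} {X Y Z : Obj L U} (hh : Obj.Maps K h X Y)
    (hg : Obj.Maps K g Y Z) : Obj.Maps K (g ∘ h) X Z := by
  obtain ⟨e, he, hx⟩ := hh
  obtain ⟨f, hf, hy⟩ := hg
  exact ⟨f.comp e, K.strong_comp he hf, fun x => by simp [hy, hx]⟩

theorem Obj.SLE.trans {X Y Z : Obj L U} (h : X.SLE K Y) (h' : Y.SLE K Z) : X.SLE K Z :=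
  Obj.Maps.comp h h'

theorem Obj.SLE.refl {X : Obj L U} (h : K.Mem X.D) : X.SLE K X :=
  ⟨Embedding.refl L _, strong_refl h, fun _ => rfl⟩

theorem Obj.SLE.subset {X Y : Obj L U} (h : X.SLE K Y) : X.D ⊆ Y.D := fun x hx => by
  obtain ⟨e, -, he⟩ := h
  have := he ⟨x, hx⟩
  simp only [id] at this
  exact this ▸ (e ⟨x, hx⟩).2

/-- The Tarski–Vaught axioms speak of chains inside a given structure. Keeping all models on subsets
of one set `U` makes direct limits literal unions, and this supplies the ambient structure. -/
theorem Obj.exists_union {j : Ordinal.{w}} (hj : j ≠ 0) (X : Ordinal.{w} → Obj L U)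
    (mono : ∀ i k, i ≤ k → k < j → (X i).SLE K (X k)) :
    ∃ Y : Obj L U, Y.D = ⋃ i < j, (X i).D ∧ (∀ i < j, ∃ e : (X i).D ↪[L] Y.D, ∀ x, (e x : U) = x) := by
  classical
  let D : Set U := ⋃ i < j, (X i).D
  have hD : ∀ x, x ∈ D ↔ ∃ i < j, x ∈ (X i).D := fun x => by simp [D]
  have hXD : ∀ i < j, (X i).D ⊆ D := fun i hi x hx => (hD x).2 ⟨i, hi, hx⟩
  have hfin : ∀ {n : ℕ} (x : Fin n → D), ∃ i, i < j ∧ ∀ k, (x k : U) ∈ (X i).D := by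
    intro n x
    choose i hi hx using fun k => (hD _).1 (x k).2
    rcases Nat.eq_zero_or_pos n with rfl | hn
    · exact ⟨0, pos_iff_ne_zero.2 hj, fun k => k.elim0⟩
    · have : Nonempty (Fin n) := ⟨⟨0, hn⟩⟩
      obtain ⟨k₀, hk₀⟩ := Finite.exists_max i
      exact ⟨i k₀, hi k₀, fun k => (mono _ _ (hk₀ k) (hi k₀)).subset (hx k)⟩
  have hfun : ∀ {n : ℕ} (f : L.Functions n) (x : Fin n → U) (i k : Ordinal.{w}) (hik : i ≤ k)
      (_ : k < j) (h : ∀ l, x l ∈ (X i).D) (h' : ∀ l, x l ∈ (X k).D),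
      ((Structure.funMap f (fun l => (⟨x l, h l⟩ : (X i).D)) : (X i).D) : U) =
        (Structure.funMap f (fun l => (⟨x l, h' l⟩ : (X k).D)) : (X k).D) := by
    intro n f x i k hik hk h h'
    obtain ⟨e, -, he⟩ := mono i k hik hk
    have := e.map_fun f (fun l => ⟨x l, h l⟩)
    refine (he _).symm.trans (congrArg Subtype.val (this.trans ?_))
    congr 1
    funext l
    exact Subtype.ext (he _)
  have hrel : ∀ {n : ℕ} (r : L.Relations n) (x : Fin n → U) (i k : Ordinal.{w}) (hik : i ≤ k)
      (_ : k < j) (h : ∀ l, x l ∈ (X i).D) (h' : ∀ l, x l ∈ (X k).D),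
      Structure.RelMap r (fun l => (⟨x l, h l⟩ : (X i).D)) ↔
        Structure.RelMap r (fun l => (⟨x l, h' l⟩ : (X k).D)) := by
    intro n r x i k hik hk h h'
    obtain ⟨e, -, he⟩ := mono i k hik hk
    rw [← e.map_rel r (fun l => ⟨x l, h l⟩)]
    have : (e ∘ fun l => (⟨x l, h l⟩ : (X i).D)) = fun l => (⟨x l, h' l⟩ : (X k).D) := by
      funext l
      exact Subtype.ext (he _)
    rw [this]
  -- A tuple is evaluated in some chosen member containing it; `hfun` and `hrel` make the choice
  -- irrelevant.
  let str : L.Structure D :=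
    { funMap := fun f x => ⟨(Structure.funMap f
        (fun l => (⟨x l, (hfin x).choose_spec.2 l⟩ : (X (hfin x).choose).D)) :
          (X (hfin x).choose).D),
          hXD _ (hfin x).choose_spec.1 (Subtype.prop _)⟩
      RelMap := fun r x => Structure.RelMap r
        (fun l => (⟨x l, (hfin x).choose_spec.2 l⟩ : (X (hfin x).choose).D)) }
  refine ⟨{ D := D, str := str }, rfl, fun i hi => ?_⟩
  refine ⟨⟨⟨fun x => ⟨x, hXD i hi x.2⟩, fun x y h => Subtype.ext (Subtype.mk.inj h)⟩, ?_, ?_⟩,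
    fun x => rfl⟩
  · intro n f x
    refine Subtype.ext ?_
    let y : Fin n → D := fun l => ⟨x l, hXD i hi (x l).2⟩
    rcases le_total i (hfin y).choose with h | h
    · exact hfun f (fun l => (x l : U)) _ _ h (hfin y).choose_spec.1 (fun l => (x l).2) _
    · exact (hfun f (fun l => (x l : U)) _ _ h hi _ (fun l => (x l).2)).symm
  · intro n r x
    let y : Fin n → D := fun l => ⟨x l, hXD i hi (x l).2⟩
    rcases le_total i (hfin y).choose with h | h
    · exact (hrel r (fun l => (x l : U)) _ _ h (hfin y).choose_spec.1 (fun l => (x l).2) _).symm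
    · exact hrel r (fun l => (x l : U)) _ _ h hi _ (fun l => (x l).2)

variable (K) in
/-- `Y` is the union of `B` and the chain `⟨X i ∣ i < j⟩`. -/
structure Obj.IsSup (B : Obj L U) (j : Ordinal.{w}) (X : Ordinal.{w} → Obj L U) (Y : Obj L U) :
    Prop where
  base : B.SLE K Y
  le : ∀ i < j, (X i).SLE K Y
  mem : ∀ x, x ∈ Y.D ↔ x ∈ B.D ∨ ∃ i < j, x ∈ (X i).D
  lift : ∀ (Z : Obj L U) (h : U → U), B.Maps K h Z → (∀ i < j, (X i).Maps K h Z) → Y.Maps K h Z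

theorem Obj.IsSup.congr {B : Obj L U} {j : Ordinal.{w}} {X X' : Ordinal.{w} → Obj L U}
    {Y : Obj L U} (h : Obj.IsSup K B j X Y) (hX : ∀ i < j, X i = X' i) :
    Obj.IsSup K B j X' Y where
  base := h.base
  le i hi := hX i hi ▸ h.le i hi
  mem x := by
    rw [h.mem]
    refine or_congr_right ⟨?_, ?_⟩
    · rintro ⟨i, hi, hx⟩
      exact ⟨i, hi, hX i hi ▸ hx⟩
    · rintro ⟨i, hi, hx⟩
      exact ⟨i, hi, by rwa [hX i hi]⟩
  lift Z g hB hZ := h.lift Z g hB fun i hi => by rw [hX i hi]; exact hZ i hi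

/-- For limit `j` the first Tarski–Vaught axiom makes the members strong in the union; for successor
`j` the last member is the union. Maps out of the union come from `exists_glue`. -/
theorem Obj.exists_isSup {B : Obj L U} (hB : K.Mem B.D) (j : Ordinal.{w})
    (X : Ordinal.{w} → Obj L U) (hBX : ∀ i < j, B.SLE K (X i))
    (mono' : ∀ i k, i < k → k < j → (X i).SLE K (X k)) :
    ∃ Y, Obj.IsSup K B j X Y := by
  by_cases hj : j = 0
  · subst hj
    exact ⟨B, SLE.refl hB, fun i hi => (not_lt_zero hi).elim, fun x => by simp [not_lt_zero],
      fun Z h hZ _ => hZ⟩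
  have hpos : 0 < j := pos_iff_ne_zero.2 hj
  have mono : ∀ i k, i ≤ k → k < j → (X i).SLE K (X k) := by
    intro i k hik hk
    rcases hik.eq_or_lt with rfl | h
    · obtain ⟨e, he, -⟩ := hBX i hk
      exact SLE.refl (K.mem_cod he)
    · exact mono' i k h hk
  obtain ⟨Y, hY, hXY⟩ := Obj.exists_union hj X mono
  have hmem : ∀ x, x ∈ Y.D ↔ ∃ i < j, x ∈ (X i).D := fun x => by rw [hY]; simp
  choose e he using hXY
  let S : Ordinal.{w} → L.Substructure Y.D := fun i => if hi : i < j then (e i hi).toHom.range else ⊥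
  have hSr : ∀ i (hi : i < j), S i = (e i hi).toHom.range := fun i hi => dif_pos hi
  have hS : ∀ i < j, ∀ x, x ∈ S i ↔ (x : U) ∈ (X i).D := fun i hi x => by
    rw [hSr i hi, mem_range']
    constructor
    · rintro ⟨y, rfl⟩
      rw [he i hi]
      exact y.2
    · intro hx
      exact ⟨⟨x, hx⟩, Subtype.ext (he i hi _)⟩
  have hSmono : ∀ i k, i ≤ k → k < j → S i ≤ S k := fun i k hik hk x hx =>
    (hS k hk x).2 ((mono i k hik hk).subset ((hS i (hik.trans_lt hk) x).1 hx))
  have hSinc : ∀ i k, i ≤ k → k < j → ∃ h : S i ≤ S k, K.Strong (Substructure.inclusion h) := by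
    intro i k hik hk
    have hi := hik.trans_lt hk
    have hle := hSmono i k hik hk
    rw [hSr i hi, hSr k hk] at hle ⊢
    refine ⟨hle, ?_⟩
    obtain ⟨f, hf, hfx⟩ := mono i k hik hk
    have h₁ := K.strong_equiv (e i hi).equivRange.symm
      (mem_equiv (e i hi).equivRange (K.mem_dom hf))
    have h₂ := K.strong_equiv (e k hk).equivRange (K.mem_cod hf)
    have h := K.strong_comp (K.strong_comp h₁ hf) h₂
    convert h using 1
    ext x
    obtain ⟨y, rfl⟩ := (e i hi).equivRange.surjective x
    simp only [Embedding.comp_apply, FirstOrder.Language.Equiv.coe_toEmbedding,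
      FirstOrder.Language.Equiv.symm_apply_apply]
    have h1 : ((Substructure.inclusion hle ((e i hi).equivRange y) : (e k hk).toHom.range) : Y.D)
      = e i hi y := rfl
    rw [h1, Embedding.equivRange_apply, he i hi, he k hk, hfx]
    rfl
  have hcover : ∀ x : Y.D, ∃ i < j, x ∈ S i := fun x => by
    obtain ⟨i, hi, hx⟩ := (hmem x).1 x.2
    exact ⟨i, hi, (hS i hi x).2 hx⟩
  have hstr : ∀ i (hi : i < j), K.Strong (e i hi) := by
    intro i hi
    rw [← strong_range_iff, ← hSr i hi]
    rcases Ordinal.zero_or_succ_or_isSuccLimit j with rfl | ⟨k, rfl⟩ | hlim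
    · exact absurd rfl hj
    · have hk : k < succ k := lt_succ k
      have htop : ∀ x, x ∈ S k := fun x => by
        obtain ⟨i', hi', hx⟩ := hcover x
        exact hSmono i' k (lt_succ_iff.1 hi') hk hx
      have hkeq : S k = ⊤ := by ext x; simp [htop]
      have hSk : K.Strong (S k).subtype := by
        obtain ⟨h, hs⟩ := hSinc k k le_rfl hk
        let ek : S k ≃[L] Y.D :=
          ⟨⟨fun x => x, fun x => ⟨x, htop x⟩, fun _ => rfl, fun _ => rfl⟩, fun _ _ => rfl,
            fun _ _ => Iff.rfl⟩
        exact K.strong_equiv ek (K.mem_dom hs)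
      obtain ⟨h, hs⟩ := hSinc i k (lt_succ_iff.1 hi) hk
      exact K.strong_comp hs hSk
    · exact K.chain_strong j S hlim hSinc hcover i hi
  refine ⟨Y, (hBX 0 hpos).trans ⟨e 0 hpos, hstr 0 hpos, he 0 hpos⟩,
    fun i hi => ⟨e i hi, hstr i hi, he i hi⟩,
    fun x => ?_, fun Z h hBZ hZ => ?_⟩
  · rw [hmem]
    exact ⟨Or.inr, fun h => h.elim (fun h => ⟨0, hpos, (hBX 0 hpos).subset h⟩) id⟩
  · have hval : ∀ x : Y.D, h x ∈ Z.D := fun x => by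
      obtain ⟨i, hi, hx⟩ := (hmem x).1 x.2
      obtain ⟨f, -, hf⟩ := hZ i hi
      have := hf ⟨x, hx⟩
      exact this ▸ (f ⟨x, hx⟩).2
    obtain ⟨G, hG, hG'⟩ := exists_glue (K := K) hj S hSmono (fun _ x => (⟨h x, hval x⟩ : Z.D))
      (fun i hi => by
        obtain ⟨f, hf, hfx⟩ := hZ i hi
        rw [hSr i hi]
        refine ⟨f.comp (e i hi).equivRange.symm.toEmbedding, K.strong_comp
          (K.strong_equiv _ (mem_equiv (e i hi).equivRange (K.mem_dom hf))) hf, fun x => ?_⟩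
        obtain ⟨y, rfl⟩ := (e i hi).equivRange.surjective x
        refine Subtype.ext ?_
        simp only [Embedding.comp_apply, FirstOrder.Language.Equiv.coe_toEmbedding,
          FirstOrder.Language.Equiv.symm_apply_apply, Embedding.equivRange_apply]
        rw [hfx, he i hi]) (fun _ _ _ _ _ _ => rfl)
    obtain ⟨f, hf, hfx⟩ := hG' ⊤ (fun x => by simpa using hcover x)
    have htop := K.strong_equiv (Substructure.topEquiv (L := L) (M := Y.D)).symm
      (mem_equiv Substructure.topEquiv (K.mem_dom hf))
    refine ⟨f.comp Substructure.topEquiv.symm.toEmbedding, K.strong_comp htop hf, fun x => ?_⟩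
    obtain ⟨i, hi, hx⟩ := hcover x
    have h1 : f.comp Substructure.topEquiv.symm.toEmbedding x = G x := hfx ⟨x, trivial⟩
    rw [h1, hG i hi x hx]

theorem Obj.IsSup.card {B : Obj L U} {j : Ordinal.{w}} {X : Ordinal.{w} → Obj L U}
    {Y : Obj L U} (h : Obj.IsSup K B j X Y) (hμ : ℵ₀ ≤ μ) (hB : #B.D = μ) (hj : j.card ≤ μ)
    (hX : ∀ i < j, #(X i).D ≤ μ) : K.InCard μ Y.D := by
  obtain ⟨e, he, -⟩ := h.base
  refine ⟨K.mem_cod he, le_antisymm ?_ ?_⟩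
  · have hY : Y.D = B.D ∪ ⋃ i < j, (X i).D := by
      ext x; simp [h.mem]
    rw [hY]
    calc _ ≤ #B.D + #(⋃ i < j, (X i).D : Set U) := Cardinal.mk_union_le _ _
      _ ≤ μ + μ := add_le_add hB.le (Cardinal.mk_biUnion_le_of_le hj hμ _ hX)
      _ = μ := Cardinal.add_eq_self hμ
  · rw [← hB]
    exact Cardinal.mk_le_mk_of_subset h.base.subset

/-- An extension of `X` is isomorphic over `X` to a structure on a subset of `U`. -/
theorem Obj.exists_copy (hμ : ℵ₀ ≤ μ) (hU : μ < #U) {X : Obj L U} (hX : #X.D = μ) {N : Type w}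
    [L.Structure N] (e : X.D ↪[L] N) (he : K.Strong e) (hN : #N = μ) :
    ∃ (Y : Obj L U) (φ : N ≃[L] Y.D), K.InCard μ Y.D ∧ X.SLE K Y ∧ ∀ x, (φ (e x) : U) = x := by
  classical
  have : Infinite U := Cardinal.infinite_iff.2 (hμ.trans hU.le)
  -- As `U` has more than `μ` elements, the complement of `X` has room for the new elements of `N`.
  have hc : #N ≤ #(X.Dᶜ : Set U) := by
    rw [Cardinal.mk_compl_of_infinite _ (hX.trans_lt hU), hN]
    exact hU.le
  obtain ⟨ψ⟩ := Cardinal.le_def _ _ |>.1 hc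
  let φ₀ : N → U := fun n => if h : ∃ x, e x = n then h.choose else ψ n
  have h₁ : ∀ x, φ₀ (e x) = x := fun x => by
    have h : ∃ y, e y = e x := ⟨x, rfl⟩
    have : φ₀ (e x) = h.choose := dif_pos h
    rw [this, e.injective h.choose_spec]
  have h₂ : ∀ n, (¬ ∃ x, e x = n) → φ₀ n = ψ n := fun n h => dif_neg h
  have hinj : Function.Injective φ₀ := by
    intro m n hmn
    by_cases hm : ∃ x, e x = m <;> by_cases hn : ∃ x, e x = n
    · obtain ⟨x, rfl⟩ := hm
      obtain ⟨y, rfl⟩ := hn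
      rw [h₁, h₁] at hmn
      rw [Subtype.ext hmn]
    · obtain ⟨x, rfl⟩ := hm
      rw [h₁, h₂ n hn] at hmn
      exact absurd (hmn ▸ x.2) (ψ n).2
    · obtain ⟨x, rfl⟩ := hn
      rw [h₁, h₂ m hm] at hmn
      exact absurd (hmn.symm ▸ x.2) (ψ m).2
    · rw [h₂ m hm, h₂ n hn] at hmn
      exact ψ.injective (Subtype.ext hmn)
  let E : N ≃ Set.range φ₀ := _root_.Equiv.ofInjective φ₀ hinj
  obtain ⟨Y, φ, hφ⟩ : ∃ (Y : Obj L U) (φ : N ≃[L] Y.D), ∀ n, (φ n : U) = φ₀ n :=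
    ⟨{ D := Set.range φ₀, str := E.inducedStructure }, E.inducedStructureEquiv, fun _ => rfl⟩
  have hs := K.strong_equiv φ (K.mem_cod he)
  refine ⟨Y, φ, ⟨K.mem_cod hs, ?_⟩, ⟨φ.toEmbedding.comp e, K.strong_comp he hs, fun x => ?_⟩,
    fun x => ?_⟩
  · rw [← hN]; exact (Cardinal.mk_congr φ.toEquiv).symm
  · exact (hφ _).trans (h₁ x)
  · exact (hφ _).trans (h₁ x)

theorem Obj.exists_copy' (hU : μ < #U) {N : Type w} [L.Structure N] (hN : K.InCard μ N) :
    ∃ Y : Obj L U, Nonempty (N ≃[L] Y.D) := by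
  obtain ⟨φ⟩ := Cardinal.le_def N U |>.1 (hN.2.trans_le hU.le)
  let E : N ≃ Set.range φ := _root_.Equiv.ofInjective φ φ.injective
  exact ⟨{ D := Set.range φ, str := E.inducedStructure }, ⟨E.inducedStructureEquiv⟩⟩

/-- Each step is applied to the union `X'` of `B` and all earlier models, so zero, successor and
limit stages are not distinguished. -/
theorem Obj.exists_chain (hμ : ℵ₀ ≤ μ) {o : Ordinal.{w}} (ho : o ≤ (succ μ).ord) {B : Obj L U}
    (hB : K.InCard μ B.D) (Φ : Ordinal.{w} → Obj L U → Obj L U → Prop)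
    (step : ∀ i X, K.InCard μ X.D → B.SLE K X → ∃ Y, K.InCard μ Y.D ∧ X.SLE K Y ∧ Φ i X Y) :
    ∃ X : Ordinal.{w} → Obj L U, ∀ j < o, K.InCard μ (X j).D ∧ B.SLE K (X j) ∧
      ∃ X', K.InCard μ X'.D ∧ Obj.IsSup K B j X X' ∧ X'.SLE K (X j) ∧ Φ j X' (X j) := by
  have : Nonempty (Obj L U) := ⟨B⟩
  refine exists_transfinite (fun j f Y => K.InCard μ Y.D ∧ B.SLE K Y ∧
      ∃ X', K.InCard μ X'.D ∧ Obj.IsSup K B j f X' ∧ X'.SLE K Y ∧ Φ j X' Y) ?_ o ?_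
  · rintro j f g Y hfg ⟨h₁, h₂, X', h₃, h₄, h₅⟩
    exact ⟨h₁, h₂, X', h₃, h₄.congr hfg, h₅⟩
  · intro j hj f hf
    have hjc : j.card ≤ μ := lt_succ_iff.1 (Cardinal.lt_ord.1 (hj.trans_le ho))
    obtain ⟨X', hX'⟩ := Obj.exists_isSup hB.1 j f (fun i hi => (hf i hi).2.1) fun i k hik hk => by
      obtain ⟨-, -, Z, -, hZ, hZk, -⟩ := hf k hk
      exact (hZ.le i hik).trans hZk
    have hc := hX'.card hμ hB.2 hjc fun i hi => (hf i hi).1.2.le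
    obtain ⟨Y, hY, hXY, hΦ⟩ := step j X' hc hX'.base
    exact ⟨Y, hY, hX'.base.trans hXY, X', hc, hX', hXY, hΦ⟩

end

section

variable {L : FirstOrder.Language.{u, v}} {K : AEC.{u, v, w} L} {μ : Cardinal.{w}} {U : Type w}

/-! ### Universal extensions -/

theorem exists_enum {X : Type*} [Nonempty X] {c : Cardinal.{w}}
    (h : Cardinal.lift.{w} #X ≤ Cardinal.lift c) :
    ∃ m : Ordinal.{w} → X, ∀ x, ∃ i < c.ord, m i = x := by
  classical
  have h' : Cardinal.lift.{w} #X ≤ Cardinal.lift #c.ord.ToType := by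
    rwa [Cardinal.mk_toType, Cardinal.card_ord]
  obtain ⟨g⟩ := Cardinal.lift_mk_le'.1 h'
  refine ⟨fun i => if h : ∃ x, ((g x).toOrd : Ordinal) = i then h.choose else Classical.arbitrary X,
    fun x => ⟨(g x).toOrd, (g x).toOrd.2, ?_⟩⟩
  have hex : ∃ y, ((g y).toOrd : Ordinal) = (g x).toOrd := ⟨x, rfl⟩
  refine (dif_pos hex).trans ?_
  exact g.injective (Ordinal.ToType.mk.symm.injective (Subtype.ext hex.choose_spec))

theorem tp_comp {M N P : Type w} [L.Structure M] [L.Structure N] [L.Structure P] {f : M ↪[L] N}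
    (hf : K.Strong f) (hN : #N = μ) (a : N) {g : N ↪[L] P} (hg : K.Strong g) (hP : #P = μ) :
    tp f hf hN a = tp (g.comp f) (K.strong_comp hf hg) hP (g a) :=
  Quot.sound ⟨P, _, g, Embedding.refl L P, hP, hg, strong_refl (K.mem_cod hg), rfl, rfl⟩

variable (K μ) in
/-- The type `p` over `X` is realized in `Y`. -/
def Obj.Realizes (X Y : Obj L U) (p : GaType K μ X.D) : Prop :=
  ∃ (e : X.D ↪[L] Y.D) (he : K.Strong e) (hY : #Y.D = μ) (c : Y.D),
    (∀ x, (e x : U) = x) ∧ p = tp e he hY c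

theorem Obj.Realizes.mono {X Y Z : Obj L U} {p : GaType K μ X.D} (h : X.Realizes K μ Y p)
    (hYZ : Y.SLE K Z) (hZ : #Z.D = μ) : X.Realizes K μ Z p := by
  obtain ⟨e, he, hY, c, hx, rfl⟩ := h
  obtain ⟨f, hf, hfx⟩ := hYZ
  exact ⟨f.comp e, K.strong_comp he hf, hZ, f c, fun x => by simp [hfx, hx],
    tp_comp he hY c hf hZ⟩

/-- Amalgamate `X` over `B` with a model in which `p` is realized, and copy the result into `U` over
`X`. -/
theorem Obj.exists_realizes (hμ : ℵ₀ ≤ μ) (hU : μ < #U) (hAP : K.Amalgamation μ) {B X : Obj L U}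
    (hB : #B.D = μ) (hX : #X.D = μ) (hBX : B.SLE K X) (p : GaType K μ B.D) :
    ∃ Y, K.InCard μ Y.D ∧ X.SLE K Y ∧ B.Realizes K μ Y p := by
  obtain ⟨q, rfl⟩ := Quot.exists_rep p
  obtain ⟨e, he, hex⟩ := hBX
  obtain ⟨P, _, f₁, f₂, hP, hf₁, hf₂, hf⟩ := hAP B.D q.N X.D q.emb e hB q.card hX q.strong he
  obtain ⟨Y, φ, hY, hXY, hφ⟩ := Obj.exists_copy hμ hU hX f₂ hf₂ hP
  have hφs := K.strong_equiv φ (K.mem_cod hf₂)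
  have hcomp := K.strong_comp (K.strong_comp he hf₂) hφs
  refine ⟨Y, hY, hXY, φ.toEmbedding.comp (f₂.comp e), hcomp, hY.2, φ (f₁ q.a), fun x => ?_, ?_⟩
  · exact (hφ _).trans (hex x)
  · refine Quot.sound ⟨Y.D, _, φ.toEmbedding.comp f₁, Embedding.refl L _, hY.2,
      K.strong_comp hf₁ hφs, strong_refl hY.1, ?_, rfl⟩
    rw [Embedding.comp_assoc, hf, Embedding.refl_comp]

theorem mk_gaType_nonempty {M : Type w} [L.Structure M] (hM : K.InCard μ M) [Nonempty M] :
    Nonempty (GaType K μ M) :=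
  ⟨tp (Embedding.refl L M) (strong_refl hM.1) hM.2 (Classical.arbitrary M)⟩

theorem ord_le_succ_ord (μ : Cardinal.{w}) : μ.ord ≤ (succ μ).ord :=
  Cardinal.ord_le_ord.2 (le_succ μ)

theorem nonempty_of_card (hμ : ℵ₀ ≤ μ) {M : Type w} (hM : #M = μ) : Nonempty M := by
  rw [← Cardinal.mk_ne_zero_iff, hM]
  exact (Cardinal.aleph0_pos.trans_le hμ).ne'

/-- Stability bounds the number of types by `μ`, so a chain of length `μ` realizes them one at a
time, and realized types stay realized. -/
theorem Obj.exists_realizes_all (hμ : ℵ₀ ≤ μ) (hU : μ < #U) (hAP : K.Amalgamation μ)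
    (hSt : K.Stable μ) {B : Obj L U} (hB : K.InCard μ B.D) :
    ∃ Y, K.InCard μ Y.D ∧ B.SLE K Y ∧ ∀ p, B.Realizes K μ Y p := by
  have := nonempty_of_card hμ hB.2
  have := mk_gaType_nonempty hB
  obtain ⟨t, ht⟩ := exists_enum (X := GaType K μ B.D) (c := μ) (by
    have h := Cardinal.lift_le.{w}.2 (hSt B.D hB)
    rwa [Cardinal.lift_lift] at h)
  obtain ⟨X, hX⟩ := Obj.exists_chain hμ (ord_le_succ_ord μ) hB
    (fun i X Y => B.Realizes K μ Y (t i)) (fun i X hX hBX =>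
      Obj.exists_realizes hμ hU hAP hB.2 hX.2 hBX (t i))
  obtain ⟨Y, hY⟩ := Obj.exists_isSup hB.1 μ.ord X (fun i hi => (hX i hi).2.1) fun i k hik hk => by
    obtain ⟨-, -, Z, -, hZ, hZk, -⟩ := hX k hk
    exact (hZ.le i hik).trans hZk
  have hc := hY.card hμ hB.2 (Cardinal.card_ord μ).le fun i hi => (hX i hi).1.2.le
  refine ⟨Y, hc, hY.base, fun p => ?_⟩
  obtain ⟨i, hi, rfl⟩ := ht p
  obtain ⟨-, -, -, -, -, -, h⟩ := hX i hi
  exact h.mono (hY.le i hi) hc.2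

/-- If `i` maps into the range of the strong embedding `e`, it factors through `e`. -/
theorem exists_factor {M N P : Type w} [L.Structure M] [L.Structure N] [L.Structure P]
    {e : N ↪[L] P} {i : M ↪[L] P} (he : K.Strong e) (hi : K.Strong i)
    (h : ∀ m, ∃ n, e n = i m) : ∃ f : M ↪[L] N, K.Strong f ∧ e.comp f = i := by
  let f : M ↪[L] N := e.equivRange.symm.toEmbedding.comp
    (i.codRestrict e.toHom.range fun m => (mem_range' e _).2 (h m))
  have hf : e.comp f = i := by
    ext m
    have : ((e.equivRange (f m) : e.toHom.range) : P) = i m := by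
      simp [f]
    exact this
  exact ⟨f, K.coherence he (by rw [hf]; exact hi), hf⟩

/-- A model all of whose types are repeatedly realized along a chain of length `μ` embeds every
extension of the first model of the chain. -/
theorem Obj.exists_embedding_of_chain (hμ : ℵ₀ ≤ μ) (hU : μ < #U) (hAP : K.Amalgamation μ)
    {B : Obj L U} {X X' : Ordinal.{w} → Obj L U}
    (hX : ∀ j < μ.ord, K.InCard μ (X j).D ∧ B.SLE K (X j) ∧ K.InCard μ (X' j).D ∧
      Obj.IsSup K B j X (X' j) ∧ (X' j).SLE K (X j) ∧ ∀ p, (X' j).Realizes K μ (X j) p)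
    {Y : Obj L U} (hY : Obj.IsSup K B μ.ord X Y) {M' : Obj L U} (hM' : K.InCard μ M'.D)
    {g : U → U} (hg : B.Maps K g M') :
    ∃ f : M'.D ↪[L] Y.D, K.Strong f ∧ ∀ x ∈ B.D, ∀ hgx : g x ∈ M'.D,
      (f ⟨g x, hgx⟩ : U) = x := by
  classical
  have := nonempty_of_card hμ hM'.2
  obtain ⟨m, hm⟩ := exists_enum (X := M'.D) (c := μ) (by
    rw [hM'.2])
  have : Nonempty (Obj L U × (U → U)) := ⟨(B, id)⟩
  -- `F j` consists of an extension of `M'` and a map embedding `X j` into it, extending the earlier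
  -- maps. The last clause puts the `j`-th element of `M'` into its image.
  obtain ⟨F, hF⟩ := exists_transfinite (X := Obj L U × (U → U))
    (fun j f Z => K.InCard μ Z.1.D ∧ M'.SLE K Z.1 ∧
      (∀ i < j, (f i).1.SLE K Z.1 ∧ ∀ x ∈ (X i).D, Z.2 x = (f i).2 x) ∧
      (∀ x ∈ B.D, Z.2 x = g x) ∧ (X j).Maps K Z.2 Z.1 ∧ ∃ x ∈ (X j).D, Z.2 x = m j)
    (by
      rintro j f f' Z hff ⟨h₁, h₂, h₃, h₄⟩
      exact ⟨h₁, h₂, fun i hi => hff i hi ▸ h₃ i hi, h₄⟩) μ.ord (by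
    intro j hj f hf
    obtain ⟨hXc, -, hX'c, hsup, hXX, hreal⟩ := hX j hj
    obtain ⟨D, hD⟩ := Obj.exists_isSup hM'.1 j (fun i => (f i).1) (fun i hi => (hf i hi).2.1)
      fun i k hik hk => ((hf k hk).2.2.1 i hik).1
    have hjc : j.card ≤ μ := (Cardinal.lt_ord.1 hj).le
    have hDc := hD.card hμ hM'.2 hjc fun i hi => (hf i hi).1.2.le
    have hcoh : ∀ i k, i ≤ k → k < j → ∀ x ∈ (X i).D, (f k).2 x = (f i).2 x := by
      intro i k hik hk x hx
      rcases hik.eq_or_lt with rfl | h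
      · rfl
      · exact ((hf k hk).2.2.1 i h).2 x hx
    let h' : U → U := fun x => if h : ∃ i < j, x ∈ (X i).D then (f h.choose).2 x else g x
    have hh₁ : ∀ i < j, ∀ x ∈ (X i).D, h' x = (f i).2 x := by
      intro i hi x hx
      have h : ∃ i < j, x ∈ (X i).D := ⟨i, hi, hx⟩
      have hh : h' x = (f h.choose).2 x := dif_pos h
      rw [hh]
      rcases le_total i h.choose with hle | hle
      · exact hcoh _ _ hle h.choose_spec.1 x hx
      · exact (hcoh _ _ hle hi x h.choose_spec.2).symm
    have hh₂ : ∀ x ∈ B.D, h' x = g x := by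
      intro x hx
      by_cases h : ∃ i < j, x ∈ (X i).D
      · obtain ⟨i, hi, hxi⟩ := h
        rw [hh₁ i hi x hxi, (hf i hi).2.2.2.1 x hx]
      · exact dif_neg h
    obtain ⟨e, he, hex⟩ : (X' j).Maps K h' D := by
      refine hsup.lift D h' (((hg.comp hD.base).congr fun x hx => ?_)) fun i hi => ?_
      · simpa using hh₂ x hx
      · refine ((hf i hi).2.2.2.2.1.comp (hD.le i hi)).congr fun x hx => ?_
        simpa using hh₁ i hi x hx
    have hmD : (m j : U) ∈ D.D := hD.base.subset (m j).2
    -- The type of `m j` over `X' j`, embedded by the map built so far, is realized by some `c` in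
    -- `X j`. Equality of types gives an amalgam of `D` and `X j` in which `m j` and `c` are
    -- identified.
    obtain ⟨e', he', hXj, c, hex', hpc⟩ := hreal (tp e he hDc.2 ⟨m j, hmD⟩)
    obtain ⟨P, _, g₂, g₁, hP, hg₂, hg₁, hge, hgc⟩ := (PreType.mk_eq_iff hAP).1 hpc
    obtain ⟨Z, φ, hZ, hDZ, hφ⟩ := Obj.exists_copy hμ hU hDc.2 g₂ hg₂ hP
    have hφs := K.strong_equiv φ (K.mem_cod hg₂)
    let k : (X j).D ↪[L] Z.D := φ.toEmbedding.comp g₁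
    let h : U → U := fun x => if hx : x ∈ (X j).D then k ⟨x, hx⟩ else x
    have hk : ∀ x : (X j).D, (k x : U) = h x := fun x => by
      simp only [h, x.2, dif_pos]
    have hX'X : ∀ x ∈ (X' j).D, h x = h' x := by
      intro x hx
      have h₁ : h x = k (e' ⟨x, hx⟩) := by
        rw [hk, hex']
      have h₂ : g₂ (e ⟨x, hx⟩) = g₁ (e' ⟨x, hx⟩) := DFunLike.congr_fun hge ⟨x, hx⟩
      rw [h₁]
      change (φ (g₁ (e' ⟨x, hx⟩)) : U) = _
      rw [← h₂, hφ, hex]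
    refine ⟨(Z, h), hZ, hD.base.trans hDZ, fun i hi => ⟨(hD.le i hi).trans hDZ, fun x hx => ?_⟩,
      fun x hx => ?_, ⟨k, K.strong_comp hg₁ hφs, hk⟩, c, c.2, ?_⟩
    · exact (hX'X x ((hsup.mem x).2 (Or.inr ⟨i, hi, hx⟩))).trans (hh₁ i hi x hx)
    · exact (hX'X x ((hsup.mem x).2 (Or.inl hx))).trans (hh₂ x hx)
    · refine (hk c).symm.trans ?_
      change (φ (g₁ c) : U) = _
      have : g₂ ⟨m j, hmD⟩ = g₁ c := hgc
      rw [← this, hφ])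
  have hpos : 0 < μ.ord := by
    rw [Cardinal.lt_ord, Ordinal.card_zero]
    exact Cardinal.aleph0_pos.trans_le hμ
  obtain ⟨D, hD⟩ := Obj.exists_isSup hM'.1 μ.ord (fun i => (F i).1) (fun i hi => (hF i hi).2.1)
      fun i k hik hk => ((hF k hk).2.2.1 i hik).1
  have hcoh : ∀ i k, i ≤ k → k < μ.ord → ∀ x ∈ (X i).D, (F k).2 x = (F i).2 x := by
    intro i k hik hk x hx
    rcases hik.eq_or_lt with rfl | h
    · rfl
    · exact ((hF k hk).2.2.1 i h).2 x hx
  let h' : U → U := fun x => if h : ∃ i < μ.ord, x ∈ (X i).D then (F h.choose).2 x else g x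
  have hh₁ : ∀ i < μ.ord, ∀ x ∈ (X i).D, h' x = (F i).2 x := by
    intro i hi x hx
    have h : ∃ i < μ.ord, x ∈ (X i).D := ⟨i, hi, hx⟩
    have hh : h' x = (F h.choose).2 x := dif_pos h
    rw [hh]
    rcases le_total i h.choose with hle | hle
    · exact hcoh _ _ hle h.choose_spec.1 x hx
    · exact (hcoh _ _ hle hi x h.choose_spec.2).symm
  have hB0 : B.D ⊆ (X 0).D := (hX 0 hpos).2.1.subset
  have hh₂ : ∀ x ∈ B.D, h' x = g x := fun x hx => by
    rw [hh₁ 0 hpos x (hB0 hx), (hF 0 hpos).2.2.2.1 x hx]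
  obtain ⟨e, he, hex⟩ : Y.Maps K h' D := by
    refine hY.lift D h' (((hg.comp hD.base).congr fun x hx => ?_)) fun i hi => ?_
    · simpa using hh₂ x hx
    · refine ((hF i hi).2.2.2.2.1.comp (hD.le i hi)).congr fun x hx => ?_
      simpa using hh₁ i hi x hx
  obtain ⟨i, hi, hix⟩ := hD.base
  -- Every element of `M'` has been hit, so the inclusion of `M'` into `D` factors through `e`. The
  -- factor is the required embedding into `Y`.
  obtain ⟨f, hf, hfi⟩ := exists_factor he hi (fun y => by
    obtain ⟨j, hj, rfl⟩ := hm y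
    obtain ⟨-, -, -, -, -, x, hx, hxm⟩ := hF j hj
    refine ⟨⟨x, (hY.le j hj).subset hx⟩, Subtype.ext ?_⟩
    rw [hex, hix, ← hxm, hh₁ j hj x hx]; rfl)
  refine ⟨f, hf, fun x hx hgx => ?_⟩
  have h₁ : e (f ⟨g x, hgx⟩) = i ⟨g x, hgx⟩ := DFunLike.congr_fun hfi _
  have h₂ : e ⟨x, hY.base.subset hx⟩ = i ⟨g x, hgx⟩ := by
    refine Subtype.ext ?_
    rw [hex, hix]
    exact hh₂ x hx
  exact congrArg Subtype.val (e.injective (h₁.trans h₂.symm))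

/-- The union of a chain of length `μ` works if each member realizes all types over the union of the
earlier ones. -/
theorem Obj.exists_universal (hμ : ℵ₀ ≤ μ) (hU : μ < #U) (hAP : K.Amalgamation μ)
    (hSt : K.Stable μ) {B : Obj L U} (hB : K.InCard μ B.D) :
    ∃ Y : Obj L U, K.InCard μ Y.D ∧ ∃ e : B.D ↪[L] Y.D, K.UniversalOver μ e ∧
      ∀ x, (e x : U) = x := by
  obtain ⟨X, hX⟩ := Obj.exists_chain hμ (ord_le_succ_ord μ) hB
    (fun i X Y => ∀ p, X.Realizes K μ Y p) (fun i X hX hBX =>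
      Obj.exists_realizes_all hμ hU hAP hSt hX)
  obtain ⟨Y, hY⟩ := Obj.exists_isSup hB.1 μ.ord X (fun i hi => (hX i hi).2.1) fun i k hik hk => by
    obtain ⟨-, -, Z, -, hZ, hZk, -⟩ := hX k hk
    exact (hZ.le i hik).trans hZk
  have hc := hY.card hμ hB.2 (Cardinal.card_ord μ).le fun i hi => (hX i hi).1.2.le
  obtain ⟨e, he, hex⟩ := hY.base
  have : Nonempty (Obj L U) := ⟨B⟩
  choose! X' hX' using fun j hj => (hX j hj).2.2
  refine ⟨Y, hc, e, ⟨he, hB.2, hc.2, ?_⟩, hex⟩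
  intro M' _ g hM' hg
  obtain ⟨Z, φ, hZ, hBZ, hφ⟩ := Obj.exists_copy hμ hU hB.2 g hg hM'
  obtain ⟨f, hf, hfx⟩ := Obj.exists_embedding_of_chain hμ hU hAP
    (fun j hj => ⟨(hX j hj).1, (hX j hj).2.1, hX' j hj⟩) hY hZ hBZ
  refine ⟨f.comp φ.toEmbedding, K.strong_comp (K.strong_equiv φ (K.mem_cod hg)) hf, ?_⟩
  ext x
  rw [hex]
  have h₁ : φ (g x) = ⟨x, hBZ.subset x.2⟩ := Subtype.ext (hφ x)
  have := hfx x x.2 (hBZ.subset x.2)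
  simp only [Embedding.comp_apply, FirstOrder.Language.Equiv.coe_toEmbedding]
  rw [h₁]
  exact this

/-! ### The monster model -/

variable (K μ) in
/-- `C` is a model of cardinality at most `μ⁺` that is model-homogeneous for models in `K_μ`. -/
structure Monster (C : Type w) [L.Structure C] : Prop where
  mem : K.Mem C
  card : #C ≤ succ μ
  exists_extension : ∀ (M N : Type w) [L.Structure M] [L.Structure N] (i : M ↪[L] C)
    (g : M ↪[L] N), #M = μ → #N = μ → K.Strong i → K.Strong g →
    ∃ h : N ↪[L] C, K.Strong h ∧ h.comp g = i

/-- A chain of length μ⁺ is built whose members are universal over the union of the earlier ones;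
homogeneity of its union comes from the regularity of μ⁺. -/
theorem exists_monster (hμ : ℵ₀ ≤ μ) (hAP : K.Amalgamation μ) (hSt : K.Stable μ) {M₀ : Type w}
    [L.Structure M₀] (hM₀ : K.InCard μ M₀) :
    ∃ (C : Type w) (_ : L.Structure C), K.Monster μ C ∧ ∃ e : M₀ ↪[L] C, K.Strong e := by
  let U : Type w := (succ μ).out
  have hU : #U = succ μ := Cardinal.mk_out _
  have hU' : μ < #U := hU ▸ lt_succ μ
  obtain ⟨B, ⟨ψ⟩⟩ := Obj.exists_copy' (U := U) hU' hM₀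
  have hψ := K.strong_equiv ψ hM₀.1
  have hB : K.InCard μ B.D := ⟨K.mem_cod hψ, (Cardinal.mk_congr ψ.toEquiv).symm.trans hM₀.2⟩
  obtain ⟨X, hX⟩ := Obj.exists_chain hμ le_rfl hB
    (fun i X Y => ∃ e : X.D ↪[L] Y.D, K.UniversalOver μ e ∧ ∀ x, (e x : U) = x)
    (fun i X hX hBX => by
      obtain ⟨Y, hY, e, he, hex⟩ := Obj.exists_universal hμ hU' hAP hSt hX
      exact ⟨Y, hY, ⟨e, he.1, hex⟩, e, he, hex⟩)
  have hmono : ∀ i k, i < k → k < (succ μ).ord → (X i).SLE K (X k) := fun i k hik hk => by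
    obtain ⟨-, -, Z, -, hZ, hZk, -⟩ := hX k hk
    exact (hZ.le i hik).trans hZk
  obtain ⟨Y, hY⟩ := Obj.exists_isSup hB.1 (succ μ).ord X (fun i hi => (hX i hi).2.1) hmono
  obtain ⟨b, hb, -⟩ := hY.base
  have hreg := Cardinal.isRegular_succ hμ
  have hlim : IsSuccLimit (succ μ).ord := Cardinal.isSuccLimit_ord (hμ.trans (le_succ μ))
  refine ⟨Y.D, inferInstance, ⟨K.mem_cod hb, (Cardinal.mk_set_le _).trans hU.le, ?_⟩,
    b.comp ψ.toEmbedding, K.strong_comp hψ hb⟩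
  intro M N _ _ i g hM hN hi hg
  have hidx : ∀ x : M, ∃ k < (succ μ).ord, (i x : U) ∈ (X k).D := fun x => by
    rcases (hY.mem (i x)).1 (i x).2 with h | h
    · have h0 : 0 < (succ μ).ord := hlim.bot_lt
      exact ⟨0, h0, (hX 0 h0).2.1.subset h⟩
    · exact h
  choose k hk hik using hidx
  -- A submodel of size `μ` is contained in a member of the chain, because μ⁺ is regular.
  have hsup : (⨆ x, k x) < (succ μ).ord := by
    refine Ordinal.iSup_lt_of_lt_cof ?_ hk
    rw [hM]
    exact (lt_succ μ).trans_le hreg.2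
  set s := ⨆ x, k x with hs
  have hs1 : s + 1 < (succ μ).ord := hlim.succ_lt hsup
  obtain ⟨hXc, -, Z, hZ, hZs, hZX, e, he, hex⟩ := hX (s + 1) hs1
  have hmem : ∀ x, (i x : U) ∈ Z.D := fun x => by
    have hks : k x < s + 1 := Order.lt_add_one_iff.2 (Ordinal.le_iSup k x)
    exact (hZs.le _ hks).subset (hik x)
  obtain ⟨z, hz, hzx⟩ : Z.SLE K Y := hZX.trans (hY.le _ hs1)
  obtain ⟨y, hy, hyx⟩ := hY.le _ hs1
  obtain ⟨f, hf, hfi⟩ := exists_factor hz hi fun m => ⟨⟨i m, hmem m⟩, Subtype.ext (hzx _)⟩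
  -- `N` and `Z` are amalgamated over `M`; universality over `Z` then brings the amalgam back into
  -- the chain.
  obtain ⟨P, _, p₁, p₂, hP, hp₁, hp₂, hp⟩ := hAP M N Z.D g f hM hN hZ.2 hg hf
  obtain ⟨h, hh, hhe⟩ := he.2.2.2 P p₂ hP hp₂
  refine ⟨y.comp (h.comp p₁), K.strong_comp (K.strong_comp hp₁ hh) hy, ?_⟩
  ext x
  have h₁ : p₁ (g x) = p₂ (f x) := DFunLike.congr_fun hp x
  have h₂ : h (p₂ (f x)) = e (f x) := DFunLike.congr_fun hhe _
  have h₃ : z (f x) = i x := DFunLike.congr_fun hfi x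
  simp only [Embedding.comp_apply]
  rw [h₁, h₂, hyx, ← h₃, hzx]
  exact hex _

end

section

variable {L : FirstOrder.Language.{u, v}} {K : AEC.{u, v, w} L} {μ : Cardinal.{w}}
variable {C : Type w} [L.Structure C]

/-! ### Automorphisms of the monster model -/

/-- A base map takes care of length `0`, so coherence is only required for strictly increasing pairs
of indices. -/
theorem exists_glue_base {A B : Type w} [L.Structure A] [L.Structure B] {j : Ordinal.{w}}
    {S₀ : L.Substructure A} {S : Ordinal.{w} → L.Substructure A} {F₀ : A → B}
    {F : Ordinal.{w} → A → B} (h₀ : K.StrongOn F₀ S₀) (hS₀ : ∀ i < j, S₀ ≤ S i)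
    (hF₀ : ∀ i < j, ∀ x ∈ S₀, F i x = F₀ x)
    (mono : ∀ i k, i < k → k < j → S i ≤ S k)
    (hF : ∀ i < j, K.StrongOn (F i) (S i))
    (coh : ∀ i k, i < k → k < j → ∀ x ∈ S i, F k x = F i x) :
    ∃ G : A → B, (∀ x ∈ S₀, G x = F₀ x) ∧ (∀ i < j, ∀ x ∈ S i, G x = F i x) ∧
      ∀ T : L.Substructure A, (∀ x, x ∈ T ↔ x ∈ S₀ ∨ ∃ i < j, x ∈ S i) → K.StrongOn G T := by
  by_cases hj : j = 0
  · subst hj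
    refine ⟨F₀, fun _ _ => rfl, fun i hi => (not_lt_zero hi).elim, fun T hT => ?_⟩
    have : T = S₀ := by
      ext x; simp [hT, not_lt_zero]
    rwa [this]
  have hpos : 0 < j := pos_iff_ne_zero.2 hj
  obtain ⟨G, hG, hG'⟩ := exists_glue hj S (fun i k hik hk => hik.eq_or_lt.elim
      (fun h => h ▸ le_rfl) fun h => mono i k h hk) F hF (fun i k hik hk => hik.eq_or_lt.elim
      (fun h => by subst h; exact fun _ _ => rfl) fun h => coh i k h hk)
  refine ⟨G, fun x hx => ?_, hG, fun T hT => hG' T fun x => ?_⟩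
  · rw [hG 0 hpos x (hS₀ 0 hpos hx), hF₀ 0 hpos x hx]
  · rw [hT]
    exact ⟨fun h => h.elim (fun h => ⟨0, hpos, hS₀ 0 hpos h⟩) id, Or.inr⟩

theorem Monster.exists_mod_insert (hLS : K.LS ≤ μ) {D : L.Substructure C} (hD : K.Mod μ D)
    (c : C) : ∃ D', K.Mod μ D' ∧ D ≤ D' ∧ c ∈ D' := by
  obtain ⟨S, hS, hc, hle⟩ := exists_mod hLS hD {c} (by
    rw [Cardinal.mk_singleton]
    exact Cardinal.one_le_aleph0.trans (ls_spec hLS).1)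
  exact ⟨S, hS, hle, hc rfl⟩

theorem Monster.exists_forth (hLS : K.LS ≤ μ) (hC : K.Monster μ C) {D : L.Substructure C}
    {F : C → C} (hD : K.Mod μ D) (hF : K.StrongOn F D) (c : C) :
    ∃ (D' : L.Substructure C) (F' : C → C), K.Mod μ D' ∧ K.StrongOn F' D' ∧ D ≤ D' ∧
      (∀ x ∈ D, F' x = F x) ∧ c ∈ D' := by
  classical
  obtain ⟨D', hD', hle, hc⟩ := Monster.exists_mod_insert hLS hD c
  obtain ⟨e, he, hex⟩ := hF
  obtain ⟨h, hh, hhe⟩ := hC.exists_extension D D' e (Substructure.inclusion hle) hD.2 hD'.2 he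
    (K.strong_inclusion hle hD.1 hD'.1)
  refine ⟨D', fun x => if hx : x ∈ D' then h ⟨x, hx⟩ else x, hD',
    ⟨h, hh, fun x => by simp⟩, hle, fun x hx => ?_, hc⟩
  have h₁ : h ⟨x, hle hx⟩ = e ⟨x, hx⟩ := DFunLike.congr_fun hhe ⟨x, hx⟩
  simp only [hle hx, dif_pos, h₁, hex]

/-- A model `R` containing `c` and the image of `F` is embedded by `k` so as to extend the inverse
of `F`. The new domain is the range of `k`, and `F'` inverts `k`. -/
theorem Monster.exists_back (hLS : K.LS ≤ μ) (hC : K.Monster μ C) {D : L.Substructure C}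
    {F : C → C} (hD : K.Mod μ D) (hF : K.StrongOn F D) (c : C) :
    ∃ (D' : L.Substructure C) (F' : C → C), K.Mod μ D' ∧ K.StrongOn F' D' ∧ D ≤ D' ∧
      (∀ x ∈ D, F' x = F x) ∧ ∃ y ∈ D', F' y = c := by
  classical
  obtain ⟨e, he, hex⟩ := hF
  obtain ⟨R, hR, hle, hc⟩ := Monster.exists_mod_insert hLS (Mod.range he hD.2) c
  obtain ⟨g, hg, hge⟩ := exists_factor hR.1 he fun m => ⟨⟨e m, hle (by simp)⟩, rfl⟩
  obtain ⟨k, hk, hkg⟩ := hC.exists_extension D R D.subtype g hD.2 hR.2 hD.1 hg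
  let E : k.toHom.range ↪[L] C := R.subtype.comp k.equivRange.symm.toEmbedding
  have hE : K.Strong E := K.strong_comp
    (K.strong_equiv _ (mem_equiv k.equivRange (K.mem_dom hk))) hR.1
  have hEk : ∀ y : R, E (k.equivRange y) = y := fun y => by simp [E]
  let F' : C → C := fun x => if hx : x ∈ k.toHom.range then E ⟨x, hx⟩ else x
  have hF' : ∀ x : k.toHom.range, E x = F' x := fun x => by
    have : F' x = E ⟨x, x.2⟩ := dif_pos x.2
    rw [this]
  have hF'k : ∀ y : R, F' (k y) = y := fun y => by
    rw [← hEk, hF']; rfl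
  have hDk : ∀ x : D, k (g x) = x := fun x => DFunLike.congr_fun hkg x
  refine ⟨k.toHom.range, F', Mod.range hk hR.2, ⟨E, hE, hF'⟩, fun x hx => ?_, fun x hx => ?_,
    k ⟨c, hc⟩, by simp, hF'k _⟩
  · exact (mem_range' _ _).2 ⟨g ⟨x, hx⟩, hDk ⟨x, hx⟩⟩
  · have h₁ := hF'k (g ⟨x, hx⟩)
    rw [hDk] at h₁
    have h₂ : ∀ y, ((g y : R) : C) = e y := DFunLike.congr_fun hge
    exact h₁.trans ((h₂ _).trans (hex _))

/-- Isomorphisms between models in `K_μ` extend to automorphisms of the monster model. -/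
theorem Monster.exists_aut (hLS : K.LS ≤ μ) (hC : K.Monster μ C) {M : Type w} [L.Structure M]
    {e e' : M ↪[L] C} (he : K.Strong e) (he' : K.Strong e') (hM : #M = μ) :
    ∃ σ : C ≃[L] C, ∀ x, σ (e x) = e' x := by
  classical
  have hμ := (ls_spec hLS).1
  have : Nonempty C := (nonempty_of_card hμ hM).map e
  -- Back and forth along an enumeration of `C` in length μ⁺: at every proper stage at most `μ`
  -- steps have been taken, so the partial domain stays of size `μ`.
  obtain ⟨c, hc⟩ := exists_enum (X := C) (c := succ μ) (Cardinal.lift_le.2 hC.card)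
  let D₀ : L.Substructure C := e.toHom.range
  have hD₀ : K.Mod μ D₀ := Mod.range he hM
  obtain ⟨F₀, hF₀, hF₀e⟩ : ∃ F₀ : C → C, K.StrongOn F₀ D₀ ∧ ∀ x, F₀ (e x) = e' x := by
    let E : D₀ ↪[L] C := e'.comp e.equivRange.symm.toEmbedding
    let F : C → C := fun x => if hx : x ∈ D₀ then E ⟨x, hx⟩ else x
    have hF : ∀ x : D₀, E x = F x := fun x => by
      have : F x = E ⟨x, x.2⟩ := dif_pos x.2
      rw [this]
    refine ⟨F, ⟨E, K.strong_comp
      (K.strong_equiv _ (mem_equiv e.equivRange (K.mem_dom he))) he', hF⟩, fun x => ?_⟩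
    rw [← Embedding.equivRange_apply e x, ← hF]
    simp [E]
  have : Nonempty (L.Substructure C × (C → C)) := ⟨(D₀, F₀)⟩
  obtain ⟨f, hf⟩ := exists_transfinite (X := L.Substructure C × (C → C))
    (fun j f Z => K.Mod μ Z.1 ∧ K.StrongOn Z.2 Z.1 ∧ D₀ ≤ Z.1 ∧ (∀ x ∈ D₀, Z.2 x = F₀ x) ∧
      (∀ i < j, (f i).1 ≤ Z.1 ∧ ∀ x ∈ (f i).1, Z.2 x = (f i).2 x) ∧ c j ∈ Z.1 ∧
      ∃ y ∈ Z.1, Z.2 y = c j) (by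
    rintro j f g Z hfg ⟨h₁, h₂, h₃, h₄, h₅, h₆⟩
    exact ⟨h₁, h₂, h₃, h₄, fun i hi => hfg i hi ▸ h₅ i hi, h₆⟩) (succ μ).ord (by
    intro j hj f hf
    have hjc : j.card ≤ μ := lt_succ_iff.1 (Cardinal.lt_ord.1 hj)
    have hmono : ∀ i k, i < k → k < j → (f i).1 ≤ (f k).1 := fun i k hik hk =>
      ((hf k hk).2.2.2.2.1 i hik).1
    obtain ⟨G, hG₀, hG, hGs⟩ := exists_glue_base (j := j) hF₀ (S := fun i => (f i).1)
      (F := fun i => (f i).2) (fun i hi => (hf i hi).2.2.1) (fun i hi => (hf i hi).2.2.2.1)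
      hmono (fun i hi => (hf i hi).2.1) fun i k hik hk => ((hf k hk).2.2.2.2.1 i hik).2
    obtain ⟨D₁, hD₁, hmem⟩ := exists_chain_union hμ hjc hD₀ (R := fun i => (f i).1)
      (fun i hi => (hf i hi).1) (fun i hi => (hf i hi).2.2.1) (fun i k hik hk => hik.eq_or_lt.elim
      (fun h => h ▸ le_rfl) fun h => hmono i k h hk)
    obtain ⟨D₂, F₂, hD₂, hF₂, hD₁₂, hF₁₂, hcD⟩ :=
      Monster.exists_forth hLS hC hD₁ (hGs D₁ hmem) (c j)
    obtain ⟨D₃, F₃, hD₃, hF₃, hD₂₃, hF₂₃, y, hy, hyc⟩ := Monster.exists_back hLS hC hD₂ hF₂ (c j)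
    have hle : D₁ ≤ D₃ := hD₁₂.trans hD₂₃
    have hFF : ∀ x ∈ D₁, F₃ x = G x := fun x hx => by rw [hF₂₃ x (hD₁₂ hx), hF₁₂ x hx]
    have h₀ : ∀ x ∈ D₀, x ∈ D₁ := fun x hx => (hmem x).2 (Or.inl hx)
    have h₁ : ∀ i < j, ∀ x ∈ (f i).1, x ∈ D₁ := fun i hi x hx => (hmem x).2 (Or.inr ⟨i, hi, hx⟩)
    exact ⟨(D₃, F₃), hD₃, hF₃, fun x hx => hle (h₀ x hx), fun x hx =>
      (hFF x (h₀ x hx)).trans (hG₀ x hx), fun i hi => ⟨fun x hx => hle (h₁ i hi x hx), fun x hx =>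
      (hFF x (h₁ i hi x hx)).trans (hG i hi x hx)⟩, hD₂₃ hcD, y, hy, hyc⟩)
  have hmono : ∀ i k, i < k → k < (succ μ).ord → (f i).1 ≤ (f k).1 := fun i k hik hk =>
      ((hf k hk).2.2.2.2.1 i hik).1
  obtain ⟨G, hG₀, hG, hGs⟩ := exists_glue_base (j := (succ μ).ord) hF₀ (S := fun i => (f i).1)
    (F := fun i => (f i).2) (fun i hi => (hf i hi).2.2.1) (fun i hi => (hf i hi).2.2.2.1)
    hmono (fun i hi => (hf i hi).2.1) fun i k hik hk => ((hf k hk).2.2.2.2.1 i hik).2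
  obtain ⟨g, -, hg⟩ := hGs ⊤ fun x => by
    obtain ⟨i, hi, rfl⟩ := hc x
    simp only [Substructure.mem_top, true_iff]
    exact Or.inr ⟨i, hi, (hf i hi).2.2.2.2.2.1⟩
  let σ₀ : C ↪[L] C := g.comp Substructure.topEquiv.symm.toEmbedding
  have hσ₀ : ∀ x, σ₀ x = G x := fun x => hg ⟨x, trivial⟩
  have hsurj : Function.Surjective σ₀ := fun y => by
    obtain ⟨i, hi, rfl⟩ := hc y
    obtain ⟨-, -, -, -, -, -, x, hx, hxy⟩ := hf i hi
    exact ⟨x, by rw [hσ₀, hG i hi x hx, hxy]⟩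
  let σ : C ≃[L] C := ⟨_root_.Equiv.ofBijective σ₀ ⟨σ₀.injective, hsurj⟩, σ₀.map_fun',
    σ₀.map_rel'⟩
  refine ⟨σ, fun x => ?_⟩
  have : σ (e x) = G (e x) := hσ₀ _
  rw [this, hG₀ _ (by simp [D₀]), hF₀e]

theorem Monster.exists_aut_of_strongOn (hLS : K.LS ≤ μ) (hC : K.Monster μ C)
    {D : L.Substructure C} {F : C → C} (hD : K.Mod μ D) (hF : K.StrongOn F D) :
    ∃ σ : C ≃[L] C, ∀ x ∈ D, σ x = F x := by
  obtain ⟨e, he, hex⟩ := hF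
  obtain ⟨σ, hσ⟩ := Monster.exists_aut hLS hC hD.1 he hD.2
  exact ⟨σ, fun x hx => (hσ ⟨x, hx⟩).trans (hex _)⟩

/-! ### Galois types in the monster model -/

/-- The element `b` of `C` realizes the type `p` over `M`, embedded in `C` through `e`. -/
def IsGt {M : Type w} [L.Structure M] (e : M ↪[L] C) (b : C) (p : GaType K μ M) : Prop :=
  ∃ q : PreType K μ M, Quot.mk _ q = p ∧ ∃ k : q.N ↪[L] C, K.Strong k ∧ k.comp q.emb = e ∧ k q.a = b

theorem isGt_tp {M N : Type w} [L.Structure M] [L.Structure N] {f : M ↪[L] N} (hf : K.Strong f)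
    (hN : #N = μ) (a : N) {k : N ↪[L] C} (hk : K.Strong k) :
    IsGt (k.comp f) (k a) (tp f hf hN a) :=
  ⟨_, rfl, k, hk, rfl, rfl⟩

theorem IsGt.pull {M M' : Type w} [L.Structure M] [L.Structure M'] {e : M ↪[L] C} {b : C}
    {p : GaType K μ M} (h : IsGt e b p) {j : M' ↪[L] M} (hj : K.Strong j) :
    IsGt (e.comp j) b (p.pull j hj) := by
  obtain ⟨q, rfl, k, hk, rfl, rfl⟩ := h
  exact ⟨q.pull j hj, rfl, k, hk, rfl, rfl⟩

theorem exists_isGt (hLS : K.LS ≤ μ) {M : Type w} [L.Structure M] {e : M ↪[L] C}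
    (he : K.Strong e) (hM : #M = μ) (b : C) : ∃ p : GaType K μ M, IsGt e b p := by
  obtain ⟨S, hS, hle, hb⟩ := Monster.exists_mod_insert hLS (Mod.range he hM) b
  obtain ⟨f, hf, rfl⟩ := exists_factor hS.1 he fun m => ⟨⟨e m, hle (by simp)⟩, rfl⟩
  exact ⟨_, isGt_tp hf hS.2 ⟨b, hb⟩ hS.1⟩

/-- An amalgam witnessing equality of types embeds into `C`, and homogeneity turns it into an
automorphism. Conversely, a submodel of size `μ` containing both copies is such an amalgam. -/
theorem IsGt.eq_iff (hLS : K.LS ≤ μ) (hAP : K.Amalgamation μ) (hC : K.Monster μ C) {M : Type w}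
    [L.Structure M] {e e' : M ↪[L] C} {b b' : C} {p p' : GaType K μ M} (h : IsGt e b p)
    (h' : IsGt e' b' p') :
    p = p' ↔ ∃ σ : C ≃[L] C, (∀ x, σ (e x) = e' x) ∧ σ b = b' := by
  obtain ⟨q, rfl, k, hk, rfl, rfl⟩ := h
  obtain ⟨q', rfl, k', hk', rfl, rfl⟩ := h'
  refine (PreType.mk_eq_iff hAP).trans ⟨?_, ?_⟩
  · rintro ⟨N, _, g₁, g₂, hN, hg₁, hg₂, hg, ha⟩
    obtain ⟨h, hh, hhg⟩ := hC.exists_extension q.N N k g₁ q.card hN hk hg₁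
    obtain ⟨σ, hσ⟩ := Monster.exists_aut hLS hC (K.strong_comp hg₂ hh) hk' q'.card
    have h₁ : ∀ x, h (g₁ x) = k x := DFunLike.congr_fun hhg
    have h₂ : ∀ x, σ (h (g₂ x)) = k' x := hσ
    have h₃ : ∀ x, g₁ (q.emb x) = g₂ (q'.emb x) := DFunLike.congr_fun hg
    refine ⟨σ, fun x => ?_, ?_⟩
    · simp only [Embedding.comp_apply]
      rw [← h₁, h₃, h₂]
    · rw [← h₁, ha, h₂]
  · rintro ⟨σ, hσ, hb⟩
    let k₁ : q.N ↪[L] C := σ.toEmbedding.comp k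
    have hk₁ : K.Strong k₁ := K.strong_comp hk (K.strong_equiv σ hC.mem)
    have hr := Mod.range hk' q'.card
    obtain ⟨S, hS, hsub, hle⟩ := exists_mod hLS hr k₁.toHom.range (Mod.range hk₁ q.card).2.le
    obtain ⟨f₁, hf₁, hf₁'⟩ := exists_factor hS.1 hk₁ fun m => ⟨⟨k₁ m, hsub (by simp)⟩, rfl⟩
    obtain ⟨f₂, hf₂, hf₂'⟩ := exists_factor hS.1 hk' fun m => ⟨⟨k' m, hle (by simp)⟩, rfl⟩
    have h₁ : ∀ x, (f₁ x : C) = σ (k x) := DFunLike.congr_fun hf₁'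
    have h₂ : ∀ x, (f₂ x : C) = k' x := DFunLike.congr_fun hf₂'
    refine ⟨S, _, f₁, f₂, hS.2, hf₁, hf₂, ?_, ?_⟩
    · ext x
      simp only [Embedding.comp_apply]
      rw [h₁, h₂]
      exact hσ x
    · exact Subtype.ext (by rw [h₁, h₂, hb])

/-- Algebraicity asks for one representative only; conjugacy transfers it to any realization. -/
theorem IsGt.algebraic_iff (hLS : K.LS ≤ μ) (hAP : K.Amalgamation μ) (hC : K.Monster μ C)
    {M : Type w} [L.Structure M] {e : M ↪[L] C} (he : K.Strong e) (hM : #M = μ) {b : C}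
    {p : GaType K μ M} (h : IsGt e b p) : p.Algebraic ↔ b ∈ e.toHom.range := by
  rw [mem_range']
  constructor
  · rintro ⟨q, hq, x, hx⟩
    obtain ⟨k, hk, hke⟩ := hC.exists_extension M q.N e q.emb hM q.card he q.strong
    obtain ⟨σ, hσ, hb⟩ := (IsGt.eq_iff hLS hAP hC ⟨q, hq, k, hk, hke, rfl⟩ h).1 rfl
    have h₁ : k (q.emb x) = e x := DFunLike.congr_fun hke x
    exact ⟨x, by rw [← hb, ← hx, h₁, hσ]⟩
  · rintro ⟨x, hx⟩
    obtain ⟨q, rfl, k, hk, rfl, rfl⟩ := h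
    exact ⟨q, rfl, x, k.injective hx⟩

/-! ### Nonsplitting in the monster model -/

variable (K μ) in
/-- The type of `b` over `M` does not `μ`-split over `N`. -/
def NS (N M : L.Substructure C) (b : C) : Prop :=
  ∀ P, K.Mod μ P → N ≤ P → P ≤ M → ∀ σ : C ≃[L] C, (∀ x ∈ P, σ x ∈ M) → (∀ x ∈ N, σ x = x) →
    ∃ ρ : C ≃[L] C, (∀ x ∈ P, ρ x = σ x) ∧ ρ b = b

/-- The isomorphism `h : N₁ ≅ N₂` corresponds to an automorphism `σ` restricted to `P`, the image of
`N₁`. By `IsGt.eq_iff`, equality of the two types says that `σ` on `P` extends to an automorphism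
fixing `b`. -/
theorem not_splits_iff (hLS : K.LS ≤ μ) (hAP : K.Amalgamation μ) (hC : K.Monster μ C)
    {N M : Type w} [L.Structure N] [L.Structure M] {j : N ↪[L] M} {e : M ↪[L] C}
    (he : K.Strong e) {b : C} {p : GaType K μ M} (h : IsGt e b p) :
    ¬ Splits j p ↔ K.NS μ (e.comp j).toHom.range e.toHom.range b := by
  rw [not_iff_comm]
  constructor
  · intro hns
    simp only [NS, not_forall] at hns
    obtain ⟨P, hP, hNP, hPM, σ, hσ, hσN, hρ⟩ := hns
    have hN₁ := Mod.comap he hP hPM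
    have hi : K.Strong (σ.toEmbedding.comp (e.comp (P.comap e.toHom).subtype)) :=
      K.strong_comp (K.strong_comp hN₁.1 he) (K.strong_equiv σ hC.mem)
    obtain ⟨f, hf, hfe⟩ := exists_factor he hi fun m => (mem_range' e _).1 (hσ _ m.2)
    have hfe' : ∀ x, e (f x) = σ (e x) := DFunLike.congr_fun hfe
    have hr := Mod.range hf hN₁.2
    refine ⟨P.comap e.toHom, f.toHom.range, hN₁.1, hr.1, f.equivRange, hN₁.2, hr.2, fun x => ?_,
      fun heq => hρ ?_⟩
    · have hx : e (j x) ∈ (e.comp j).toHom.range := (mem_range' _ _).2 ⟨x, rfl⟩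
      refine ⟨hNP hx, e.injective ?_⟩
      rw [Embedding.equivRange_apply, hfe', hσN _ hx]
    · have h₁ := (h.pull hN₁.1).pull
        (K.strong_equiv f.equivRange.symm (mem_equiv f.equivRange (K.mem_dom hf)))
      have h₂ := h.pull hr.1
      obtain ⟨ρ, hρ₁, hρ₂⟩ := (IsGt.eq_iff hLS hAP hC h₁ h₂).1 heq
      refine ⟨ρ, fun x hx => ?_, hρ₂⟩
      obtain ⟨x, rfl⟩ := (mem_range' _ _).1 (hPM hx)
      have := hρ₁ (f.equivRange ⟨x, hx⟩)
      simp only [Embedding.comp_apply, FirstOrder.Language.Equiv.coe_toEmbedding,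
        FirstOrder.Language.Equiv.symm_apply_apply, Substructure.subtype_apply,
        Embedding.equivRange_apply] at this
      rw [this, hfe']
  · rintro ⟨N₁, N₂, h₁, h₂, f, hc₁, hc₂, hf, hne⟩ hns
    have hs₁ := K.strong_comp h₁ he
    have hs₂ := K.strong_comp (K.strong_comp (K.strong_equiv f (K.mem_dom h₁)) h₂) he
    obtain ⟨σ, hσ⟩ := Monster.exists_aut hLS hC hs₁ hs₂ hc₁
    have hσ' : ∀ x : N₁, σ (e x) = e (f x) := hσ
    obtain ⟨ρ, hρ, hρb⟩ := hns _ (Mod.range hs₁ hc₁) (fun y hy => by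
        obtain ⟨x, rfl⟩ := (mem_range' _ _).1 hy
        exact (mem_range' _ _).2 ⟨⟨j x, (hf x).1⟩, rfl⟩) (fun y hy => by
        obtain ⟨x, rfl⟩ := (mem_range' _ _).1 hy
        exact (mem_range' _ _).2 ⟨x, rfl⟩) σ (fun y hy => by
        obtain ⟨x, rfl⟩ := (mem_range' _ _).1 hy
        exact (mem_range' _ _).2 ⟨_, (hσ' x).symm⟩) (fun y hy => by
        obtain ⟨x, rfl⟩ := (mem_range' _ _).1 hy
        obtain ⟨hx, hfx⟩ := hf x
        refine (hσ' ⟨j x, hx⟩).trans ?_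
        rw [hfx]; rfl)
    refine hne ((IsGt.eq_iff hLS hAP hC ((h.pull h₁).pull
      (K.strong_equiv f.symm (K.mem_dom h₂))) (h.pull h₂)).2 ⟨ρ, fun x => ?_, hρb⟩)
    obtain ⟨y, rfl⟩ := f.surjective x
    simp only [Embedding.comp_apply, FirstOrder.Language.Equiv.coe_toEmbedding,
        FirstOrder.Language.Equiv.symm_apply_apply, Substructure.subtype_apply]
    rw [← hσ']
    exact hρ _ ((mem_range' _ _).2 ⟨y, rfl⟩)

/-! ### Universal extensions in the monster model -/

variable (K μ) in
/-- `M` is universal over `N`. -/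
structure UnivIn (N M : L.Substructure C) : Prop where
  mod_left : K.Mod μ N
  mod_right : K.Mod μ M
  le : N ≤ M
  exists_aut : ∀ P, K.Mod μ P → N ≤ P → ∃ σ : C ≃[L] C, (∀ x ∈ N, σ x = x) ∧ ∀ x ∈ P, σ x ∈ M

/-- Abstract extensions of `N` may be taken inside `C` by homogeneity, and embeddings between
submodels of size `μ` extend to automorphisms. -/
theorem universalOver_iff (hLS : K.LS ≤ μ) (hC : K.Monster μ C) {N M : Type w} [L.Structure N]
    [L.Structure M] {f : N ↪[L] M} {k : M ↪[L] C} (hk : K.Strong k) :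
    K.UniversalOver μ f ↔ K.UnivIn μ (k.comp f).toHom.range k.toHom.range := by
  constructor
  · rintro ⟨hf, hN, hM, hu⟩
    refine ⟨Mod.range (K.strong_comp hf hk) hN, Mod.range hk hM, fun y hy => ?_,
      fun P hP hNP => ?_⟩
    · obtain ⟨x, rfl⟩ := (mem_range' _ _).1 hy
      exact (mem_range' _ _).2 ⟨_, rfl⟩
    · obtain ⟨g, hg, hgf⟩ := exists_factor hP.1 (K.strong_comp hf hk)
        fun m => ⟨⟨k (f m), hNP ((mem_range' _ _).2 ⟨m, rfl⟩)⟩, rfl⟩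
      obtain ⟨h, hh, hhg⟩ := hu P g hP.2 hg
      obtain ⟨σ, hσ⟩ := Monster.exists_aut hLS hC hP.1 (K.strong_comp hh hk) hP.2
      refine ⟨σ, fun y hy => ?_, fun y hy => ?_⟩
      · obtain ⟨x, rfl⟩ := (mem_range' _ _).1 hy
        have h₁ : (g x : C) = k (f x) := DFunLike.congr_fun hgf x
        have h₂ : h (g x) = f x := DFunLike.congr_fun hhg x
        have h₃ : σ (g x) = k (h (g x)) := hσ (g x)
        rw [h₁, h₂] at h₃
        exact h₃
      · rw [show y = P.subtype ⟨y, hy⟩ from rfl, hσ]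
        exact (mem_range' _ _).2 ⟨_, rfl⟩
  · rintro ⟨h₁, h₂, -, hu⟩
    have hkf := (strong_range_iff _).1 h₁.1
    have hN : #N = μ := by
      rw [← h₁.2]; exact Cardinal.mk_congr (k.comp f).equivRange.toEquiv
    have hM : #M = μ := by
      rw [← h₂.2]; exact Cardinal.mk_congr k.equivRange.toEquiv
    refine ⟨K.coherence hk hkf, hN, hM, fun Q _ g hQ hg => ?_⟩
    obtain ⟨h, hh, hhg⟩ := hC.exists_extension N Q (k.comp f) g hN hQ hkf hg
    have hhg' : ∀ x, h (g x) = k (f x) := DFunLike.congr_fun hhg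
    obtain ⟨σ, hσN, hσ⟩ := hu _ (Mod.range hh hQ) fun y hy => by
      obtain ⟨x, rfl⟩ := (mem_range' _ _).1 hy
      exact (mem_range' _ _).2 ⟨_, hhg' x⟩
    obtain ⟨r, hr, hrk⟩ := exists_factor hk (K.strong_comp hh (K.strong_equiv σ hC.mem))
      fun m => (mem_range' _ _).1 (hσ (h m) ((mem_range' _ _).2 ⟨m, rfl⟩))
    refine ⟨r, hr, ?_⟩
    ext x
    have h₁ : k (r (g x)) = σ (h (g x)) := DFunLike.congr_fun hrk (g x)
    refine k.injective ?_
    rw [Embedding.comp_apply, h₁, hhg']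
    exact hσN _ ((mem_range' _ _).2 ⟨x, rfl⟩)

theorem exists_universalOver (hμ : ℵ₀ ≤ μ) (hAP : K.Amalgamation μ) (hSt : K.Stable μ)
    {N : Type w} [L.Structure N] (hN : K.InCard μ N) :
    ∃ (M : Type w) (_ : L.Structure M) (f : N ↪[L] M), K.UniversalOver μ f := by
  let U : Type w := (succ μ).out
  have hU : μ < #U := by rw [Cardinal.mk_out]; exact lt_succ μ
  obtain ⟨B, ⟨ψ⟩⟩ := Obj.exists_copy' (U := U) hU hN
  have hψ := K.strong_equiv ψ hN.1
  have hψ' := K.strong_equiv ψ.symm (K.mem_cod hψ)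
  have hB : K.InCard μ B.D := ⟨K.mem_cod hψ, (Cardinal.mk_congr ψ.toEquiv).symm.trans hN.2⟩
  obtain ⟨Y, hY, e, he, -⟩ := Obj.exists_universal hμ hU hAP hSt hB
  refine ⟨Y.D, _, e.comp ψ.toEmbedding, K.strong_comp hψ he.1, hN.2, hY.2,
    fun M' _ g hM' hg => ?_⟩
  obtain ⟨h, hh, hhe⟩ := he.2.2.2 M' (g.comp ψ.symm.toEmbedding) hM' (K.strong_comp hψ' hg)
  refine ⟨h, hh, ?_⟩
  ext x
  have := DFunLike.congr_fun hhe (ψ x)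
  simp only [Embedding.comp_apply, FirstOrder.Language.Equiv.coe_toEmbedding,
    FirstOrder.Language.Equiv.symm_apply_apply] at this ⊢
  rw [this]

theorem exists_univIn (hLS : K.LS ≤ μ) (hAP : K.Amalgamation μ) (hSt : K.Stable μ)
    (hC : K.Monster μ C) {N : L.Substructure C} (hN : K.Mod μ N) : ∃ M, K.UnivIn μ N M := by
  obtain ⟨M, _, f, hf⟩ := exists_universalOver (ls_spec hLS).1 hAP hSt ⟨K.mem_dom hN.1, hN.2⟩
  obtain ⟨k, hk, hkf⟩ := hC.exists_extension N M N.subtype f hN.2 hf.2.2.1 hN.1 hf.1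
  have h := (universalOver_iff hLS hC hk).1 hf
  rw [hkf, Substructure.range_subtype] at h
  exact ⟨_, h⟩

/-- Amalgamate `N` and `P` over `N'`, place the amalgam in `C` over `N`, and use universality over
`N`. Here `τ` moves `P` into the amalgam over `N'`. -/
theorem UnivIn.mono_left {N N' M : L.Substructure C} (h : K.UnivIn μ N M) (hN' : K.Mod μ N')
    (hle : N' ≤ N) (hLS : K.LS ≤ μ) (hAP : K.Amalgamation μ) (hC : K.Monster μ C) :
    K.UnivIn μ N' M := by
  refine ⟨hN', h.mod_right, hle.trans h.le, fun P hP hNP => ?_⟩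
  have hi₁ := K.strong_inclusion hle hN'.1 h.mod_left.1
  have hi₂ := K.strong_inclusion hNP hN'.1 hP.1
  obtain ⟨Q, _, f₁, f₂, hQ, hf₁, hf₂, hf⟩ := hAP N' N P _ _ hN'.2 h.mod_left.2 hP.2 hi₁ hi₂
  obtain ⟨k, hk, hkf⟩ := hC.exists_extension N Q N.subtype f₁ h.mod_left.2 hQ h.mod_left.1 hf₁
  have hkf' : ∀ x : N, k (f₁ x) = x := DFunLike.congr_fun hkf
  obtain ⟨τ, hτ⟩ := Monster.exists_aut hLS hC hP.1 (K.strong_comp hf₂ hk) hP.2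
  have hτ' : ∀ x : P, τ x = k (f₂ x) := hτ
  obtain ⟨σ, hσN, hσ⟩ := h.exists_aut _ (Mod.range hk hQ) fun x hx =>
    (mem_range' _ _).2 ⟨f₁ ⟨x, hx⟩, hkf' _⟩
  refine ⟨σ.comp τ, fun x hx => ?_, fun x hx => ?_⟩
  · have h₁ : f₁ ⟨x, hle hx⟩ = f₂ ⟨x, hNP hx⟩ := DFunLike.congr_fun hf ⟨x, hx⟩
    have h₂ : τ x = x := by
      have := hτ' ⟨x, hNP hx⟩
      rw [← h₁, hkf'] at this
      exact this
    rw [FirstOrder.Language.Equiv.comp_apply, h₂, hσN x (hle hx)]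
  · rw [FirstOrder.Language.Equiv.comp_apply]
    refine hσ _ ((mem_range' _ _).2 ⟨f₂ ⟨x, hx⟩, (hτ' ⟨x, hx⟩).symm⟩)

theorem UnivIn.mono_right {N M M' : L.Substructure C} (h : K.UnivIn μ N M) (hM' : K.Mod μ M')
    (hle : M ≤ M') : K.UnivIn μ N M' :=
  ⟨h.mod_left, hM', h.le.trans hle, fun P hP hNP => by
    obtain ⟨σ, h₁, h₂⟩ := h.exists_aut P hP hNP
    exact ⟨σ, h₁, fun x hx => hle (h₂ x hx)⟩⟩

/-! ### Images under automorphisms -/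

/-- The image of a substructure under an automorphism. -/
def img (σ : C ≃[L] C) (S : L.Substructure C) : L.Substructure C := S.map σ.toHom

@[simp]
theorem mem_img {σ : C ≃[L] C} {S : L.Substructure C} {x : C} : x ∈ img σ S ↔ σ.symm x ∈ S := by
  rw [img, Substructure.mem_map]
  constructor
  · rintro ⟨y, hy, rfl⟩
    simpa using hy
  · exact fun h => ⟨_, h, by simp⟩

theorem apply_mem_img {σ : C ≃[L] C} {S : L.Substructure C} {x : C} : σ x ∈ img σ S ↔ x ∈ S := by
  simp

theorem Mod.img {S : L.Substructure C} (hS : K.Mod μ S) (σ : C ≃[L] C) :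
    K.Mod μ (AEC.img σ S) :=
  Mod.map (K.strong_equiv σ hS.mem) hS

theorem img_symm_img (σ : C ≃[L] C) (S : L.Substructure C) : img σ.symm (img σ S) = S := by
  ext x; simp

theorem img_img_symm (σ : C ≃[L] C) (S : L.Substructure C) : img σ (img σ.symm S) = S := by
  ext x; simp

theorem img_le_img {σ : C ≃[L] C} {S T : L.Substructure C} : img σ S ≤ img σ T ↔ S ≤ T := by
  constructor
  · exact fun h x hx => apply_mem_img.1 (h (apply_mem_img.2 hx))
  · exact fun h x hx => mem_img.2 (h (mem_img.1 hx))

theorem img_congr {σ τ : C ≃[L] C} {S : L.Substructure C} (h : ∀ x ∈ S, σ x = τ x) :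
    img σ S = img τ S := by
  ext y
  simp only [img, Substructure.mem_map]
  constructor
  · rintro ⟨x, hx, rfl⟩
    exact ⟨x, hx, (h x hx).symm⟩
  · rintro ⟨x, hx, rfl⟩
    exact ⟨x, hx, h x hx⟩

theorem UnivIn.img {N M : L.Substructure C} (h : K.UnivIn μ N M) (σ : C ≃[L] C) :
    K.UnivIn μ (AEC.img σ N) (AEC.img σ M) := by
  refine ⟨h.mod_left.img σ, h.mod_right.img σ, img_le_img.2 h.le, fun P hP hNP => ?_⟩
  obtain ⟨τ, h₁, h₂⟩ := h.exists_aut (AEC.img σ.symm P) (hP.img _) (by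
    rw [← img_le_img (σ := σ), img_img_symm]; exact hNP)
  refine ⟨(σ.comp τ).comp σ.symm, fun x hx => ?_, fun x hx => ?_⟩
  · simp only [FirstOrder.Language.Equiv.comp_apply]
    rw [h₁ _ (mem_img.1 hx)]; simp
  · simp only [FirstOrder.Language.Equiv.comp_apply]
    exact apply_mem_img.2 (h₂ _ (mem_img.2 (by simpa using hx)))

theorem NS.mono {N N' M M' : L.Substructure C} {b : C} (h : K.NS μ N M b) (hN : N ≤ N')
    (hM : M' ≤ M) : K.NS μ N' M' b :=
  fun P hP hNP hPM σ hσ hσN => h P hP (hN.trans hNP) (hPM.trans hM) σ (fun x hx => hM (hσ x hx))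
    fun x hx => hσN x (hN hx)

theorem NS.img {N M : L.Substructure C} {b : C} (h : K.NS μ N M b) (τ : C ≃[L] C) :
    K.NS μ (AEC.img τ N) (AEC.img τ M) (τ b) := by
  intro P hP hNP hPM σ hσ hσN
  obtain ⟨ρ, h₁, h₂⟩ := h (AEC.img τ.symm P) (hP.img _)
    (by rw [← img_le_img (σ := τ), img_img_symm]; exact hNP)
    (by rw [← img_le_img (σ := τ), img_img_symm]; exact hPM)
    ((τ.symm.comp σ).comp τ) (fun x hx => by
      have := hσ (τ x) (by simpa using hx)
      simpa using this) (fun x hx => by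
      simp [hσN (τ x) (apply_mem_img.2 hx)])
  refine ⟨(τ.comp ρ).comp τ.symm, fun x hx => ?_, by simp [h₂]⟩
  simp only [FirstOrder.Language.Equiv.comp_apply]
  rw [h₁ _ (mem_img.2 (by simpa using hx))]
  simp

/-! ### Uniqueness and existence of nonsplitting extensions -/

/-- Uniqueness of nonsplitting extensions. -/
theorem NS.unique {N M M' : L.Substructure C} {a b : C} (hU : K.UnivIn μ N M) (hM' : K.Mod μ M')
    (hle : M ≤ M') (ha : K.NS μ N M' a) (hb : K.NS μ N M' b)
    (hab : ∃ τ : C ≃[L] C, (∀ x ∈ M, τ x = x) ∧ τ a = b) :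
    ∃ τ : C ≃[L] C, (∀ x ∈ M', τ x = x) ∧ τ a = b := by
  obtain ⟨σ, hσN, hσ⟩ := hU.exists_aut M' hM' (hU.le.trans hle)
  have hσ' : ∀ x ∈ M', σ x ∈ M' := fun x hx => hle (hσ x hx)
  obtain ⟨ρ, hρ, hρa⟩ := ha M' hM' (hU.le.trans hle) le_rfl σ hσ' hσN
  obtain ⟨ρ', hρ', hρb⟩ := hb M' hM' (hU.le.trans hle) le_rfl σ hσ' hσN
  obtain ⟨τ, hτ, hτa⟩ := hab
  -- `ρ` and `ρ'` both agree with `σ` on `M'` and send it into `M`, where `τ` is the identity. They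
  -- fix `a` and `b` respectively, so the composite fixes `M'` and sends `a` to `b`.
  refine ⟨(ρ'.symm.comp τ).comp ρ, fun x hx => ρ'.injective ?_, ρ'.injective ?_⟩
  · simp [hρ x hx, hρ' x hx, hτ _ (hσ x hx)]
  · simp [hρa, hτa, hρb]

/-- Existence of nonsplitting extensions. -/
theorem NS.exists_extension {N M M' : L.Substructure C} {a : C} (hU : K.UnivIn μ N M)
    (hM' : K.Mod μ M') (hle : M ≤ M') (ha : K.NS μ N M a) (haM : a ∉ M) :
    ∃ τ : C ≃[L] C, (∀ x ∈ M, τ x = x) ∧ K.NS μ N M' (τ a) ∧ τ a ∉ M' := by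
  obtain ⟨σ, hσN, hσ⟩ := hU.exists_aut M' hM' (hU.le.trans hle)
  obtain ⟨ρ, hρ, hρa⟩ := ha M hU.mod_right hU.le le_rfl σ (fun x hx => hσ x (hle hx)) hσN
  have hN : AEC.img σ.symm N = N := by
    ext x
    rw [mem_img]
    constructor
    · intro h
      have h₁ : σ x ∈ N := h
      have : σ x = x := σ.injective (hσN _ h₁)
      rwa [this] at h₁
    · intro h
      change σ x ∈ N
      rwa [hσN x h]
  -- The realization is σ⁻¹(a): its type over σ⁻¹(M), which contains `M'`, does not split over
  -- σ⁻¹(N) = N. Since `ρ` agrees with `σ` on `M` and fixes `a`, the composite fixes `M` and sends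
  -- `a` there.
  refine ⟨σ.symm.comp ρ, fun x hx => ?_, ?_, ?_⟩
  · simp [hρ x hx]
  · have := ha.img σ.symm
    rw [hN] at this
    rw [FirstOrder.Language.Equiv.comp_apply, hρa]
    exact this.mono le_rfl fun x hx => mem_img.2 (hσ x hx)
  · rw [FirstOrder.Language.Equiv.comp_apply, hρa]
    intro h
    have := hσ _ h
    simp only [FirstOrder.Language.Equiv.apply_symm_apply] at this
    exact haM this

end

section

variable {L : FirstOrder.Language.{u, v}} {K : AEC.{u, v, w} L} {μ : Cardinal.{w}}
variable {C : Type w} [L.Structure C]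

/-! ### Chains and limit models in the monster model -/

variable (K μ) in
/-- `⟨S i ∣ i < θ⟩` is an increasing continuous chain with universal successor steps. -/
structure CW (θ : Ordinal.{w}) (S : Ordinal.{w} → L.Substructure C) : Prop where
  lim : IsSuccLimit θ
  lt : θ < (succ μ).ord
  univ : ∀ i < θ, K.UnivIn μ (S i) (S (i + 1))
  mono : ∀ i j, i ≤ j → j < θ → S i ≤ S j
  cont : ∀ i < θ, IsSuccLimit i → ∀ x ∈ S i, ∃ j < i, x ∈ S j

theorem CW.mod {θ : Ordinal.{w}} {S : Ordinal.{w} → L.Substructure C} (h : K.CW μ θ S) {i}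
    (hi : i < θ) : K.Mod μ (S i) :=
  (h.univ i hi).mod_left

theorem card_le_of_lt {θ : Ordinal.{w}} (h : θ < (succ μ).ord) : θ.card ≤ μ :=
  lt_succ_iff.1 (Cardinal.lt_ord.1 h)

theorem add_one_lt_of_lim {θ i : Ordinal.{w}} (h : IsSuccLimit θ) (hi : i < θ) : i + 1 < θ :=
  h.succ_lt hi

theorem CW.exists_union (hμ : ℵ₀ ≤ μ) {θ : Ordinal.{w}} {S : Ordinal.{w} → L.Substructure C}
    (h : K.CW μ θ S) : ∃ M, K.Mod μ M ∧ ∀ x, x ∈ M ↔ ∃ i < θ, x ∈ S i := by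
  have hpos : 0 < θ := h.lim.bot_lt
  obtain ⟨M, hM, hmem⟩ := exists_chain_union hμ (card_le_of_lt h.lt) (h.mod hpos)
    (fun i hi => h.mod hi) (fun i hi => h.mono 0 i zero_le hi) h.mono
  refine ⟨M, hM, fun x => (hmem x).trans ⟨?_, Or.inr⟩⟩
  exact fun h' => h'.elim (fun hx => ⟨0, hpos, hx⟩) id

/-- A family in which each member is universal over a model containing the previous ones
interpolates a continuous chain. -/
theorem exists_cw (hLS : K.LS ≤ μ) (hAP : K.Amalgamation μ) (hC : K.Monster μ C)
    {θ : Ordinal.{w}} (hθ : IsSuccLimit θ) (hθμ : θ < (succ μ).ord) {B : L.Substructure C}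
    (hB : K.Mod μ B) {R : Ordinal.{w} → L.Substructure C}
    (hR : ∀ k < θ, ∃ Q, K.UnivIn μ Q (R k) ∧ B ≤ Q ∧ ∀ i < k, R i ≤ Q) :
    ∃ S, K.CW μ θ S ∧ S 0 = B ∧ ∀ k < θ, ∀ x, x ∈ S k ↔ x ∈ B ∨ ∃ i < k, x ∈ R i := by
  have hμ := (ls_spec hLS).1
  have hRm : ∀ k < θ, K.Mod μ (R k) := fun k hk => (hR k hk).choose_spec.1.mod_right
  have hBR : ∀ k < θ, B ≤ R k := fun k hk =>
    (hR k hk).choose_spec.2.1.trans (hR k hk).choose_spec.1.le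
  have hRmono : ∀ i k, i ≤ k → k < θ → R i ≤ R k := fun i k hik hk => by
    rcases hik.eq_or_lt with rfl | h
    · exact le_rfl
    · exact ((hR k hk).choose_spec.2.2 i h).trans (hR k hk).choose_spec.1.le
  -- `S k` collects the earlier `R i` only, so `S (i + 1) = R i` and continuity at limits is
  -- automatic, although `R` need not be continuous.
  have hS : ∀ k < θ, ∃ S, K.Mod μ S ∧ ∀ x, x ∈ S ↔ x ∈ B ∨ ∃ i < k, x ∈ R i := fun k hk =>
    exists_chain_union hμ (card_le_of_lt (hk.trans hθμ)) hB (fun i hi => hRm i (hi.trans hk))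
      (fun i hi => hBR i (hi.trans hk)) fun i l hil hl => hRmono i l hil (hl.trans hk)
  choose! S hSm hmem using hS
  refine ⟨S, ⟨hθ, hθμ, fun i hi => ?_, fun i j hij hj x hx => ?_, fun i hi hlim x hx => ?_⟩, ?_,
    hmem⟩
  · have hi1 := add_one_lt_of_lim hθ hi
    have hSR : S (i + 1) = R i := by
      ext x
      rw [hmem _ hi1]
      constructor
      · rintro (h | ⟨l, hl, hx⟩)
        · exact hBR i hi h
        · exact hRmono l i (Order.lt_add_one_iff.1 hl) hi hx
      · exact fun h => Or.inr ⟨i, Order.lt_add_one_iff.2 le_rfl, h⟩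
    obtain ⟨Q, hQ, hBQ, hRQ⟩ := hR i hi
    rw [hSR]
    refine hQ.mono_left (hSm i hi) (fun x hx => ?_) hLS hAP hC
    rcases (hmem i hi x).1 hx with h | ⟨l, hl, h⟩
    · exact hBQ h
    · exact hRQ l hl h
  · rcases (hmem i (hij.trans_lt hj) x).1 hx with h | ⟨l, hl, h⟩
    · exact (hmem j hj x).2 (Or.inl h)
    · exact (hmem j hj x).2 (Or.inr ⟨l, hl.trans_le hij, h⟩)
  · rcases (hmem i hi x).1 hx with h | ⟨l, hl, h⟩
    · have hpos : 0 < i := hlim.bot_lt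
      exact ⟨0, hpos, (hmem 0 (hpos.trans hi) x).2 (Or.inl h)⟩
    · have hl1 := add_one_lt_of_lim hlim hl
      exact ⟨l + 1, hl1, (hmem _ (hl1.trans hi) x).2
        (Or.inr ⟨l, Order.lt_add_one_iff.2 le_rfl, h⟩)⟩
  · ext x
    rw [hmem 0 hθ.bot_lt]
    simp [not_lt_zero]

variable (K μ) in
/-- `M` is a `(μ, θ)`-limit model over `B`. -/
def LimD (θ : Ordinal.{w}) (B M : L.Substructure C) : Prop :=
  ∃ S, K.CW μ θ S ∧ S 0 = B ∧ ∀ x, x ∈ M ↔ ∃ i < θ, x ∈ S i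

theorem LimD.mod (hμ : ℵ₀ ≤ μ) {θ : Ordinal.{w}} {B M : L.Substructure C} (h : K.LimD μ θ B M) :
    K.Mod μ M := by
  obtain ⟨S, hS, -, hmem⟩ := h
  obtain ⟨M', hM', hmem'⟩ := hS.exists_union hμ
  have : M = M' := by
    ext x; rw [hmem, hmem']
  exact this ▸ hM'

theorem LimD.univIn (hμ : ℵ₀ ≤ μ) {θ : Ordinal.{w}} {B M : L.Substructure C}
    (h : K.LimD μ θ B M) : K.UnivIn μ B M := by
  have hM := h.mod hμ
  obtain ⟨S, hS, rfl, hmem⟩ := h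
  have hpos : 0 < θ := hS.lim.bot_lt
  exact (hS.univ 0 hpos).mono_right hM fun x hx =>
    (hmem x).2 ⟨_, add_one_lt_of_lim hS.lim hpos, hx⟩

/-- Only the zeroth member of the witnessing chain is replaced, and the first step remains universal
by `UnivIn.mono_left`. -/
theorem LimD.mono_base (hLS : K.LS ≤ μ) (hAP : K.Amalgamation μ) (hC : K.Monster μ C)
    {θ : Ordinal.{w}} {B B' M : L.Substructure C} (h : K.LimD μ θ B M) (hB' : K.Mod μ B')
    (hle : B' ≤ B) : K.LimD μ θ B' M := by
  classical
  obtain ⟨S, hS, rfl, hmem⟩ := h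
  let S' : Ordinal.{w} → L.Substructure C := fun i => if i = 0 then B' else S i
  have h0 : S' 0 = B' := if_pos rfl
  have h1 : ∀ i, i ≠ 0 → S' i = S i := fun i hi => if_neg hi
  have hle' : ∀ i < θ, S' i ≤ S i := fun i hi => by
    by_cases h : i = 0
    · subst h; rw [h0]; exact hle
    · rw [h1 i h]
  have hsucc : ∀ i : Ordinal.{w}, S' (i + 1) = S (i + 1) := fun i =>
    h1 _ (Order.lt_add_one_iff.2 (zero_le (a := i))).ne'
  refine ⟨S', ⟨hS.lim, hS.lt, fun i hi => ?_, fun i j hij hj => ?_, fun i hi hlim x hx => ?_⟩, h0,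
    fun x => ?_⟩
  · rw [hsucc]
    by_cases h : i = 0
    · subst h
      rw [h0]
      exact (hS.univ 0 hi).mono_left hB' hle hLS hAP hC
    · rw [h1 i h]
      exact hS.univ i hi
  · by_cases h : j = 0
    · subst h
      rw [le_antisymm hij zero_le]
    · rw [h1 j h]
      exact (hle' i (hij.trans_lt hj)).trans (hS.mono i j hij hj)
  · rw [h1 i hlim.bot_lt.ne'] at hx
    obtain ⟨j, hj, hx⟩ := hS.cont i hi hlim x hx
    -- The index is raised by one because `j = 0` is possible and `S' 0` may omit elements of `S 0`.
    refine ⟨j + 1, add_one_lt_of_lim hlim hj, ?_⟩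
    rw [hsucc]
    exact hS.mono j _ le_self_add ((add_one_lt_of_lim hlim hj).trans hi) hx
  · rw [hmem]
    constructor
    · rintro ⟨i, hi, hx⟩
      refine ⟨i + 1, add_one_lt_of_lim hS.lim hi, ?_⟩
      rw [hsucc]
      exact hS.mono i _ le_self_add (add_one_lt_of_lim hS.lim hi) hx
    · rintro ⟨i, hi, hx⟩
      exact ⟨i, hi, hle' i hi hx⟩

theorem LimD.img {θ : Ordinal.{w}} {B M : L.Substructure C} (h : K.LimD μ θ B M) (σ : C ≃[L] C) :
    K.LimD μ θ (AEC.img σ B) (AEC.img σ M) := by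
  obtain ⟨S, hS, rfl, hmem⟩ := h
  refine ⟨fun i => AEC.img σ (S i), ⟨hS.lim, hS.lt, fun i hi => (hS.univ i hi).img σ,
    fun i j hij hj => img_le_img.2 (hS.mono i j hij hj), fun i hi hlim x hx => ?_⟩, rfl,
    fun x => ?_⟩
  · obtain ⟨j, hj, h⟩ := hS.cont i hi hlim _ (mem_img.1 hx)
    exact ⟨j, hj, mem_img.2 h⟩
  · simp [hmem]

/-- Choose each `R j` universal over the union of the earlier ones, then interpolate a continuous
chain. -/
theorem exists_limD (hLS : K.LS ≤ μ) (hAP : K.Amalgamation μ) (hSt : K.Stable μ)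
    (hC : K.Monster μ C) {θ : Ordinal.{w}} (hθ : IsSuccLimit θ) (hθμ : θ < (succ μ).ord)
    {B : L.Substructure C} (hB : K.Mod μ B) : ∃ M, K.LimD μ θ B M := by
  have hμ := (ls_spec hLS).1
  obtain ⟨R, hR⟩ := exists_transfinite (X := L.Substructure C)
    (fun j f R => ∃ Q, K.UnivIn μ Q R ∧ B ≤ Q ∧ ∀ i < j, f i ≤ Q)
    (fun j f g R hfg ⟨Q, h₁, h₂, h₃⟩ => ⟨Q, h₁, h₂, fun i hi => hfg i hi ▸ h₃ i hi⟩) θ (by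
    intro j hj f hf
    obtain ⟨Q, hQ, hmem⟩ := exists_chain_union hμ (card_le_of_lt (hj.trans hθμ)) hB
      (fun i hi => (hf i hi).choose_spec.1.mod_right)
      (fun i hi => (hf i hi).choose_spec.2.1.trans (hf i hi).choose_spec.1.le)
      fun i k hik hk => by
        rcases hik.eq_or_lt with rfl | h
        · exact le_rfl
        · exact ((hf k hk).choose_spec.2.2 i h).trans (hf k hk).choose_spec.1.le
    obtain ⟨R, hR⟩ := exists_univIn hLS hAP hSt hC hQ
    exact ⟨R, Q, hR, fun x hx => (hmem x).2 (Or.inl hx),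
      fun i hi x hx => (hmem x).2 (Or.inr ⟨i, hi, hx⟩)⟩)
  obtain ⟨S, hS, hS0, -⟩ := exists_cw hLS hAP hC hθ hθμ hB hR
  obtain ⟨M, -, hmem⟩ := hS.exists_union hμ
  exact ⟨M, S, hS, hS0, hmem⟩

theorem CW.isWitness (hLS : K.LS ≤ μ) (hC : K.Monster μ C) {θ : Ordinal.{w}}
    {S : Ordinal.{w} → L.Substructure C} (h : K.CW μ θ S) {M : Type w} [L.Structure M]
    {k : M ↪[L] C} (hk : K.Strong k) (hM : #M = μ) (hmem : ∀ x, ∃ i < θ, k x ∈ S i)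
    (hle : ∀ i < θ, S i ≤ k.toHom.range) :
    K.IsWitness μ θ (fun i => (S i).comap k.toHom) where
  card_top := hM
  card i hi := (Mod.comap hk (h.mod hi) (hle i hi)).2
  mono i j hij hj x hx := h.mono i j hij hj hx
  strong i hi := (Mod.comap hk (h.mod hi) (hle i hi)).1
  cont i hi hlim := by
    ext x
    simp only [SetLike.mem_coe, Set.mem_iUnion, exists_prop, Substructure.mem_comap]
    constructor
    · exact fun hx => h.cont i hi hlim _ hx
    · rintro ⟨j, hj, hx⟩
      exact h.mono j i hj.le hi hx
  univ i hi := by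
    have hi' : i < θ := lt_of_le_of_lt le_self_add hi
    have hs := Mod.comap hk (h.mod hi) (hle _ hi)
    rw [universalOver_iff hLS hC (K.strong_comp hs.1 hk), range_comp_comap k (hle _ hi)]
    convert h.univ i hi' using 1
    exact range_comp_comap k (hle _ hi')
  union x := hmem x

theorem LimD.isLimitOver (hLS : K.LS ≤ μ) (hC : K.Monster μ C) {θ : Ordinal.{w}} {N M : Type w}
    [L.Structure N] [L.Structure M] {f : N ↪[L] M} {k : M ↪[L] C} (hk : K.Strong k)
    (h : K.LimD μ θ (k.comp f).toHom.range k.toHom.range) : K.IsLimitOver μ θ f := by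
  have hM := h.mod (ls_spec hLS).1
  obtain ⟨S, hS, h0, hmem⟩ := h
  refine ⟨hS.lim, hS.lt, fun i => (S i).comap k.toHom, hS.isWitness hLS hC hk ?_
    (fun x => (hmem _).1 (by simp)) fun i hi x hx => (hmem x).2 ⟨i, hi, hx⟩, ?_⟩
  · rw [← hM.2]; exact Cardinal.mk_congr k.equivRange.toEquiv
  · change (S 0).comap k.toHom = _
    rw [h0]
    ext x
    simp only [Substructure.mem_comap, mem_range']
    constructor
    · rintro ⟨y, hy⟩
      exact ⟨y, k.injective hy⟩
    · rintro ⟨y, rfl⟩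
      exact ⟨y, rfl⟩

theorem LimD.isLimitModel (hLS : K.LS ≤ μ) (hC : K.Monster μ C) {θ : Ordinal.{w}}
    {B : L.Substructure C} {M : Type w} [L.Structure M] {k : M ↪[L] C} (hk : K.Strong k)
    (h : K.LimD μ θ B k.toHom.range) : K.IsLimitModel μ M := by
  refine ⟨B.comap k.toHom, θ, LimD.isLimitOver hLS hC hk ?_⟩
  rwa [range_comp_comap k (h.univIn (ls_spec hLS).1).le]

/-! ### Continuity, local character and symmetry in the monster model -/

theorem NS.of_continuity (hLS : K.LS ≤ μ) (hAP : K.Amalgamation μ) (hC : K.Monster μ C)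
    (hCont : K.SplittingContinuity μ) {θ : Ordinal.{w}} {S : Ordinal.{w} → L.Substructure C}
    (hS : K.CW μ θ S) {N M : L.Substructure C} (hmem : ∀ x, x ∈ M ↔ ∃ i < θ, x ∈ S i)
    (hN : K.Mod μ N) (hNS : N ≤ S 0) {b : C} (h : ∀ i < θ, K.NS μ N (S i) b) :
    K.NS μ N M b := by
  have hM : K.Mod μ M := LimD.mod (ls_spec hLS).1 ⟨S, hS, rfl, hmem⟩
  have hr : M.subtype.toHom.range = M := Substructure.range_subtype M
  have hle : ∀ i < θ, S i ≤ M.subtype.toHom.range := fun i hi x hx => by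
    rw [hr]; exact (hmem x).2 ⟨i, hi, hx⟩
  have hpos : 0 < θ := hS.lim.bot_lt
  have hNi : ∀ i < θ, N ≤ S i := fun i hi => hNS.trans (hS.mono 0 i zero_le hi)
  have hNM : N ≤ M.subtype.toHom.range := (hNi 0 hpos).trans (hle 0 hpos)
  have hW := hS.isWitness hLS hC hM.1 hM.2 (fun x => (hmem x).1 x.2) hle
  have hN' := Mod.comap hM.1 hN hNM
  obtain ⟨p, hp⟩ := exists_isGt hLS hM.1 hM.2 b
  have key := hCont θ hS.lim hS.lt M (fun i => (S i).comap M.subtype.toHom) hW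
    (N.comap M.subtype.toHom) (fun i hi x hx => hNi i hi hx) hN'.1 hN'.2 p (fun i hi => by
      refine (not_splits_iff hLS hAP hC (K.strong_comp (hW.strong i hi) hM.1)
        (hp.pull (hW.strong i hi))).2 ?_
      rw [range_comp_comap _ (hle i hi)]
      convert h i hi using 1
      exact range_comp_comap _ hNM)
  rw [not_splits_iff hLS hAP hC hM.1 hp, range_comp_comap _ hNM, hr] at key
  exact key

/-- Continuity needs a continuous chain starting at or above `T ξ`. The tail of `T` beyond `ξ` is
reindexed and interpolated by a chain with `S 0 = T ξ`, and nonsplitting over `T ξ` passes to its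
smaller members. -/
theorem NS.of_continuity_family (hLS : K.LS ≤ μ) (hAP : K.Amalgamation μ) (hC : K.Monster μ C)
    (hCont : K.SplittingContinuity μ) {ξ j : Ordinal.{w}} (hj : IsSuccLimit j) (hξ : ξ < j)
    (hjμ : j < (succ μ).ord) {T : Ordinal.{w} → L.Substructure C} (hTξ : K.Mod μ (T ξ))
    (hT : ∀ k < j, ∃ Q, K.UnivIn μ Q (T k) ∧ ∀ i < k, T i ≤ Q)
    {M : L.Substructure C} (hmem : ∀ x, x ∈ M ↔ ∃ i < j, x ∈ T i)
    {b : C} (h : ∀ i < j, ξ ≤ i → K.NS μ (T ξ) (T i) b) : K.NS μ (T ξ) M b := by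
  have hTmono : ∀ i k, i ≤ k → k < j → T i ≤ T k := fun i k hik hk => by
    rcases hik.eq_or_lt with rfl | hlt
    · exact le_rfl
    · obtain ⟨Q, hQ, hQT⟩ := hT k hk
      exact (hQT i hlt).trans hQ.le
  have hξ1 : ξ + 1 < j := add_one_lt_of_lim hj hξ
  -- Starting at `ξ + 1` makes every member of the tail universal over a model that contains the
  -- base `T ξ`.
  obtain ⟨θ, rfl⟩ : ∃ θ, j = ξ + 1 + θ := ⟨j - (ξ + 1), (Ordinal.add_sub_cancel_of_le hξ1.le).symm⟩
  have hθ0 : θ ≠ 0 := by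
    rintro rfl
    simp at hξ1
  have hθ : IsSuccLimit θ := by
    rcases Ordinal.zero_or_succ_or_isSuccLimit θ with h | ⟨i, rfl⟩ | h
    · exact absurd h hθ0
    · rw [Order.succ_eq_add_one i, ← add_assoc, ← Order.succ_eq_add_one] at hj
      exact absurd hj (Order.not_isSuccLimit_succ _)
    · exact h
  have hlt : ∀ k < θ, ξ + 1 + k < ξ + 1 + θ := fun k hk => by simpa using hk
  have hθμ : θ < (succ μ).ord := le_add_self.trans_lt hjμ
  have hlt' : ∀ k : Ordinal.{w}, ξ < ξ + 1 + k := fun k =>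
    (Order.lt_add_one_iff.2 le_rfl).trans_le le_self_add
  obtain ⟨S, hS, hS0, hSmem⟩ := exists_cw hLS hAP hC hθ hθμ hTξ (R := fun k => T (ξ + 1 + k))
    fun k hk => by
      obtain ⟨Q, hQ, hQT⟩ := hT _ (hlt k hk)
      exact ⟨Q, hQ, hQT _ (hlt' k), fun i hi => hQT _ (by simpa using hi)⟩
  refine NS.of_continuity hLS hAP hC hCont hS (fun x => ?_) hTξ hS0.ge fun k hk => ?_
  · rw [hmem]
    constructor
    · rintro ⟨i, hi, hx⟩
      rcases le_or_gt i ξ with hle | hlt''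
      · exact ⟨0, hθ.bot_lt, by rw [hS0]; exact hTmono i ξ hle hξ hx⟩
      · obtain ⟨l, rfl⟩ : ∃ l, i = ξ + 1 + l :=
          ⟨i - (ξ + 1), (Ordinal.add_sub_cancel_of_le (Order.add_one_le_iff.2 hlt'')).symm⟩
        have hl : l < θ := by simpa using hi
        have hl1 := add_one_lt_of_lim hθ hl
        exact ⟨l + 1, hl1, (hSmem _ hl1 x).2 (Or.inr ⟨l, Order.lt_add_one_iff.2 le_rfl, hx⟩)⟩
    · rintro ⟨k, hk, hx⟩
      rcases (hSmem k hk x).1 hx with hx | ⟨l, hl, hx⟩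
      · exact ⟨ξ, hξ, hx⟩
      · exact ⟨_, hlt l (hl.trans hk), hx⟩
  · refine (h _ (hlt k hk) (hlt' k).le).mono le_rfl fun x hx => ?_
    rcases (hSmem k hk x).1 hx with hx | ⟨l, hl, hx⟩
    · exact hTmono _ _ (hlt' k).le (hlt k hk) hx
    · exact hTmono (ξ + 1 + l) (ξ + 1 + k) (by simpa using hl.le) (hlt k hk) hx

/-- Below μ⁺ the value of `kappaStar` is an attained infimum, hence itself a cardinal with local
character. -/
theorem exists_localCharacter {δ : Ordinal.{w}}
    (hκ : K.kappaStar μ < ((succ μ : Cardinal.{w}) : WithTop Cardinal.{w}))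
    (hcof : K.kappaStar μ ≤ ((δ.cof : Cardinal.{w}) : WithTop Cardinal.{w})) :
    ∃ κ, κ ≤ δ.cof ∧ K.LocalCharacter μ κ := by
  classical
  by_cases h : ∃ κ : Cardinal.{w}, κ.IsRegular ∧ κ < succ μ ∧ K.LocalCharacter μ κ
  · rw [kappaStar, if_pos h] at hcof
    exact ⟨_, WithTop.coe_le_coe.1 hcof, (csInf_mem h).2.2⟩
  · rw [kappaStar, if_neg h] at hκ
    exact absurd hκ not_top_lt

/-- Local character concerns continuous chains of regular length. It is applied to a chain
interpolating a cofinal subsequence of `T` of length cf(δ); enlarging the base from `S i` to `T (e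
i)` preserves nonsplitting. -/
theorem NS.exists_of_localCharacter (hLS : K.LS ≤ μ) (hAP : K.Amalgamation μ)
    (hC : K.Monster μ C) {δ : Ordinal.{w}} (hδ : IsSuccLimit δ) (hδμ : δ < (succ μ).ord)
    {κ : Cardinal.{w}} (hκδ : κ ≤ δ.cof) (hκ : K.LocalCharacter μ κ)
    {T : Ordinal.{w} → L.Substructure C} {B : L.Substructure C} (hB : K.Mod μ B)
    (hT : ∀ k < δ, ∃ Q, K.UnivIn μ Q (T k) ∧ B ≤ Q ∧ ∀ i < k, T i ≤ Q)
    {M : L.Substructure C} (hmem : ∀ x, x ∈ M ↔ ∃ i < δ, x ∈ T i) {b : C} (hb : b ∉ M) :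
    ∃ ξ < δ, K.NS μ (T ξ) M b := by
  classical
  obtain ⟨θ, hθδ⟩ : ∃ θ, δ.cof.ord = θ := ⟨_, rfl⟩
  obtain ⟨f, hf⟩ := Ordinal.exists_isFundamentalSeq hθδ
  have hreg := Cardinal.isRegular_cof hδ
  have hθ : IsSuccLimit θ := hθδ ▸ Cardinal.isSuccLimit_ord hreg.1
  have hθμ : θ < (succ μ).ord := hθδ ▸ (Ordinal.ord_cof_le δ).trans_lt hδμ
  let e : Ordinal.{w} → Ordinal.{w} := fun k => if h : k < θ then f ⟨k, h⟩ else 0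
  have he : ∀ k (hk : k < θ), e k = f ⟨k, hk⟩ := fun k hk => dif_pos hk
  have heδ : ∀ k < θ, e k < δ := fun k hk => by rw [he k hk]; exact (f ⟨k, hk⟩).2
  have hemono : ∀ i k, i < k → k < θ → e i < e k := fun i k hik hk => by
    rw [he k hk, he i (hik.trans hk)]
    exact hf.strictMono (Subtype.mk_lt_mk.2 hik)
  have hTmono : ∀ i k, i ≤ k → k < δ → T i ≤ T k := fun i k hik hk => by
    rcases hik.eq_or_lt with rfl | hlt
    · exact le_rfl
    · obtain ⟨Q, hQ, -, hQT⟩ := hT k hk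
      exact (hQT i hlt).trans hQ.le
  obtain ⟨S, hS, hS0, hSmem⟩ := exists_cw hLS hAP hC hθ hθμ hB (R := fun k => T (e k))
    fun k hk => by
      obtain ⟨Q, hQ, hBQ, hQT⟩ := hT _ (heδ k hk)
      exact ⟨Q, hQ, hBQ, fun i hi => hQT _ (hemono i k hi hk)⟩
  have hBT : ∀ k < δ, B ≤ T k := fun k hk => by
    obtain ⟨Q, hQ, hBQ, -⟩ := hT k hk
    exact hBQ.trans hQ.le
  have hST : ∀ k < θ, S k ≤ T (e k) := fun k hk x hx => by
    rcases (hSmem k hk x).1 hx with hx | ⟨l, hl, hx⟩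
    · exact hBT _ (heδ k hk) hx
    · exact hTmono _ _ (hemono l k hl hk).le (heδ k hk) hx
  have hmem' : ∀ x, x ∈ M ↔ ∃ k < θ, x ∈ S k := fun x => by
    rw [hmem]
    constructor
    · rintro ⟨i, hi, hx⟩
      obtain ⟨_, ⟨⟨k, hk⟩, rfl⟩, hik⟩ := hf.isCofinal_range ⟨i, hi⟩
      have hik' : i ≤ e k := by rw [he k hk]; exact hik
      have hk1 := add_one_lt_of_lim hθ hk
      exact ⟨k + 1, hk1, (hSmem _ hk1 x).2
        (Or.inr ⟨k, Order.lt_add_one_iff.2 le_rfl, hTmono _ _ hik' (heδ k hk) hx⟩)⟩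
    · rintro ⟨k, hk, hx⟩
      exact ⟨e k, heδ k hk, hST k hk hx⟩
  have hM : K.Mod μ M := LimD.mod (ls_spec hLS).1 ⟨S, hS, rfl, hmem'⟩
  have hr : M.subtype.toHom.range = M := Substructure.range_subtype M
  have hle : ∀ i < θ, S i ≤ M.subtype.toHom.range := fun i hi x hx => by
    rw [hr]; exact (hmem' x).2 ⟨i, hi, hx⟩
  have hW := hS.isWitness hLS hC hM.1 hM.2 (fun x => (hmem' x).1 x.2) hle
  obtain ⟨p, hp⟩ := exists_isGt hLS hM.1 hM.2 b
  have hκ' := hκ _ hκδ hreg M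
  rw [hθδ] at hκ'
  obtain ⟨i, hi, hns⟩ := hκ' _ hW p (by
    rw [hp.algebraic_iff hLS hAP hC hM.1 hM.2, hr]; exact hb)
  rw [not_splits_iff hLS hAP hC hM.1 hp, range_comp_comap _ (hle i hi), hr] at hns
  exact ⟨e i, heδ i hi, hns.mono (hST i hi) le_rfl⟩

/-- Symmetry is stated inside a model in `K_μ`, so everything is first moved to a model `D`
containing `M` and `b`. -/
theorem NS.exists_of_symmetry (hLS : K.LS ≤ μ) (hAP : K.Amalgamation μ) (hC : K.Monster μ C)
    {δ : Ordinal.{w}} (hSym : K.Symmetry μ δ) {N M₀ M : L.Substructure C} {a b : C}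
    (hU : K.UnivIn μ M₀ M) (hlim : K.LimD μ δ N M₀) (ha : a ∈ M) (ha' : a ∉ M₀)
    (haN : K.NS μ N M₀ a) (hb : b ∉ M) (hbN : K.NS μ M₀ M b) :
    ∃ Mb, K.Mod μ Mb ∧ M₀ ≤ Mb ∧ b ∈ Mb ∧ K.NS μ N Mb a := by
  have hNM := hlim.univIn (ls_spec hLS).1
  obtain ⟨D, hD, hMD, hbD⟩ := Monster.exists_mod_insert hLS hU.mod_right b
  have hr : D.subtype.toHom.range = D := Substructure.range_subtype D
  have hMD' : M ≤ D.subtype.toHom.range := hMD.trans hr.ge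
  have hM₀D' := hU.le.trans hMD'
  have hND' := hNM.le.trans hM₀D'
  have h₁ := Mod.comap hD.1 hNM.mod_left hND'
  have h₂ := Mod.comap hD.1 hU.mod_left hM₀D'
  have h₃ := Mod.comap hD.1 hU.mod_right hMD'
  have hs₂ := K.strong_comp h₂.1 hD.1
  have hs₃ := K.strong_comp h₃.1 hD.1
  have hle₁ : N.comap D.subtype.toHom ≤ M₀.comap D.subtype.toHom := fun x hx => hNM.le hx
  have hle₂ : M₀.comap D.subtype.toHom ≤ M.comap D.subtype.toHom := fun x hx => hU.le hx
  have hga : IsGt _ a (tp (M₀.comap D.subtype.toHom).subtype h₂.1 hD.2 ⟨a, hMD ha⟩) :=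
    isGt_tp h₂.1 hD.2 ⟨a, hMD ha⟩ hD.1
  have hgb : IsGt _ b (tp (M.comap D.subtype.toHom).subtype h₃.1 hD.2 ⟨b, hbD⟩) :=
    isGt_tp h₃.1 hD.2 ⟨b, hbD⟩ hD.1
  have hr₁ : ((D.subtype.comp (M₀.comap D.subtype.toHom).subtype).comp
      (Substructure.inclusion hle₁)).toHom.range = N := range_comp_comap _ hND'
  have hr₂ : ((D.subtype.comp (M.comap D.subtype.toHom).subtype).comp
      (Substructure.inclusion hle₂)).toHom.range = M₀ := range_comp_comap _ hM₀D'
  obtain ⟨C', _, hC', g, Mb, hMb, h₀, hNb, hg, ⟨θ, hθ⟩, hgb', hns⟩ := hSym D hD.2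
    (N.comap D.subtype.toHom) (M₀.comap D.subtype.toHom) (M.comap D.subtype.toHom) hle₁ hle₂
    h₁.1 h₂.1 h₃.1 ⟨a, hMD ha⟩ ⟨b, hbD⟩
    (by rw [universalOver_iff hLS hC hs₃, hr₂, range_comp_comap _ hMD']; exact hU)
    (LimD.isLimitOver hLS hC hs₂ (by rw [hr₁, range_comp_comap _ hM₀D']; exact hlim))
    ha ha'
    (by rw [hga.algebraic_iff hLS hAP hC hs₂ h₂.2, range_comp_comap _ hM₀D']; exact ha')
    (by rw [not_splits_iff hLS hAP hC hs₂ hga, hr₁, range_comp_comap _ hM₀D']; exact haN)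
    (by rw [hgb.algebraic_iff hLS hAP hC hs₃ h₃.2, range_comp_comap _ hMD']; exact hb)
    (by rw [not_splits_iff hLS hAP hC hs₃ hgb, hr₂, range_comp_comap _ hMD']; exact hbN)
  -- The extension found by symmetry is brought back into `C` over `D`, so `a` and `b` do not move.
  obtain ⟨h, hh, hhg⟩ := hC.exists_extension D C' D.subtype g hD.2 hC' hD.1 hg
  have hhg' : ∀ x : D, h (g x) = x := DFunLike.congr_fun hhg
  have hMbc : #Mb = μ := by
    obtain ⟨-, -, S, hS, -⟩ := hθ
    exact hS.card_top
  have hsb := K.strong_comp hMb hh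
  have hgt := isGt_tp hMb hC' (g ⟨a, hMD ha⟩) hh
  rw [not_splits_iff hLS hAP hC hsb hgt, hhg'] at hns
  have hrN : ((h.comp Mb.subtype).comp (Substructure.inclusion hNb)).toHom.range = N := by
    ext y
    rw [mem_range']
    constructor
    · rintro ⟨⟨x, z, hz, rfl⟩, rfl⟩
      have : h (g z) = z := hhg' z
      change h (g z) ∈ N
      rw [this]
      exact hz
    · intro hy
      have hyD : y ∈ D := hMD (hU.le (hNM.le hy))
      exact ⟨⟨g ⟨y, hyD⟩, ⟨y, hyD⟩, hy, rfl⟩, hhg' ⟨y, hyD⟩⟩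
  rw [hrN] at hns
  refine ⟨_, Mod.range hsb hMbc, fun y hy => ?_, ?_, hns⟩
  · have hyD : y ∈ D := hMD (hU.le hy)
    exact (mem_range' _ _).2 ⟨⟨g ⟨y, hyD⟩, h₀ ⟨⟨y, hyD⟩, hy, rfl⟩⟩, hhg' ⟨y, hyD⟩⟩
  · exact (mem_range' _ _).2 ⟨⟨_, hgb'⟩, hhg' ⟨b, hbD⟩⟩

end

section

variable {L : FirstOrder.Language.{u, v}} {K : AEC.{u, v, w} L} {μ : Cardinal.{w}}
variable {C : Type w} [L.Structure C]

/-! ### Rebuilding towers in the monster model -/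

theorem exists_aut_glue (hLS : K.LS ≤ μ) (hC : K.Monster μ C) {ξ j : Ordinal.{w}}
    (hξ : ξ < j) (hjμ : j < (succ μ).ord) {M : Ordinal.{w} → L.Substructure C}
    (hM : ∀ i, ξ ≤ i → i < j → K.Mod μ (M i))
    (mono : ∀ i k, ξ ≤ i → i ≤ k → k < j → M i ≤ M k) {σ : Ordinal.{w} → C ≃[L] C}
    (coh : ∀ i k, ξ ≤ i → i ≤ k → k < j → ∀ x ∈ M i, σ k x = σ i x) :
    ∃ τ : C ≃[L] C, ∀ i, ξ ≤ i → i < j → ∀ x ∈ M i, τ x = σ i x := by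
  -- Indices below `ξ` are sent to `ξ`, turning a family on the interval from `ξ` to `j` into one on
  -- all ordinals below `j`.
  have hmax : ∀ i < j, max ξ i < j := fun i hi => max_lt hξ hi
  have hle : ∀ i, ξ ≤ max ξ i := fun i => le_max_left _ _
  have hs : ∀ i, ξ ≤ i → i < j → K.StrongOn (σ i) (M i) := fun i h₁ h₂ =>
    StrongOn.of_equiv _ (hM i h₁ h₂).1
  obtain ⟨G, -, hG, hGs⟩ := exists_glue_base (j := j) (hs ξ le_rfl hξ)
    (S := fun i => M (max ξ i)) (F := fun i => σ (max ξ i))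
    (fun i hi => mono _ _ le_rfl (hle i) (hmax i hi))
    (fun i hi => coh _ _ le_rfl (hle i) (hmax i hi))
    (fun i k hik hk => mono _ _ (hle i) (max_le_max le_rfl hik.le) (hmax k hk))
    (fun i hi => hs _ (hle i) (hmax i hi))
    (fun i k hik hk => coh _ _ (hle i) (max_le_max le_rfl hik.le) (hmax k hk))
  obtain ⟨D, hD, hmem⟩ := exists_chain_union (ls_spec hLS).1 (card_le_of_lt hjμ)
    (hM ξ le_rfl hξ) (R := fun i => M (max ξ i)) (fun i hi => hM _ (hle i) (hmax i hi))
    (fun i hi => mono _ _ le_rfl (hle i) (hmax i hi))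
    (fun i k hik hk => mono _ _ (hle i) (max_le_max le_rfl hik) (hmax k hk))
  obtain ⟨τ, hτ⟩ := Monster.exists_aut_of_strongOn hLS hC hD (hGs D hmem)
  refine ⟨τ, fun i h₁ h₂ x hx => ?_⟩
  have hmi : max ξ i = i := max_eq_right h₁
  have hx' : x ∈ M (max ξ i) := by rwa [hmi]
  rw [hτ x ((hmem x).2 (Or.inr ⟨i, h₂, hx'⟩)), hG i h₂ x hx', hmi]

theorem exists_mod_family (hLS : K.LS ≤ μ) {j : Ordinal.{w}} (hj : j.card ≤ μ)
    {P : L.Substructure C} (hP : K.Mod μ P) (p : Ordinal.{w} → Prop)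
    {T : Ordinal.{w} → L.Substructure C} (hT : ∀ i < j, p i → K.Mod μ (T i)) :
    ∃ R, K.Mod μ R ∧ P ≤ R ∧ ∀ i < j, p i → T i ≤ R := by
  classical
  have hμ := (ls_spec hLS).1
  let B : Ordinal.{w} → Set C := fun i => if p i then T i else ∅
  obtain ⟨R, hR, hBR, hPR⟩ := exists_mod hLS hP (⋃ i < j, B i)
    (Cardinal.mk_biUnion_le_of_le hj hμ _ fun i hi => by
      by_cases h : p i
      · simp only [B, h, if_true]; exact (hT i hi h).2.le
      · simp [B, h])
  refine ⟨R, hR, hPR, fun i hi h x hx => hBR ?_⟩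
  simp only [Set.mem_iUnion]
  exact ⟨i, hi, by simpa [B, h] using hx⟩

variable (K μ) in
/-- On the interval `[ξ, γ)`, the models `T j` are limit models containing `σ j (M j)`, and
`σ (j + 1) (a j)` realizes over `T j` a nonsplitting type. -/
structure Rebuild (θ ξ γ : Ordinal.{w}) (H : (C ≃[L] C) → Prop)
    (M N : Ordinal.{w} → L.Substructure C) (a : Ordinal.{w} → C)
    (T : Ordinal.{w} → L.Substructure C) (σ : Ordinal.{w} → C ≃[L] C) : Prop where
  mem : ∀ j, ξ ≤ j → j < γ → H (σ j)
  coh : ∀ i j, ξ ≤ i → i ≤ j → j < γ → ∀ x ∈ M i, σ j x = σ i x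
  lim : ∀ j, ξ ≤ j → j < γ → ∃ R, K.LimD μ θ R (T j) ∧ img (σ j) (M j) ≤ R ∧
    ∀ i, ξ ≤ i → i < j → T i ≤ R
  ns : ∀ j, ξ ≤ j → j + 1 < γ → K.NS μ (img (σ j) (N j)) (T j) (σ (j + 1) (a j)) ∧
    σ (j + 1) (a j) ∉ T j

/-- `H` is the constraint carried by the automorphisms: fixing `b` in one application, nothing in
the others. `hsucc` moves `a j` to a nonsplitting realization, and `hlim` glues within `H`. -/
theorem exists_rebuild (hLS : K.LS ≤ μ) (hAP : K.Amalgamation μ) (hSt : K.Stable μ)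
    (hC : K.Monster μ C) {θ ξ γ : Ordinal.{w}} (hθ : IsSuccLimit θ) (hθμ : θ < (succ μ).ord)
    (hγ : γ ≤ (succ μ).ord) {H : (C ≃[L] C) → Prop}
    (hH₁ : H (FirstOrder.Language.Equiv.refl L C)) (hH₂ : ∀ σ τ, H σ → H τ → H (σ.comp τ))
    {M N : Ordinal.{w} → L.Substructure C} {a : Ordinal.{w} → C}
    (hM : ∀ i, ξ ≤ i → i < γ → K.Mod μ (M i)) {T₀ : L.Substructure C}
    (hT₀ : ∃ R, K.LimD μ θ R T₀ ∧ M ξ ≤ R)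
    (hsucc : ∀ j, ξ ≤ j → j + 1 < γ → ∀ P, K.Mod μ P → M j ≤ P →
      ∃ τ, H τ ∧ (∀ x ∈ M j, τ x = x) ∧ K.NS μ (N j) P (τ (a j)) ∧ τ (a j) ∉ P)
    (mono : ∀ i j, ξ ≤ i → i ≤ j → j < γ → M i ≤ M j)
    (hlim : ∀ j, IsSuccLimit j → ξ < j → j < γ → ∀ σ : Ordinal.{w} → C ≃[L] C,
      (∀ i, ξ ≤ i → i < j → H (σ i)) →
      (∀ i k, ξ ≤ i → i ≤ k → k < j → ∀ x ∈ M i, σ k x = σ i x) →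
      ∃ τ, H τ ∧ ∀ i, ξ ≤ i → i < j → ∀ x ∈ M i, τ x = σ i x) (hξγ : ξ < γ) :
    ∃ T σ, T ξ = T₀ ∧ σ ξ = FirstOrder.Language.Equiv.refl L C ∧
      K.Rebuild μ θ ξ γ H M N a T σ := by
  have hμ := (ls_spec hLS).1
  have : Nonempty (L.Substructure C × (C ≃[L] C)) := ⟨(⊤, FirstOrder.Language.Equiv.refl L C)⟩
  obtain ⟨f, hf⟩ := exists_transfinite (X := L.Substructure C × (C ≃[L] C))
    (fun j f Z => (j = ξ → Z.1 = T₀ ∧ Z.2 = FirstOrder.Language.Equiv.refl L C) ∧ (ξ ≤ j →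
      H Z.2 ∧ (∀ i, ξ ≤ i → i < j → ∀ x ∈ M i, Z.2 x = (f i).2 x) ∧
      (∃ R, K.LimD μ θ R Z.1 ∧ img Z.2 (M j) ≤ R ∧ ∀ i, ξ ≤ i → i < j → (f i).1 ≤ R) ∧
      ∀ k, ξ ≤ k → k + 1 = j → K.NS μ (img (f k).2 (N k)) (f k).1 (Z.2 (a k)) ∧
        Z.2 (a k) ∉ (f k).1)) (by
    rintro j f g Z hfg ⟨h₁, h₂⟩
    refine ⟨h₁, fun h => ?_⟩
    obtain ⟨h₃, h₄, ⟨R, h₅, h₆, h₇⟩, h₈⟩ := h₂ h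
    refine ⟨h₃, fun i hi hij => hfg i hij ▸ h₄ i hi hij, ⟨R, h₅, h₆, fun i hi hij =>
      hfg i hij ▸ h₇ i hi hij⟩, fun k hk hkj => ?_⟩
    have : k < j := hkj ▸ Order.lt_add_one_iff.2 le_rfl
    exact hfg k this ▸ h₈ k hk hkj) γ (by
    intro j hj f hf
    rcases lt_trichotomy j ξ with hlt | rfl | hlt
    · exact ⟨(⊤, FirstOrder.Language.Equiv.refl L C), fun h => absurd h hlt.ne,
        fun h => absurd hlt h.not_gt⟩
    · obtain ⟨R, hR, hMR⟩ := hT₀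
      refine ⟨(T₀, FirstOrder.Language.Equiv.refl L C), fun _ => ⟨rfl, rfl⟩, fun _ => ⟨hH₁,
        fun i hi hij => absurd hij hi.not_gt, ⟨R, hR, fun x hx => hMR ?_,
        fun i hi hij => absurd hij hi.not_gt⟩, fun k hk hkj => ?_⟩⟩
      · exact mem_img.1 hx
      · exact absurd (hkj ▸ Order.lt_add_one_iff.2 le_rfl) hk.not_gt
    · have hjμ : j < (succ μ).ord := hj.trans_le hγ
      have hcoh : ∀ i k, ξ ≤ i → i ≤ k → k < j → ∀ x ∈ M i, (f k).2 x = (f i).2 x := by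
        intro i k hi hik hk x hx
        rcases hik.eq_or_lt with rfl | h
        · rfl
        · exact ((hf k hk).2 (hi.trans hik)).2.1 i hi h x hx
      obtain ⟨σ, hσ, hσc, hns⟩ : ∃ σ, H σ ∧ (∀ i, ξ ≤ i → i < j → ∀ x ∈ M i, σ x = (f i).2 x) ∧
          ∀ k, ξ ≤ k → k + 1 = j → K.NS μ (img (f k).2 (N k)) (f k).1 (σ (a k)) ∧
            σ (a k) ∉ (f k).1 := by
        rcases Ordinal.zero_or_succ_or_isSuccLimit j with rfl | ⟨k, rfl⟩ | hlimj
        · exact absurd hlt not_lt_zero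
        · rw [Order.succ_eq_add_one] at *
          have hkk : k < k + 1 := Order.lt_add_one_iff.2 le_rfl
          have hk : ξ ≤ k := Order.lt_add_one_iff.1 hlt
          obtain ⟨hHk, -, ⟨R, hR, hMR, -⟩, -⟩ := (hf k hkk).2 hk
          -- The move is made over the preimage of `T k` under `σ k`; composing with `σ k` puts the
          -- realization over `T k` itself, while `τ` fixes `M k` and so preserves coherence.
          obtain ⟨τ, hτ, hτM, hτN, hτa⟩ := hsucc k hk hj (img (f k).2.symm (f k).1)
            ((hR.mod hμ).img _) (by
              rw [← img_le_img (σ := (f k).2), img_img_symm]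
              exact hMR.trans (hR.univIn hμ).le)
          refine ⟨(f k).2.comp τ, hH₂ _ _ hHk hτ, fun i hi hik x hx => ?_, fun l hl hlk => ?_⟩
          · have hik' : i ≤ k := Order.lt_add_one_iff.1 hik
            rw [FirstOrder.Language.Equiv.comp_apply,
              hτM x (mono i k hi hik' (hkk.trans hj) hx), hcoh i k hi hik' hkk x hx]
          · have hlk' : l = k := Order.add_one_inj.1 hlk
            subst hlk'
            have h := hτN.img (f l).2
            rw [img_img_symm] at h
            refine ⟨h, fun h' => hτa ?_⟩
            simpa using h'
        · obtain ⟨τ, hτ, hτc⟩ := hlim j hlimj hlt hj (fun i => (f i).2)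
            (fun i hi hij => ((hf i hij).2 hi).1) hcoh
          refine ⟨τ, hτ, hτc, fun k hk hkj => ?_⟩
          subst hkj
          rw [← Order.succ_eq_add_one] at hlimj
          exact absurd hlimj (Order.not_isSuccLimit_succ _)
      obtain ⟨R, hR, hPR, hTR⟩ := exists_mod_family hLS (card_le_of_lt hjμ)
        ((hM j hlt.le hj).img σ) (fun i => ξ ≤ i) (T := fun i => (f i).1) (fun i hij hi => by
          obtain ⟨-, -, ⟨R, hR, -⟩, -⟩ := (hf i hij).2 hi
          exact hR.mod hμ)
      obtain ⟨T, hT⟩ := exists_limD hLS hAP hSt hC hθ hθμ hR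
      exact ⟨(T, σ), fun h => absurd h hlt.ne', fun _ => ⟨hσ, hσc,
        ⟨R, hT, hPR, fun i hi hij => hTR i hij hi⟩, hns⟩⟩)
  obtain ⟨h₁, h₂⟩ := (hf ξ hξγ).1 rfl
  refine ⟨fun j => (f j).1, fun j => (f j).2, h₁, h₂, ⟨fun j hj hjγ => ((hf j hjγ).2 hj).1,
    fun i j hi hij hj x hx => ?_, fun j hj hjγ => ((hf j hjγ).2 hj).2.2.1, fun j hj hjγ =>
    ((hf (j + 1) hjγ).2 (hj.trans le_self_add)).2.2.2 j hj rfl⟩⟩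
  rcases hij.eq_or_lt with rfl | h
  · rfl
  · exact ((hf j hj).2 (hi.trans hij)).2.1 i hi h x hx

/-- Pulling a rebuilt tower back along a common extension of the automorphisms. -/
theorem Rebuild.pull {θ ξ γ : Ordinal.{w}} {H : (C ≃[L] C) → Prop}
    {M N : Ordinal.{w} → L.Substructure C} {a : Ordinal.{w} → C}
    {T : Ordinal.{w} → L.Substructure C} {σ : Ordinal.{w} → C ≃[L] C}
    (h : K.Rebuild μ θ ξ γ H M N a T σ) {τ : C ≃[L] C}
    (hτ : ∀ i, ξ ≤ i → i < γ → ∀ x ∈ M i, τ x = σ i x)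
    (hN : ∀ i, ξ ≤ i → i < γ → N i ≤ M i) (ha : ∀ i, ξ ≤ i → i + 1 < γ → a i ∈ M (i + 1)) :
    (∀ j, ξ ≤ j → j < γ → ∃ R, K.LimD μ θ R (img τ.symm (T j)) ∧ M j ≤ R ∧
      ∀ i, ξ ≤ i → i < j → img τ.symm (T i) ≤ R) ∧
    ∀ j, ξ ≤ j → j + 1 < γ → K.NS μ (N j) (img τ.symm (T j)) (a j) ∧ a j ∉ img τ.symm (T j) := by
  constructor
  · intro j hj hjγ
    obtain ⟨R, hR, hMR, hTR⟩ := h.lim j hj hjγ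
    refine ⟨img τ.symm R, hR.img _, ?_, fun i hi hij => img_le_img.2 (hTR i hi hij)⟩
    rw [← img_le_img (σ := τ), img_img_symm, img_congr (hτ j hj hjγ)]
    exact hMR
  · intro j hj hjγ
    have hjγ' : j < γ := lt_of_le_of_lt le_self_add hjγ
    obtain ⟨h₁, h₂⟩ := h.ns j hj hjγ
    rw [← hτ (j + 1) (hj.trans le_self_add) hjγ _ (ha j hj hjγ)] at h₁ h₂
    rw [← img_congr fun x hx => hτ j hj hjγ' x (hN j hj hjγ' hx)] at h₁
    have h₃ := h₁.img τ.symm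
    rw [img_symm_img, FirstOrder.Language.Equiv.symm_apply_apply] at h₃
    exact ⟨h₃, fun h' => h₂ (by simpa using h')⟩

/-! ### Extending towers of limit length -/

variable (K μ) in
/-- The elementwise data of a tower of length `γ` inside the monster model. -/
structure TowerData (γ : Ordinal.{w}) (M N : Ordinal.{w} → L.Substructure C)
    (a : Ordinal.{w} → C) : Prop where
  mod : ∀ i < γ, K.Mod μ (M i)
  mono : ∀ i j, i ≤ j → j < γ → M i ≤ M j
  univ : ∀ i, i + 1 < γ → K.UnivIn μ (N i) (M i)
  mem : ∀ i, i + 1 < γ → a i ∈ M (i + 1)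
  notMem : ∀ i, i + 1 < γ → a i ∉ M i
  ns : ∀ i, i + 1 < γ → K.NS μ (N i) (M i) (a i)

theorem TowerData.restrict {γ γ' : Ordinal.{w}} {M N : Ordinal.{w} → L.Substructure C}
    {a : Ordinal.{w} → C} (h : K.TowerData μ γ M N a) (hle : γ' ≤ γ) :
    K.TowerData μ γ' M N a where
  mod i hi := h.mod i (hi.trans_le hle)
  mono i j hij hj := h.mono i j hij (hj.trans_le hle)
  univ i hi := h.univ i (hi.trans_le hle)
  mem i hi := h.mem i (hi.trans_le hle)
  notMem i hi := h.notMem i (hi.trans_le hle)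
  ns i hi := h.ns i (hi.trans_le hle)

/-- Every tower of limit length `δ < μ⁺` is extended by one whose models are `(μ, θ)`-limit
models over models containing the previous ones. -/
theorem TowerData.exists_extension (hLS : K.LS ≤ μ) (hAP : K.Amalgamation μ) (hSt : K.Stable μ)
    (hC : K.Monster μ C) {θ δ : Ordinal.{w}} (hθ : IsSuccLimit θ) (hθμ : θ < (succ μ).ord)
    (hδ : IsSuccLimit δ) (hδμ : δ < (succ μ).ord) {M N : Ordinal.{w} → L.Substructure C}
    {a : Ordinal.{w} → C} (h : K.TowerData μ δ M N a) :
    ∃ T : Ordinal.{w} → L.Substructure C,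
      (∀ j < δ, ∃ R, K.LimD μ θ R (T j) ∧ M j ≤ R ∧ ∀ i < j, T i ≤ R) ∧
      ∀ j < δ, K.NS μ (N j) (T j) (a j) ∧ a j ∉ T j := by
  have hpos : 0 < δ := hδ.bot_lt
  obtain ⟨T₀, hT₀⟩ := exists_limD hLS hAP hSt hC hθ hθμ (h.mod 0 hpos)
  obtain ⟨T, σ, -, -, hR⟩ := exists_rebuild hLS hAP hSt hC (ξ := 0) (N := N) (a := a) hθ hθμ
    hδμ.le (H := fun _ => True) trivial (fun _ _ _ _ => trivial) (fun i _ => h.mod i)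
    ⟨_, hT₀, le_rfl⟩ (fun j _ hj P hP hle => by
      obtain ⟨τ, h₁, h₂, h₃⟩ := (h.ns j hj).exists_extension (h.univ j hj) hP hle (h.notMem j hj)
      exact ⟨τ, trivial, h₁, h₂, h₃⟩) (fun i j _ => h.mono i j) (fun j hj hlt hjδ σ _ hσ => by
      obtain ⟨τ, hτ⟩ := exists_aut_glue hLS hC hlt (hjδ.trans hδμ)
        (fun i _ hij => h.mod i (hij.trans hjδ))
        (fun i k _ hik hk => h.mono i k hik (hk.trans hjδ)) hσ
      exact ⟨τ, trivial, hτ⟩) hpos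
  obtain ⟨τ, hτ⟩ := exists_aut_glue hLS hC hpos hδμ (fun i _ => h.mod i)
    (fun i j _ => h.mono i j) hR.coh
  obtain ⟨h₁, h₂⟩ := hR.pull hτ (fun i _ hi => (h.univ i (add_one_lt_of_lim hδ hi)).le)
    fun i _ => h.mem i
  refine ⟨fun j => img τ.symm (T j), fun j hj => ?_, fun j hj =>
    h₂ j zero_le (add_one_lt_of_lim hδ hj)⟩
  obtain ⟨R, hR₁, hR₂, hR₃⟩ := h₁ j zero_le hj
  exact ⟨R, hR₁, hR₂, fun i hi => hR₃ i zero_le hi⟩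

/-- A tower of limit length `δ` has an extension containing a given element `b`, by symmetry and
local character. -/
theorem TowerData.exists_extension_mem (hLS : K.LS ≤ μ) (hAP : K.Amalgamation μ)
    (hSt : K.Stable μ) (hC : K.Monster μ C) (hCont : K.SplittingContinuity μ) {δ : Ordinal.{w}}
    (hδ : IsSuccLimit δ) (hδμ : δ < (succ μ).ord) {κ : Cardinal.{w}} (hκδ : κ ≤ δ.cof)
    (hκ : K.LocalCharacter μ κ) (hSym : K.Symmetry μ δ) {M N : Ordinal.{w} → L.Substructure C}
    {a : Ordinal.{w} → C} (h : K.TowerData μ δ M N a) (b : C) :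
    ∃ T : Ordinal.{w} → L.Substructure C,
      (∀ j < δ, ∃ R, K.LimD μ δ R (T j) ∧ M j ≤ R) ∧
      (∀ i j, i ≤ j → j < δ → T i ≤ T j) ∧
      (∀ j < δ, K.NS μ (N j) (T j) (a j) ∧ a j ∉ T j) ∧ ∃ j < δ, b ∈ T j := by
  classical
  have hμ := (ls_spec hLS).1
  have hpos : 0 < δ := hδ.bot_lt
  obtain ⟨S, hS, hSns⟩ := h.exists_extension hLS hAP hSt hC hδ hδμ hδ hδμ
  have hSm : ∀ j < δ, K.Mod μ (S j) := fun j hj => by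
    obtain ⟨R, hR, -⟩ := hS j hj
    exact hR.mod hμ
  have hSmono : ∀ i j, i ≤ j → j < δ → S i ≤ S j := fun i j hij hj => by
    rcases hij.eq_or_lt with rfl | hlt
    · exact le_rfl
    · obtain ⟨R, hR, -, hSR⟩ := hS j hj
      exact (hSR i hlt).trans (hR.univIn hμ).le
  have hMS : ∀ j < δ, M j ≤ S j := fun j hj => by
    obtain ⟨R, hR, hMR, -⟩ := hS j hj
    exact hMR.trans (hR.univIn hμ).le
  -- If `b` has already entered, `S` serves. Otherwise `b` is outside every `S j`, as local
  -- character and symmetry require for nonalgebraic types.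
  by_cases hbS : ∃ j < δ, b ∈ S j
  · refine ⟨S, fun j hj => ?_, hSmono, hSns, hbS⟩
    obtain ⟨R, hR, hMR, -⟩ := hS j hj
    exact ⟨R, hR, hMR⟩
  have hU : ∀ k < δ, ∃ Q, K.UnivIn μ Q (S k) ∧ M 0 ≤ Q ∧ ∀ i < k, S i ≤ Q := fun k hk => by
    obtain ⟨R, hR, hMR, hSR⟩ := hS k hk
    exact ⟨R, hR.univIn hμ, (h.mono 0 k zero_le hk).trans hMR, hSR⟩
  have hUN : ∀ j < δ, K.UnivIn μ (N j) (S j) := fun j hj =>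
    (h.univ j (add_one_lt_of_lim hδ hj)).mono_right (hSm j hj) (hMS j hj)
  obtain ⟨W, hW, hWmem⟩ := exists_chain_union hμ (card_le_of_lt hδμ) (hSm 0 hpos) hSm
    (fun i hi => hSmono 0 i zero_le hi) hSmono
  have hWmem' : ∀ x, x ∈ W ↔ ∃ i < δ, x ∈ S i := fun x => (hWmem x).trans
    ⟨fun h => h.elim (fun h => ⟨0, hpos, h⟩) id, Or.inr⟩
  have hbW : b ∉ W := fun hb => hbS ((hWmem' b).1 hb)
  obtain ⟨ξ, hξ, hξb⟩ := NS.exists_of_localCharacter hLS hAP hC hδ hδμ hκδ hκ (h.mod 0 hpos) hU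
    hWmem' hbW
  have hSW : ∀ j < δ, S j ≤ W := fun j hj x hx => (hWmem' x).2 ⟨j, hj, hx⟩
  obtain ⟨P₀, hP₀, hSP₀, hbP₀⟩ := Monster.exists_mod_insert hLS (hSm ξ hξ) b
  obtain ⟨T₀, hT₀⟩ := exists_limD hLS hAP hSt hC hδ hδμ hP₀
  have hlim : ∀ j, IsSuccLimit j → ξ < j → j ≤ δ → ∀ σ : Ordinal.{w} → C ≃[L] C,
      (∀ i, ξ ≤ i → i < j → σ i b = b) →
      (∀ i k, ξ ≤ i → i ≤ k → k < j → ∀ x ∈ S i, σ k x = σ i x) →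
      ∃ τ : C ≃[L] C, τ b = b ∧ ∀ i, ξ ≤ i → i < j → ∀ x ∈ S i, τ x = σ i x := by
    intro j hj hlt hjδ σ hσ hσc
    obtain ⟨τ, hτ⟩ := exists_aut_glue hLS hC hlt (hjδ.trans_lt hδμ)
      (fun i _ hij => hSm i (hij.trans_le hjδ))
      (fun i k _ hik hk => hSmono i k hik (hk.trans_le hjδ)) hσc
    obtain ⟨Z, hZ, hZmem⟩ := exists_chain_union hμ (card_le_of_lt (hjδ.trans_lt hδμ))
      (hSm 0 hpos) (fun i hi => hSm i (hi.trans_le hjδ))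
      (fun i hi => hSmono 0 i zero_le (hi.trans_le hjδ))
      (fun i k hik hk => hSmono i k hik (hk.trans_le hjδ))
    have hZmem' : ∀ x, x ∈ Z ↔ ∃ i < j, x ∈ S i := fun x => (hZmem x).trans
      ⟨fun h => h.elim (fun h => ⟨0, hj.bot_lt, h⟩) id, Or.inr⟩
    have hSZ : ∀ i < j, S i ≤ Z := fun i hi x hx => (hZmem' x).2 ⟨i, hi, hx⟩
    have hZb : K.NS μ (S ξ) Z b := hξb.mono le_rfl fun x hx => by
      obtain ⟨i, hi, hx⟩ := (hZmem' x).1 hx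
      exact hSW i (hi.trans_le hjδ) hx
    have hfix : ∀ i, ξ ≤ i → i < j → ∀ x ∈ S i, (τ.symm.comp (σ i)) x = x := fun i hi hij x hx => by
      rw [FirstOrder.Language.Equiv.comp_apply, ← hτ i hi hij x hx]
      simp
    -- For each `i` from `ξ` on, τ⁻¹σ_i fixes `S i` pointwise and sends `b` to τ⁻¹(b). Hence τ⁻¹(b)
    -- and `b` have the same type over `S i`, and continuity carries nonsplitting to the union `Z`.
    have hZb' : K.NS μ (S ξ) Z (τ.symm b) := by
      refine NS.of_continuity_family hLS hAP hC hCont hj hlt (hjδ.trans_lt hδμ) (hSm ξ hξ)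
        (fun k hk => ?_) hZmem' fun i hij hi => ?_
      · obtain ⟨Q, hQ, -, hQS⟩ := hU k (hk.trans_le hjδ)
        exact ⟨Q, hQ, hQS⟩
      · have h₁ := (hZb.mono le_rfl (hSZ i hij)).img (τ.symm.comp (σ i))
        have himg : ∀ l, l ≤ i → img (τ.symm.comp (σ i)) (S l) = S l := fun l hl => by
          rw [img_congr (τ := FirstOrder.Language.Equiv.refl L C) fun x hx =>
            hfix i hi hij x (hSmono l i hl (hij.trans_le hjδ) hx)]
          ext x
          exact mem_img
        rw [himg ξ hi, himg i le_rfl, FirstOrder.Language.Equiv.comp_apply, hσ i hi hij] at h₁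
        exact h₁
    have hξ1 : ξ + 1 < j := add_one_lt_of_lim hj hlt
    have hUξ : K.UnivIn μ (S ξ) (S (ξ + 1)) := by
      obtain ⟨Q, hQ, -, hQS⟩ := hU _ (hξ1.trans_le hjδ)
      exact hQ.mono_left (hSm ξ hξ) (hQS ξ (Order.lt_add_one_iff.2 le_rfl)) hLS hAP hC
    -- Both types over `Z` do not split over `S ξ` and agree on `S (ξ + 1)`, which is universal over
    -- it. So some `ρ` fixing `Z` sends τ⁻¹(b) to `b`, and τρ⁻¹ is the corrected automorphism.
    obtain ⟨ρ, hρ, hρb⟩ := NS.unique hUξ hZ (hSZ _ hξ1) hZb' hZb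
      ⟨(τ.symm.comp (σ (ξ + 1))).symm, fun x hx => by
        have := hfix (ξ + 1) le_self_add hξ1 x hx
        conv_lhs => rw [← this]
        simp, by
        have h₁ := hσ (ξ + 1) le_self_add hξ1
        have h₂ : (τ.symm.comp (σ (ξ + 1))) b = τ.symm b := by
          rw [FirstOrder.Language.Equiv.comp_apply, h₁]
        rw [← h₂]
        simp⟩
    refine ⟨τ.comp ρ.symm, ?_, fun i hi hij x hx => ?_⟩
    · have : ρ.symm b = τ.symm b := ρ.injective (by rw [hρb]; simp)
      rw [FirstOrder.Language.Equiv.comp_apply, this]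
      simp
    · have h₁ := hρ x (hSZ i hij hx)
      have : ρ.symm x = x := by
        conv_lhs => rw [← h₁]
        simp
      rw [FirstOrder.Language.Equiv.comp_apply, this, hτ i hi hij x hx]
  have hsucc : ∀ j, ξ ≤ j → j + 1 < δ → ∀ P, K.Mod μ P → S j ≤ P →
      ∃ τ : C ≃[L] C, τ b = b ∧ (∀ x ∈ S j, τ x = x) ∧ K.NS μ (N j) P (τ (a j)) ∧ τ (a j) ∉ P := by
    intro j hj hjδ P hP hSP
    have hj' : j < δ := lt_of_le_of_lt le_self_add hjδ
    have hjj : j < j + 1 := Order.lt_add_one_iff.2 le_rfl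
    obtain ⟨Q, hQ, -, hQS⟩ := hU _ hjδ
    obtain ⟨R, hR, hMR, -⟩ := hS j hj'
    -- Symmetry applies because `S j` is a (μ, δ)-limit over `N j`, `S (j + 1)` is universal over `S
    -- j` and contains `a j`, and the type of `b` over it does not split over `S j`, which contains
    -- `S ξ`.
    obtain ⟨Mb, hMb, hSMb, hbMb, hns⟩ := NS.exists_of_symmetry hLS hAP hC hSym
      (hQ.mono_left (hSm j hj') (hQS j hjj) hLS hAP hC)
      (hR.mono_base hLS hAP hC (hUN j hj').mod_left ((h.univ j hjδ).le.trans hMR))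
      (hMS _ hjδ (h.mem j hjδ)) (hSns j hj').2 (hSns j hj').1
      (fun hb => hbS ⟨_, hjδ, hb⟩) (hξb.mono (hSmono ξ j hj hj') (hSW _ hjδ))
    obtain ⟨P', hP', hPP', hMbP'⟩ := exists_mod hLS hMb P hP.2.le
    obtain ⟨τ, hτ, hτN, hτa⟩ := (hSns j hj').1.exists_extension (hUN j hj') hP'
      (hSMb.trans hMbP') (hSns j hj').2
    -- Over `Mb`, both `a j` and `τ (a j)` realize the nonsplitting extension of the same type over
    -- `S j`. Hence the move can be made by an automorphism fixing `Mb`, and in particular `b`.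
    obtain ⟨ρ, hρ, hρa⟩ := NS.unique (hUN j hj') hMb hSMb hns (hτN.mono le_rfl hMbP')
      ⟨τ, hτ, rfl⟩
    refine ⟨ρ, hρ b hbMb, fun x hx => hρ x (hSMb hx), ?_, ?_⟩
    · rw [hρa]
      exact hτN.mono le_rfl hPP'
    · rw [hρa]
      exact fun hx => hτa (hPP' hx)
  obtain ⟨T, σ, hTξ, -, hR⟩ := exists_rebuild hLS hAP hSt hC (ξ := ξ) (M := S) (N := N) (a := a)
    hδ hδμ hδμ.le (H := fun σ => σ b = b) (by simp) (fun σ τ h₁ h₂ => by simp [h₁, h₂])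
    (fun i _ hi => hSm i hi) ⟨_, hT₀, hSP₀⟩ hsucc (fun i j _ => hSmono i j)
    (fun j hj hlt hjδ => hlim j hj hlt hjδ.le) hξ
  obtain ⟨τ, hτb, hτ⟩ := hlim δ hδ hξ le_rfl σ hR.mem hR.coh
  obtain ⟨h₁, h₂⟩ := hR.pull hτ (fun i _ hi => (hUN i hi).le)
    fun i _ hi => hMS _ hi (h.mem i hi)
  -- Below `ξ` the models of `S` are kept. The automorphism `τ` fixes `b`, so `b` stays in the
  -- pulled-back model at `ξ`.
  let T' : Ordinal.{w} → L.Substructure C := fun j => if j < ξ then S j else img τ.symm (T j)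
  have hT'₁ : ∀ j, j < ξ → T' j = S j := fun j hj => if_pos hj
  have hT'₂ : ∀ j, ξ ≤ j → T' j = img τ.symm (T j) := fun j hj => if_neg hj.not_gt
  refine ⟨T', fun j hj => ?_, fun i j hij hj => ?_, fun j hj => ?_, ξ, hξ, ?_⟩
  · rcases lt_or_ge j ξ with hlt | hle
    · obtain ⟨R, hR, hMR, -⟩ := hS j hj
      exact ⟨R, by rwa [hT'₁ j hlt], hMR⟩
    · obtain ⟨R, hR, hMR, -⟩ := h₁ j hle hj
      exact ⟨R, by rwa [hT'₂ j hle], (hMS j hj).trans hMR⟩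
  · rcases lt_or_ge j ξ with hlt | hle
    · rw [hT'₁ j hlt, hT'₁ i (hij.trans_lt hlt)]
      exact hSmono i j hij hj
    · obtain ⟨R, hR, hMR, hTR⟩ := h₁ j hle hj
      rw [hT'₂ j hle]
      rcases lt_or_ge i ξ with hlt | hle'
      · rw [hT'₁ i hlt]
        exact (hSmono i j hij hj).trans (hMR.trans (hR.univIn hμ).le)
      · rw [hT'₂ i hle']
        rcases hij.eq_or_lt with rfl | hlt'
        · exact le_rfl
        · exact (hTR i hle' hlt').trans (hR.univIn hμ).le
  · rcases lt_or_ge j ξ with hlt | hle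
    · rw [hT'₁ j hlt]
      exact hSns j hj
    · rw [hT'₂ j hle]
      exact h₂ j hle (add_one_lt_of_lim hδ hj)
  · rw [hT'₂ ξ le_rfl, hTξ, mem_img]
    simpa [hτb] using (hT₀.univIn hμ).le hbP₀

end

section

variable {L : FirstOrder.Language.{u, v}} {K : AEC.{u, v, w} L} {μ : Cardinal.{w}}
variable {C : Type w} [L.Structure C]

/-! ### Towers and the monster model -/

/-- The union of a chain of length at most `μ⁺` of models in `K_μ` embeds into a monster model. -/
theorem exists_monster_embedding (hLS : K.LS ≤ μ) (hAP : K.Amalgamation μ) (hSt : K.Stable μ)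
    {A : Type w} [L.Structure A] {α : Ordinal.{w}} (hα : 0 < α) (hαμ : α ≤ (succ μ).ord)
    {S : Ordinal.{w} → L.Substructure A} (hS : ∀ i < α, K.Mod μ (S i))
    (mono : ∀ i j, i ≤ j → j < α → S i ≤ S j) (cover : ∀ x : A, ∃ i < α, x ∈ S i) :
    ∃ (C : Type w) (_ : L.Structure C) (e : A ↪[L] C), K.Monster μ C ∧ K.Strong e := by
  classical
  have hμ := (ls_spec hLS).1
  obtain ⟨C, _, hC, e₀, he₀⟩ := exists_monster hμ hAP hSt ⟨K.mem_dom (hS 0 hα).1, (hS 0 hα).2⟩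
  obtain ⟨c⟩ : Nonempty C := (nonempty_of_card hμ (hS 0 hα).2).map e₀
  have : Nonempty (A → C) := ⟨fun _ => c⟩
  let F₀ : A → C := fun x => if hx : x ∈ S 0 then e₀ ⟨x, hx⟩ else c
  have hF₀ : K.StrongOn F₀ (S 0) := ⟨e₀, he₀, fun x => by simp [F₀]⟩
  obtain ⟨f, hf⟩ := exists_transfinite (X := A → C)
    (fun j f F => K.StrongOn F (S j) ∧ (∀ x ∈ S 0, F x = F₀ x) ∧ ∀ i < j, ∀ x ∈ S i, F x = f i x)
    (fun j f g F hfg h => ⟨h.1, h.2.1, fun i hi => hfg i hi ▸ h.2.2 i hi⟩) α (by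
    intro j hj f hf
    obtain ⟨G, hG₀, hG, hGs⟩ := exists_glue_base (j := j) hF₀ (S := S) (F := f)
      (fun i hi => mono 0 i zero_le (hi.trans hj)) (fun i hi => (hf i hi).2.1)
      (fun i k hik hk => mono i k hik.le (hk.trans hj)) (fun i hi => (hf i hi).1)
      fun i k hik hk => (hf k hk).2.2 i hik
    obtain ⟨D, hD, hmem⟩ := exists_chain_union hμ (card_le_of_lt (hj.trans_le hαμ)) (hS 0 hα)
      (fun i hi => hS i (hi.trans hj)) (fun i hi => mono 0 i zero_le (hi.trans hj))
      fun i k hik hk => mono i k hik (hk.trans hj)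
    have hDj : D ≤ S j := fun x hx => by
      rcases (hmem x).1 hx with h | ⟨i, hi, h⟩
      · exact mono 0 j zero_le hj h
      · exact mono i j hi.le hj h
    obtain ⟨g, hg, hgG⟩ := hGs D hmem
    obtain ⟨h, hh, hhg⟩ := hC.exists_extension D (S j) g (Substructure.inclusion hDj) hD.2
      (hS j hj).2 hg (K.strong_inclusion hDj hD.1 (hS j hj).1)
    let F : A → C := fun x => if hx : x ∈ S j then h ⟨x, hx⟩ else c
    have hFG : ∀ x ∈ D, F x = G x := fun x hx => by
      have h₁ : F x = h ⟨x, hDj hx⟩ := dif_pos (hDj hx)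
      rw [h₁, ← hgG ⟨x, hx⟩, ← hhg]
      rfl
    refine ⟨F, ⟨h, hh, fun x => by simp [F]⟩, fun x hx => ?_, fun i hi x hx => ?_⟩
    · rw [hFG x ((hmem x).2 (Or.inl hx)), hG₀ x hx]
    · rw [hFG x ((hmem x).2 (Or.inr ⟨i, hi, hx⟩)), hG i hi x hx])
  obtain ⟨G, -, hG⟩ := exists_glue hα.ne' S mono f (fun i hi => (hf i hi).1)
    fun i k hik hk x hx => by
      rcases hik.eq_or_lt with rfl | hlt
      · rfl
      · exact (hf k hk).2.2 i hlt x hx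
  obtain ⟨e, he, -⟩ := hG ⊤ fun x => ⟨fun _ => cover x, fun _ => trivial⟩
  refine ⟨C, _, e.comp Substructure.topEquiv.symm.toEmbedding, hC, K.strong_comp
    (K.strong_equiv _ (K.mem_cod (hS 0 hα).1)) he⟩

theorem range_comp_subtype {A : Type w} [L.Structure A] (F : A ↪[L] C) (S : L.Substructure A) :
    (F.comp S.subtype).toHom.range = S.map F.toHom := by
  ext y
  rw [mem_range', Substructure.mem_map]
  exact ⟨fun ⟨x, hx⟩ => ⟨x, x.2, hx⟩, fun ⟨x, hx, h⟩ => ⟨⟨x, hx⟩, h⟩⟩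

namespace Tower

variable {α : Ordinal.{w}} {A : Type w} [L.Structure A]

theorem mod (T : Tower K μ α A) {i : Ordinal.{w}} (hi : i < α) : K.Mod μ (T.M i) :=
  ⟨T.strong i hi, (T.limit i hi).card⟩

theorem a_ne (T : Tower K μ α A) {i j : Ordinal.{w}} (hij : i < j) (hj : j + 1 < α) :
    T.a i ≠ T.a j := fun h => T.a_notMem j hj (h ▸ T.mono (i + 1) j (Order.add_one_le_of_lt hij)
  (lt_of_le_of_lt le_self_add hj) (T.a_mem i ((Order.add_one_le_of_lt hij).trans_lt
    (lt_of_le_of_lt le_self_add hj))))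

/-- A tower has length at most `μ⁺`. -/
theorem length_le (T : Tower K μ α A) : α ≤ (succ μ).ord := by
  -- For j < α, the elements a_i with i < j are distinct members of M_j, which has size μ.
  refine le_of_forall_lt fun j hj => ?_
  rw [Cardinal.lt_ord, Order.lt_succ_iff, ← (T.limit j hj).card]
  have key : ∀ i : Set.Iio j, T.a i ∈ T.M j := fun i =>
    T.mono _ j (Order.add_one_le_of_lt i.2) hj (T.a_mem i ((Order.add_one_le_of_lt i.2).trans_lt hj))
  have hinj : Function.Injective fun i : Set.Iio j => (⟨T.a i, key i⟩ : T.M j) := by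
    intro i k hik
    have hik' : T.a i = T.a k := congrArg Subtype.val hik
    rcases lt_trichotomy i.1 k.1 with h | h | h
    · exact absurd hik' (T.a_ne h ((Order.add_one_le_of_lt k.2).trans_lt hj))
    · exact Subtype.ext h
    · exact absurd hik'.symm (T.a_ne h ((Order.add_one_le_of_lt i.2).trans_lt hj))
  have h := Cardinal.lift_mk_le_lift_mk_of_injective hinj
  rwa [Cardinal.mk_Iio_ordinal, Cardinal.lift_lift, Cardinal.lift_le] at h

theorem towerData (hLS : K.LS ≤ μ) (hAP : K.Amalgamation μ) (hC : K.Monster μ C)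
    (T : Tower K μ α A) {e : A ↪[L] C} (he : K.Strong e) :
    K.TowerData μ α (fun i => (T.M i).map e.toHom) (fun i => (T.N i).map e.toHom)
      fun i => e (T.a i) where
  mod i hi := (T.mod hi).map he
  mono i j hij hj := by
    rintro _ ⟨x, hx, rfl⟩
    exact ⟨x, T.mono i j hij hj hx, rfl⟩
  univ i hi := by
    have h := (universalOver_iff hLS hC (K.strong_comp
      (T.strong i (lt_of_le_of_lt le_self_add hi)) he)).1 (T.univ i hi)
    rwa [range_comp_subtype, show (e.comp (T.M i).subtype).comp (Substructure.inclusion _) =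
      e.comp (T.N i).subtype from rfl, range_comp_subtype] at h
  mem i hi := ⟨_, T.a_mem i hi, rfl⟩
  notMem i hi := by
    rintro ⟨x, hx, h⟩
    exact T.a_notMem i hi (e.injective h ▸ hx)
  ns i hi := by
    have hi' : i < α := lt_of_le_of_lt le_self_add hi
    have hgt : IsGt (e.comp (T.M i).subtype) (e (T.a i)) _ :=
      isGt_tp (f := Substructure.inclusion (T.mono i (i + 1) le_self_add hi))
        (K.strong_inclusion _ (T.strong i hi') (T.strong (i + 1) hi)) (T.limit (i + 1) hi).card
        ⟨T.a i, T.a_mem i hi⟩ (K.strong_comp (T.strong (i + 1) hi) he)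
    have h := (not_splits_iff hLS hAP hC (K.strong_comp (T.strong i hi') he) hgt).1
      (T.nonsplit i hi)
    rwa [range_comp_subtype, show (e.comp (T.M i).subtype).comp (Substructure.inclusion _) =
      e.comp (T.N i).subtype from rfl, range_comp_subtype] at h

/-- The image of the tower `T` under `k` is given by `M`, `N` and `a`. -/
structure IsImage (T : Tower K μ α A) (k : A ↪[L] C) (M N : Ordinal.{w} → L.Substructure C)
    (a : Ordinal.{w} → C) : Prop where
  M_eq : ∀ i < α, (T.M i).map k.toHom = M i
  N_eq : ∀ i, i + 1 < α → (T.N i).map k.toHom = N i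
  a_eq : ∀ i, i + 1 < α → k (T.a i) = a i

theorem map_comap {k : A ↪[L] C} {S : L.Substructure C} (h : S ≤ k.toHom.range) :
    (S.comap k.toHom).map k.toHom = S := by
  rw [← range_comp_subtype, range_comp_comap k h]

theorem map_comp {B : Type w} [L.Structure B] (k : B ↪[L] C) (f : A ↪[L] B)
    (S : L.Substructure A) : (S.map f.toHom).map k.toHom = S.map (k.comp f).toHom := by
  ext y
  simp [Substructure.mem_map]

/-- The relations are checked in `C` and pulled back along the injective `k`. Universality is
assumed at every index, so equality of models needs no separate case. -/
theorem extends_of_isImage (hLS : K.LS ≤ μ) (hC : K.Monster μ C) {B : Type w} [L.Structure B]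
    {T : Tower K μ α A} {T' : Tower K μ α B} {k : B ↪[L] C} {f : A ↪[L] B}
    (hk : K.Strong k) (hf : K.Strong f) (hN : ∀ i, i + 1 < α →
      (T'.N i).map k.toHom = (T.N i).map (k.comp f).toHom)
    (ha : ∀ i, i + 1 < α → k (T'.a i) = k (f (T.a i)))
    (hM : ∀ i < α, K.UnivIn μ ((T.M i).map (k.comp f).toHom) ((T'.M i).map k.toHom)) :
    T.Extends T' f := by
  have hle : ∀ i < α, (T.M i).map f.toHom ≤ T'.M i := by
    rintro i hi _ ⟨x, hx, rfl⟩
    obtain ⟨y, hy, hyx⟩ := (hM i hi).le ⟨x, hx, rfl⟩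
    have : y = f x := k.injective hyx
    exact this ▸ hy
  refine ⟨fun i hi => k.injective (ha i hi), fun i hi => ?_, hle, fun i hi =>
    K.strong_inclusion _ ((T.mod hi).map hf).1 (T'.strong i hi), fun i hi _ => ?_⟩
  · refine Substructure.map_injective_of_injective (f := k.toHom) k.injective ?_
    rw [hN i hi, map_comp]
  · refine (universalOver_iff hLS hC (k := k.comp (T'.M i).subtype)
      (K.strong_comp (T'.strong i hi) hk)).2 ?_
    rw [range_comp_subtype, show (k.comp (T'.M i).subtype).comp (Substructure.inclusion _) =
      k.comp ((T.M i).map f.toHom).subtype from rfl, range_comp_subtype, map_comp]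
    exact hM i hi

theorem _root_.AEC.TowerData.exists_tower (hLS : K.LS ≤ μ) (hAP : K.Amalgamation μ)
    (hC : K.Monster μ C) {M N : Ordinal.{w} → L.Substructure C} {a : Ordinal.{w} → C}
    (h : K.TowerData μ α M N a) (hα : 0 < α) (hlim : ∀ i < α, ∃ θ R, K.LimD μ θ R (M i)) :
    ∃ (B : Type w) (_ : L.Structure B) (k : B ↪[L] C) (T : Tower K μ α B), K.Strong k ∧
      T.IsImage k M N a ∧ ∀ x, x ∈ k.toHom.range ↔ ∃ i < α, x ∈ M i := by
  classical
  have hμ := (ls_spec hLS).1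
  have : Nonempty (Set.Iio α) := ⟨⟨0, hα⟩⟩
  let D : L.Substructure C := ⨆ i : Set.Iio α, M i
  have hD : ∀ x, x ∈ D ↔ ∃ i < α, x ∈ M i := fun x => by
    rw [Substructure.mem_iSup_of_directed]
    · simp
    · exact fun i j => ⟨max i j, h.mono _ _ (le_max_left i j) (max i j).2,
        h.mono _ _ (le_max_right i j) (max i j).2⟩
  have hr : D.subtype.toHom.range = D := Substructure.range_subtype D
  have hMD : ∀ i < α, M i ≤ D.subtype.toHom.range := fun i hi x hx => by
    rw [hr]
    exact (hD x).2 ⟨i, hi, hx⟩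
  have hNM : ∀ i, i + 1 < α → N i ≤ M i := fun i hi => (h.univ i hi).le
  have hs : ∀ i < α, K.Strong (D.subtype.comp ((M i).comap D.subtype.toHom).subtype) :=
    fun i hi => (strong_range_iff _).1 (by rw [range_comp_comap _ (hMD i hi)]; exact (h.mod i hi).1)
  have hmono : ∀ i j, i ≤ j → j < α →
      (M i).comap D.subtype.toHom ≤ (M j).comap D.subtype.toHom :=
    fun i j hij hj x hx => h.mono i j hij hj hx
  have hDs : K.Strong D.subtype := strong_of_chain hα.ne'
    (fun i => (M i).comap D.subtype.toHom) hmono (fun x => (hD x).1 x.2) _ hs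
  obtain ⟨d⟩ : Nonempty D := (nonempty_of_card hμ (h.mod 0 hα).2).map
    fun x : M 0 => ⟨x, (hD x).2 ⟨0, hα, x.2⟩⟩
  have haD : ∀ i, i + 1 < α → a i ∈ D := fun i hi => (hD _).2 ⟨_, hi, h.mem i hi⟩
  -- The default `d` is used only at indices that the tower ignores.
  let a' : Ordinal.{w} → D := fun i => if hi : a i ∈ D then ⟨a i, hi⟩ else d
  have ha' : ∀ i, i + 1 < α → (a' i : C) = a i := fun i hi => by simp [a', haD i hi]
  have hst : ∀ i < α, K.Strong ((M i).comap D.subtype.toHom).subtype := fun i hi =>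
    K.coherence hDs (hs i hi)
  have hNle : ∀ i, i + 1 < α → (N i).comap D.subtype.toHom ≤ (M i).comap D.subtype.toHom :=
    fun i hi x hx => hNM i hi hx
  have hlim' : ∀ i < α, K.IsLimitModel μ ((M i).comap D.subtype.toHom) := fun i hi => by
    obtain ⟨θ, R, hR⟩ := hlim i hi
    exact LimD.isLimitModel hLS hC (hs i hi) (by rwa [range_comp_comap _ (hMD i hi)])
  have hmem : ∀ i, i + 1 < α → a' i ∈ (M (i + 1)).comap D.subtype.toHom := fun i hi => by
    show (a' i : C) ∈ M (i + 1)
    rw [ha' i hi]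
    exact h.mem i hi
  have hNr : ∀ i (hi : i + 1 < α), ((D.subtype.comp ((M i).comap D.subtype.toHom).subtype).comp
      (Substructure.inclusion (hNle i hi))).toHom.range = N i := fun i hi =>
    range_comp_comap D.subtype ((hNM i hi).trans (hMD i (lt_of_le_of_lt le_self_add hi)))
  refine ⟨D, inferInstance, D.subtype, ⟨fun i => (M i).comap D.subtype.toHom, a',
    fun i => (N i).comap D.subtype.toHom, fun x => (hD x).1 x.2, hmono, hst, hlim', hmem,
    fun i hi => ?_, hNle, fun i hi => ?_, fun i hi => ?_⟩, hDs,
    ⟨fun i hi => map_comap (hMD i hi), fun i hi => ?_, ha'⟩, fun x => by rw [hr, hD]⟩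
  · show (a' i : C) ∉ M i
    rw [ha' i hi]
    exact h.notMem i hi
  · have hi' : i < α := lt_of_le_of_lt le_self_add hi
    refine (universalOver_iff hLS hC (hs i hi')).2 ?_
    rw [hNr i hi, range_comp_comap _ (hMD i hi')]
    exact h.univ i hi
  · have hi' : i < α := lt_of_le_of_lt le_self_add hi
    have hgt : IsGt (D.subtype.comp ((M i).comap D.subtype.toHom).subtype) (a' i : C) _ :=
      isGt_tp (f := Substructure.inclusion (hmono i (i + 1) le_self_add hi))
        (K.strong_inclusion _ (hst i hi') (hst (i + 1) hi)) (hlim' (i + 1) hi).card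
        ⟨a' i, hmem i hi⟩ (hs (i + 1) hi)
    refine (not_splits_iff hLS hAP hC (hs i hi') hgt).2 ?_
    rw [hNr i hi, range_comp_comap _ (hMD i hi'), ha' i hi]
    exact h.ns i hi
  · exact map_comap ((hNM i hi).trans (hMD i (lt_of_le_of_lt le_self_add hi)))

end Tower

end

section

variable {L : FirstOrder.Language.{u, v}} {K : AEC.{u, v, w} L} {μ : Cardinal.{w}}
variable {C : Type w} [L.Structure C]

/-! ### Reduced towers are continuous -/

theorem img_refl (S : L.Substructure C) : img (FirstOrder.Language.Equiv.refl L C) S = S := by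
  ext x
  exact mem_img

/-- A tower of length `α > δ` has an extension, up to automorphisms that are trivial up to `δ`,
with a given element `b` in one of the first `δ` models. -/
theorem TowerData.exists_extension_mem_of_lt (hLS : K.LS ≤ μ) (hAP : K.Amalgamation μ)
    (hSt : K.Stable μ) (hC : K.Monster μ C) (hCont : K.SplittingContinuity μ) {α δ : Ordinal.{w}}
    (hδ : IsSuccLimit δ) (hδα : δ < α) (hαμ : α ≤ (succ μ).ord) {κ : Cardinal.{w}}
    (hκδ : κ ≤ δ.cof) (hκ : K.LocalCharacter μ κ) (hSym : K.Symmetry μ δ)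
    {M N : Ordinal.{w} → L.Substructure C} {a : Ordinal.{w} → C} (h : K.TowerData μ α M N a)
    (b : C) :
    ∃ (T : Ordinal.{w} → L.Substructure C) (σ : Ordinal.{w} → C ≃[L] C),
      (∀ i ≤ δ, σ i = FirstOrder.Language.Equiv.refl L C) ∧
      (∀ i j, i ≤ j → j < α → ∀ x ∈ M i, σ j x = σ i x) ∧
      K.TowerData μ α T (fun i => img (σ i) (N i)) (fun i => σ (i + 1) (a i)) ∧
      (∀ i < α, ∃ R, K.LimD μ δ R (T i) ∧ img (σ i) (M i) ≤ R) ∧ ∃ j < δ, b ∈ T j := by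
  have hμ := (ls_spec hLS).1
  have hδμ : δ < (succ μ).ord := hδα.trans_le hαμ
  obtain ⟨P, hP, hPmono, hPns, j₀, hj₀, hb⟩ := (h.restrict hδα.le).exists_extension_mem hLS hAP hSt
    hC hCont hδ hδμ hκδ hκ hSym b
  -- The new model at `δ` is taken over a model containing both `M δ` and all the new models below
  -- `δ`, joining the two halves; no continuity at `δ` is needed.
  obtain ⟨R₀, hR₀, hMR₀, hPR₀⟩ := exists_mod_family hLS (card_le_of_lt hδμ) (h.mod δ hδα)
    (fun _ => True) (T := P) fun i hi _ => by
      obtain ⟨R, hR, -⟩ := hP i hi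
      exact hR.mod hμ
  obtain ⟨T₀, hT₀⟩ := exists_limD hLS hAP hSt hC hδ hδμ hR₀
  obtain ⟨Q, σ, hQδ, hσδ, hQ⟩ := exists_rebuild hLS hAP hSt hC (ξ := δ) (N := N) (a := a) hδ hδμ
    hαμ (H := fun _ => True) trivial (fun _ _ _ _ => trivial) (fun i _ => h.mod i)
    ⟨_, hT₀, hMR₀⟩ (fun j _ hj P hP hle => by
      obtain ⟨τ, h₁, h₂, h₃⟩ := (h.ns j hj).exists_extension (h.univ j hj) hP hle (h.notMem j hj)
      exact ⟨τ, trivial, h₁, h₂, h₃⟩) (fun i j _ => h.mono i j) (fun j hj hlt hjα σ _ hσ => by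
      obtain ⟨τ, hτ⟩ := exists_aut_glue hLS hC hlt (hjα.trans_le hαμ)
        (fun i _ hij => h.mod i (hij.trans hjα))
        (fun i k _ hik hk => h.mono i k hik (hk.trans hjα)) hσ
      exact ⟨τ, trivial, hτ⟩) hδα
  classical
  obtain ⟨T, hT₁, hT₂⟩ : ∃ T : Ordinal.{w} → L.Substructure C,
      (∀ i < δ, T i = P i) ∧ ∀ i, δ ≤ i → T i = Q i :=
    ⟨fun i => if i < δ then P i else Q i, fun i hi => if_pos hi, fun i hi => if_neg hi.not_gt⟩
  -- Replacing `i` by `max δ i` makes the family trivial up to `δ`, since `σ δ` is the identity.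
  obtain ⟨τ, hτ₁, hτ₂⟩ : ∃ τ : Ordinal.{w} → C ≃[L] C,
      (∀ i ≤ δ, τ i = FirstOrder.Language.Equiv.refl L C) ∧ ∀ i, δ ≤ i → τ i = σ i :=
    ⟨fun i => σ (max δ i), fun i hi => by simp [max_eq_left hi, hσδ],
      fun i hi => by simp [max_eq_right hi]⟩
  have hcoh : ∀ i j, i ≤ j → j < α → ∀ x ∈ M i, τ j x = τ i x := by
    intro i j hij hj x hx
    rcases le_total j δ with hjδ | hjδ
    · rw [hτ₁ j hjδ, hτ₁ i (hij.trans hjδ)]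
    · rcases le_total i δ with hiδ | hiδ
      · rw [hτ₂ j hjδ, hQ.coh δ j le_rfl hjδ hj x (h.mono i δ hiδ hδα hx), hσδ, hτ₁ i hiδ]
      · rw [hτ₂ j hjδ, hτ₂ i hiδ, hQ.coh i j hiδ hij hj x hx]
  have hlim : ∀ i < α, ∃ R, K.LimD μ δ R (T i) ∧ img (τ i) (M i) ≤ R := by
    intro i hi
    rcases lt_or_ge i δ with hiδ | hiδ
    · rw [hT₁ i hiδ, hτ₁ i hiδ.le, img_refl]
      exact hP i hiδ
    · rw [hT₂ i hiδ, hτ₂ i hiδ]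
      obtain ⟨R, hR, hMR, -⟩ := hQ.lim i hiδ hi
      exact ⟨R, hR, hMR⟩
  have hMT : ∀ i < α, img (τ i) (M i) ≤ T i := fun i hi => by
    obtain ⟨R, hR, hMR⟩ := hlim i hi
    exact hMR.trans (hR.univIn hμ).le
  have hTm : ∀ i < α, K.Mod μ (T i) := fun i hi => by
    obtain ⟨R, hR, -⟩ := hlim i hi
    exact hR.mod hμ
  have hQmono : ∀ i j, δ ≤ i → i ≤ j → j < α → Q i ≤ Q j := by
    intro i j hi hij hj
    rcases hij.eq_or_lt with rfl | hlt
    · exact le_rfl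
    · obtain ⟨R, hR, -, hQR⟩ := hQ.lim j (hi.trans hij) hj
      exact (hQR i hi hlt).trans (hR.univIn hμ).le
  have hsucc : ∀ i, i < δ → i + 1 < δ := fun i hi => add_one_lt_of_lim hδ hi
  refine ⟨T, τ, hτ₁, hcoh, ⟨hTm, fun i j hij hj => ?_, fun i hi => ?_, fun i hi =>
    hMT (i + 1) hi (apply_mem_img.2 (h.mem i hi)), fun i hi => ?_, fun i hi => ?_⟩, hlim, j₀, hj₀,
    by rwa [hT₁ j₀ hj₀]⟩
  · rcases lt_or_ge j δ with hjδ | hjδ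
    · rw [hT₁ j hjδ, hT₁ i (hij.trans_lt hjδ)]
      exact hPmono i j hij hjδ
    · rw [hT₂ j hjδ]
      rcases lt_or_ge i δ with hiδ | hiδ
      · rw [hT₁ i hiδ]
        refine ((hPR₀ i hiδ trivial).trans (hT₀.univIn hμ).le).trans ?_
        rw [← hQδ]
        exact hQmono δ j le_rfl hjδ hj
      · rw [hT₂ i hiδ]
        exact hQmono i j hiδ hij hj
  · have hi' : i < α := lt_of_le_of_lt le_self_add hi
    exact ((h.univ i hi).img (τ i)).mono_right (hTm i hi') (hMT i hi')
  · rcases lt_or_ge i δ with hiδ | hiδ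
    · rw [hT₁ i hiδ, hτ₁ _ (hsucc i hiδ).le]
      exact (hPns i hiδ).2
    · rw [hT₂ i hiδ, hτ₂ _ (hiδ.trans le_self_add)]
      exact (hQ.ns i hiδ hi).2
  · rcases lt_or_ge i δ with hiδ | hiδ
    · rw [hT₁ i hiδ, hτ₁ _ (hsucc i hiδ).le, hτ₁ i hiδ.le, img_refl]
      exact (hPns i hiδ).1
    · rw [hT₂ i hiδ, hτ₂ _ (hiδ.trans le_self_add), hτ₂ i hiδ]
      exact (hQ.ns i hiδ hi).1

theorem Tower.Reduced.continuous (hLS : K.LS ≤ μ) (hAP : K.Amalgamation μ) (hSt : K.Stable μ)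
    (hCont : K.SplittingContinuity μ) {α δ : Ordinal.{w}} (hδ : IsSuccLimit δ) (hδα : δ < α)
    {κ : Cardinal.{w}} (hκδ : κ ≤ δ.cof) (hκ : K.LocalCharacter μ κ) (hSym : K.Symmetry μ δ)
    {A : Type w} [L.Structure A] {T : Tower K μ α A} (hT : T.Reduced) :
    (T.M δ : Set A) = ⋃ β < δ, (T.M β : Set A) := by
  have hμ := (ls_spec hLS).1
  refine Set.Subset.antisymm (fun b hb => ?_)
    (Set.iUnion₂_subset fun i hi => T.mono i δ hi.le hδα)
  have hα : 0 < α := hδ.bot_lt.trans hδα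
  obtain ⟨C, _, e, hC, he⟩ := exists_monster_embedding hLS hAP hSt hα T.length_le
    (fun i => T.mod) T.mono T.union
  obtain ⟨P, σ, hσδ, hσ, hP, hlim, j, hj, hbj⟩ :=
    (T.towerData hLS hAP hC he).exists_extension_mem_of_lt hLS hAP hSt hC hCont hδ hδα T.length_le
      hκδ hκ hSym (e b)
  obtain ⟨B, _, k, T', hk, himg, hrange⟩ := hP.exists_tower hLS hAP hC hα fun i hi => by
    obtain ⟨R, hR, -⟩ := hlim i hi
    exact ⟨δ, R, hR⟩
  have hmap : ∀ i x, x ∈ T.M i → e x ∈ (T.M i).map e.toHom := fun i x hx => ⟨x, hx, rfl⟩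
  -- The maps `σ i ∘ e` cohere on the tower and glue to an embedding of its union. This works for
  -- length μ⁺ too, as no extension to an automorphism is sought.
  obtain ⟨F, hF, hFs⟩ := exists_glue hα.ne' T.M T.mono (fun i x => σ i (e x))
    (fun i hi => (StrongOn.of_embedding he (T.strong i hi)).comp (g := (σ i).toEmbedding)
      (K.strong_equiv _ hC.mem))
    fun i l hil hl x hx => hσ i l hil hl _ (hmap i x hx)
  obtain ⟨F', hF's, hF'⟩ := hFs ⊤ fun x => ⟨fun _ => T.union x, fun _ => trivial⟩
  obtain ⟨g, hg, hgx⟩ : ∃ g : A ↪[L] C, K.Strong g ∧ ∀ i < α, ∀ x ∈ T.M i, g x = σ i (e x) :=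
    ⟨F'.comp Substructure.topEquiv.symm.toEmbedding,
      K.strong_comp (K.strong_equiv _ (K.mem_dom he)) hF's,
      fun i hi x hx => (hF' _).trans (hF i hi x hx)⟩
  have hMimg : ∀ i < α, ∀ S ≤ T.M i, S.map g.toHom = img (σ i) (S.map e.toHom) := by
    intro i hi S hS
    ext y
    constructor
    · rintro ⟨x, hx, rfl⟩
      exact ⟨e x, ⟨x, hx, rfl⟩, (hgx i hi x (hS hx)).symm⟩
    · rintro ⟨_, ⟨x, hx, rfl⟩, rfl⟩
      exact ⟨x, hx, hgx i hi x (hS hx)⟩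
  have hPle : ∀ i < α, img (σ i) ((T.M i).map e.toHom) ≤ P i := fun i hi => by
    obtain ⟨R, hR, hle⟩ := hlim i hi
    exact hle.trans (hR.univIn hμ).le
  obtain ⟨f, hf, rfl⟩ : ∃ f : A ↪[L] B, K.Strong f ∧ k.comp f = g := exists_factor hk hg fun x => by
    obtain ⟨i, hi, hx⟩ := T.union x
    refine (mem_range' k _).1 ((hrange _).2 ⟨i, hi, ?_⟩)
    rw [hgx i hi x hx]
    exact hPle i hi (apply_mem_img.2 (hmap i x hx))
  have hext : T.Extends T' f := by
    refine Tower.extends_of_isImage hLS hC hk hf (fun i hi => ?_) (fun i hi => ?_) fun i hi => ?_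
    · rw [himg.N_eq i hi, hMimg i (lt_of_le_of_lt le_self_add hi) _ (T.N_le i hi)]
    · rw [himg.a_eq i hi]
      exact (hgx (i + 1) hi _ (T.a_mem i hi)).symm
    · obtain ⟨R, hR, hle⟩ := hlim i hi
      rw [himg.M_eq i hi, hMimg i hi _ le_rfl]
      exact (hR.univIn hμ).mono_left (((T.mod hi).map he).img _) hle hLS hAP hC
  have hjα : j < α := hj.trans hδα
  -- This is where triviality of `σ δ` is used: `b` lies in the model at `δ`, so its image is the
  -- element that was put into the `j`-th model.
  have hkfb : k (f b) = e b := by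
    have := hgx δ hδα b hb
    rwa [hσδ δ le_rfl] at this
  have hfb : f b ∈ T'.M j := by
    rw [← himg.M_eq j hjα, ← hkfb] at hbj
    obtain ⟨y, hy, hyb⟩ := hbj
    have : y = f b := k.injective hyb
    exact this ▸ hy
  have key : f b ∈ f '' (T.M j : Set A) := by
    rw [← hT B T' f hext j hjα]
    exact ⟨hfb, Set.mem_iUnion₂.2 ⟨δ, hδα, b, hb, rfl⟩⟩
  obtain ⟨x, hx, hxb⟩ := key
  exact Set.mem_iUnion₂.2 ⟨j, hj, f.injective hxb ▸ hx⟩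

end

end AEC

theorem theorem4p4 {L : FirstOrder.Language.{u, v}} (K : AEC.{u, v, w} L) (μ : Cardinal.{w})
    (hLS : K.LS ≤ μ)
    (hJEP : K.JointEmbedding μ) (hAP : K.Amalgamation μ) (hNMM : K.NoMaximal μ)
    (hStable : K.Stable μ)
    (hκ : K.kappaStar μ < ((Order.succ μ : Cardinal.{w}) : WithTop Cardinal.{w}))
    (hCont : K.SplittingContinuity μ)
    (α δ : Ordinal.{w}) (hδ : Order.IsSuccLimit δ) (hδα : δ < α)
    (hcof : K.kappaStar μ ≤ ((δ.cof : Cardinal.{w}) : WithTop Cardinal.{w}))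
    (hSym : K.Symmetry μ δ)
    {A : Type w} [L.Structure A] (T : AEC.Tower K μ α A) (hT : T.Reduced) :
    (T.M δ : Set A) = ⋃ β < δ, (T.M β : Set A) := by
  obtain ⟨κ, hκδ, hκ'⟩ := AEC.exists_localCharacter hκ hcof
  exact hT.continuous hLS hAP hStable hCont hδ hδα hκδ hκ' hSym
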